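/- Write $\lg=\log_2$. A problem $P$ assigns to every bit string $\vec I\in\{0,1\}^n$ (for every $n$) its correct output $P(\vec I)\in\mathbb N$. A *good low-degree polynomial* for $P$ consists, for each input length $n$, of a prime $p=p(n)$, a number $d=d(n)$, a partition of the $n$ input positions into $d$ sets $S_1,\dots,S_d$, and a polynomial $f$ in $x_1,\dots,x_n$ over $\mathbb F_p$ such that - there is a constant $c$ with $p(n)<n^c$ for all large $n$, and $0\le P(\vec I)\le p-1$ for all $\vec I\in\{0,1\}^n$; - $f(b_1,\dots,b_n)=P(\vec I)$ in $\mathbb F_p$ for every $\vec I=(b_1,\dots,b_n)\in\{0,1\}^n$; - $f$ is strongly $d$-partite: in every monomial of $f$ all exponents are at most $1$ and no two distinct variables lie in the same set $S_m$ (so $\deg f\le d$); - $d(n)=o(\lg n/\lg\lg n)$. Algorithms are (randomized, fair-coin) word-RAM programs with words of $O(\log n)$ bits and unit-cost instructions. Besides the $n$-bit input they have a read-only table of the constants that belong to the problem at length $n$ and do not depend on the input: $n$, $p(n)$, $d(n)$, the index of the set $S_m$ containing each input position, and the binary digits of $\mu$. An algorithm runs in time $T(n)$ if on every input of length $n$ and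 for all coin tosses it halts within $T(n)$ steps. **Theorem.** Let $0<\mu<1$ be a constant, let $P$ be a problem that has a good low-degree polynomial, with $d=d(n)$ as above, and let $A$ be an algorithm that runs in time $T(n)$ such that, for some function $g(n)=\omega\big((\lg n)^{d}(\lg\lg n)^{d}\big)$ and all large $n$, when $\vec I$ consists of $n$ bits chosen i.i.d. from $\mathrm{Ber}(\mu)$, $$\Pr[A(\vec I)=P(\vec I)]\ \ge\ 1-\frac1{g(n)}.$$ Then there is a randomized algorithm $B$ that runs in time $\tilde O(n+T(n))$ such that for every $n$ and every $\vec I\in\{0,1\}^n$ $$\Pr[B(\vec I)=P(\vec I)]\ \ge\ 1-O\big(2^{-(\lg n)^2}\big),$$ where the implied constant does not depend on $n$ or $\vec I$. Here $\tilde O(n+T(n))$ means $(n+T(n))\cdot n^{o(1)}$, and, if $d(n)$ is bounded, the running time of the same $B$ is moreover $(n+T(n))\cdot(\lg n)^{O(1)}$. -/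

import Mathlib

open Filter Topology Asymptotics

noncomputable section

namespace AvgCase

/-- Base-two logarithm. -/
def lg (x : ℝ) : ℝ := Real.logb 2 x

/-! ### Problems and good low-degree polynomials -/

/-- A problem assigns to every bit string (of any length `n`) its correct output, a natural
number. -/
abbrev Problem : Type := (n : ℕ) → (Fin n → Bool) → ℕ

/-- `f` is strongly partite with respect to the partition `part` of its variables into `d` sets:
in every monomial of `f` all variables have exponent one, and no two different variables of the
monomial lie in the same set. In particular `f` has degree at most `d`. -/
def StronglyPartite {R : Type*} [CommSemiring R] {n d : ℕ}
    (part : Fin n → Fin d) (f : MvPolynomial (Fin n) R) : Prop :=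
  ∀ m ∈ f.support,
    (∀ i, m i ≤ 1) ∧ ∀ i j, i ≠ j → m i ≠ 0 → m j ≠ 0 → part i ≠ part j

/-- A good low-degree polynomial for the problem `P`: for each input length `n` a prime `p n`, a
number `d n` of parts, a partition of the `n` variables into `d n` sets and a polynomial over the
field with `p n` elements. -/
structure GoodPolynomial (P : Problem) where
  /-- the modulus -/
  p : ℕ → ℕ
  p_prime : ∀ n, (p n).Prime
  p_lt : ∃ c : ℕ, ∀ᶠ n in atTop, p n < n ^ c
  /-- the output is an integer in the range `[0, p - 1]` -/
  output_lt : ∀ n I, P n I < p n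
  /-- the number of parts, which bounds the degree -/
  d : ℕ → ℕ
  d_isLittleO : (fun n => (d n : ℝ)) =o[atTop] (fun n : ℕ => lg n / lg (lg n))
  /-- the partition of the variables -/
  part : (n : ℕ) → Fin n → Fin (d n)
  /-- the polynomial -/
  f : (n : ℕ) → MvPolynomial (Fin n) (ZMod (p n))
  stronglyPartite : ∀ n, StronglyPartite (part n) (f n)
  eval_eq : ∀ n (I : Fin n → Bool),
    MvPolynomial.eval (fun i => if I i then 1 else 0) (f n) = (P n I : ZMod (p n))

/-! ### Randomized word-RAM programs -/

/-- Binary word operations. -/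
inductive BinOp
  | add | sub | mul | div | mod | land | lor | xor | shl | shr

/-- The effect of a binary operation on two words of `w` bits; the result is reduced modulo
`2 ^ w` (and subtraction wraps around). -/
def BinOp.eval (w : ℕ) : BinOp → ℕ → ℕ → ℕ
  | .add, a, b => (a + b) % 2 ^ w
  | .sub, a, b => (a + (2 ^ w - b)) % 2 ^ w
  | .mul, a, b => (a * b) % 2 ^ w
  | .div, a, b => (a / b) % 2 ^ w
  | .mod, a, b => (a % b) % 2 ^ w
  | .land, a, b => (a &&& b) % 2 ^ w
  | .lor, a, b => (a ||| b) % 2 ^ w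
  | .xor, a, b => (a ^^^ b) % 2 ^ w
  | .shl, a, b => (a <<< b) % 2 ^ w
  | .shr, a, b => (a >>> b) % 2 ^ w

/-- Programs of a random access machine. Registers are named by natural numbers; a program
mentions only finitely many of them. -/
inductive Prog
  /-- do nothing -/
  | skip
  /-- `r := k` -/
  | const (r k : ℕ)
  /-- `r := o a b` -/
  | op (o : BinOp) (r a b : ℕ)
  /-- `r := memory[a]` -/
  | load (r a : ℕ)
  /-- `memory[a] := r` -/
  | store (a r : ℕ)
  /-- `r :=` the input bit at position `a` -/
  | input (r a : ℕ)
  /-- `r :=` the word at position `a` of the read-only table -/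
  | table (r a : ℕ)
  /-- `r :=` a fresh uniformly random bit -/
  | flip (r : ℕ)
  | seq (x y : Prog)
  /-- `if r ≠ 0 then x else y` -/
  | ite (r : ℕ) (x y : Prog)
  /-- `while r ≠ 0 do x` -/
  | loop (r : ℕ) (x : Prog)

/-- What a program cannot change: the word length in bits, the input and the read-only table. -/
structure Env where
  w : ℕ
  input : ℕ → ℕ
  table : ℕ → ℕ

/-- Registers, memory, and the number of steps performed so far. -/
structure State where
  reg : ℕ → ℕ
  mem : ℕ → ℕ
  time : ℕ

/-- Everything is zero at the start. -/
def State.start : State := ⟨fun _ => 0, fun _ => 0, 0⟩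

/-- Perform one step that changes nothing else. -/
def State.tick (s : State) : State := { s with time := s.time + 1 }

/-- Perform one step that writes `v` into register `r`. -/
def State.setReg (s : State) (r v : ℕ) : State :=
  { s with reg := Function.update s.reg r v, time := s.time + 1 }

/-- Perform one step that writes `v` into memory cell `a`. -/
def State.setMem (s : State) (a v : ℕ) : State :=
  { s with mem := Function.update s.mem a v, time := s.time + 1 }

/-- The distribution of the final state. The first argument bounds the nesting depth of the
evaluation; `none` means that this bound did not suffice. Every instruction and every test of a
branch or a loop is one step. -/
def exec (E : Env) : ℕ → Prog → State → PMF (Option State)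
  | 0, _, _ => PMF.pure none
  | _ + 1, .skip, s => PMF.pure (some s.tick)
  | _ + 1, .const r k, s => PMF.pure (some (s.setReg r (k % 2 ^ E.w)))
  | _ + 1, .op o r a b, s => PMF.pure (some (s.setReg r (o.eval E.w (s.reg a) (s.reg b))))
  | _ + 1, .load r a, s => PMF.pure (some (s.setReg r (s.mem (s.reg a))))
  | _ + 1, .store a r, s => PMF.pure (some (s.setMem (s.reg a) (s.reg r)))
  | _ + 1, .input r a, s => PMF.pure (some (s.setReg r (E.input (s.reg a) % 2 ^ E.w)))
  | _ + 1, .table r a, s => PMF.pure (some (s.setReg r (E.table (s.reg a) % 2 ^ E.w)))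
  | _ + 1, .flip r, s =>
      (PMF.uniformOfFintype Bool).map fun b => some (s.setReg r (b.toNat % 2 ^ E.w))
  | k + 1, .seq x y, s =>
      (exec E k x s).bind fun o =>
        match o with
        | none => PMF.pure none
        | some s' => exec E k y s'
  | k + 1, .ite r x y, s => if s.reg r ≠ 0 then exec E k x s.tick else exec E k y s.tick
  | k + 1, .loop r x, s =>
      if s.reg r ≠ 0 then
        (exec E k x s.tick).bind fun o =>
          match o with
          | none => PMF.pure none
          | some s' => exec E k (.loop r x) s'
      else PMF.pure (some s.tick)

/-- An algorithm: a program, and the constant in its word length `O(log n)`. -/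
structure Algorithm where
  code : Prog
  wordConst : ℕ

/-- Word length on inputs of length `n`. -/
def Algorithm.wordLength (A : Algorithm) (n : ℕ) : ℕ := A.wordConst * (Nat.log 2 n + 1)

/-- The read-only table for inputs of length `n`. It lists the constants that belong to the
problem at this length: `n`, the modulus, the number of parts, the part of each of the `n` input
positions, and then the binary digits of `μ` after the binary point. It does not depend on the
input. -/
def problemTable {P : Problem} (G : GoodPolynomial P) (μ : ℝ) (n : ℕ) : ℕ → ℕ
  | 0 => n
  | 1 => G.p n
  | 2 => G.d n
  | k + 3 => if h : k < n then (G.part n ⟨k, h⟩ : ℕ) else ⌊μ * 2 ^ (k - n + 1)⌋₊ % 2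

/-- The environment in which the algorithm `A` runs on the input `I`. -/
def Algorithm.env {P : Problem} (A : Algorithm) (G : GoodPolynomial P) (μ : ℝ)
    (n : ℕ) (I : Fin n → Bool) : Env where
  w := A.wordLength n
  input k := if h : k < n then (I ⟨k, h⟩).toNat else 0
  table := problemTable G μ n

/-- On every input of length `n` and for all outcomes of its coin tosses, `A` halts after at most
`T n` steps. -/
def Algorithm.RunsInTime {P : Problem} (A : Algorithm) (G : GoodPolynomial P) (μ : ℝ)
    (T : ℕ → ℕ) : Prop :=
  ∀ n (I : Fin n → Bool), ∃ k, ∀ o ∈ (exec (A.env G μ n I) k A.code State.start).support,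
    ∃ s : State, o = some s ∧ s.time ≤ T n

/-- The probability, over the coin tosses of `A`, that `A` halts on input `I` with the correct
output `P n I` in register `0`. -/
def Algorithm.successProb {P : Problem} (A : Algorithm) (G : GoodPolynomial P) (μ : ℝ)
    (n : ℕ) (I : Fin n → Bool) : ℝ :=
  (⨆ k, (exec (A.env G μ n I) k A.code State.start).toOuterMeasure
    {o | ∃ s : State, o = some s ∧ s.reg 0 = P n I}).toReal

/-- The probability that `A` is correct when the `n` input bits are chosen independently, each of
them being `1` with probability `μ` (and over the coin tosses of `A`). -/
def Algorithm.avgSuccessProb {P : Problem} (A : Algorithm) (G : GoodPolynomial P) (μ : ℝ)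
    (n : ℕ) : ℝ :=
  ∑ I : Fin n → Bool, (∏ i, if I i then μ else 1 - μ) * A.successProb G μ n I

/-! ### Asymptotics -/

/-- `F ≤ n ^ o(1) * G`: the notation `F = Õ(G)` where `Õ` hides subpolynomial factors. -/
def SoftO (F G : ℕ → ℝ) : Prop :=
  ∃ ε : ℕ → ℝ, Tendsto ε atTop (𝓝 0) ∧ ∀ᶠ n : ℕ in atTop, F n ≤ (n : ℝ) ^ ε n * G n

/-- `F = O(G * polylog n)`. -/
def PolylogO (F G : ℕ → ℝ) : Prop :=
  ∃ k : ℕ, ∀ᶠ n : ℕ in atTop, F n ≤ lg n ^ k * G n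

/-- `g = ω(h)`. -/
def IsLittleOmega (g h : ℕ → ℝ) : Prop :=
  Tendsto (fun n => g n / h n) atTop atTop

end AvgCase

end

/-!
The algorithm `B` rests on a self-reduction from an arbitrary input to random ones. Choose weights
`cf j` in `𝔽_p` with sum `1`, and write each input bit as a random affine combination
`I i = ∑ j < K, cf j * b i j` with bits `b i j`. A strongly partite polynomial is affine in each of
its `d` blocks of variables, so that (`StronglyPartite.eval_sum`)
`P I = ∑ τ, (∏ m, cf (τ m)) * P (fun i => b i (τ (part i)))`, where `τ` runs over the `K ^ d` choices
of a column for each block. Every term is a call of the given algorithm, and the right-hand side is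
exact as soon as all calls are right. A query uses only one bit of each row `b i ·`. If rows are
sampled independently and each single bit is `1` with probability about `μ`, every query is
distributed almost like the inputs for which the average-case algorithm is guaranteed to be right.

The rows come from randomized binary expansions. The first bit of a row has the weight that makes
the sum of all weights `1`. The residue modulo `p` that remains has a representative `t` close to
the expectation of `∑ i ≤ l, 2 ^ i * N i` for digits `N i` of mean `μ * R`. Digits are split off
from `t` with unbiased random rounding, which keeps the prospects of the last digit unchanged in
expectation (`digit_step`). A digit `N` is spread as `N` ones over `R` cells at a uniformly random
cyclic position, so that each cell is `1` with probability `N / R`. The rounding of `μ` and the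
residue, which moves the last digit a little, cost a factor `1 + 1 / n` in the probability of each
bit (`bern_le_digit`, `bern_le_last`) and a factor `(1 + 1 / n) ^ n ≤ 3` for a query (`sum_err_le`).
Here `K = O(lg n)`, so the `K ^ d` queries of a repetition are all answered correctly with
probability at least `15 / 16`, by the assumption on `g`. The number of repetitions is the square of
the number of bits of `n`; a majority vote with a candidate and its lead (`vote_spec`) has the
potential `4 ^ (± lead)`, which halves with each repetition in expectation (`repetition_spec`).

All of this is carried out for a concrete word-RAM program `mainProg`. Programs are analysed by the
expectation transformer `wp`, with values in `[0, ∞]`: a run that does not halt, takes too long or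
violates an invariant counts as `∞`, so that one finite bound states termination, running time,
invariants and error probability together (`Tri`, `guard`, `penalty`). Programs are written with
expressions and variables, for which `TriL` has one rule per construct, and word arithmetic is exact
because all numbers are polynomial in `n`. The given algorithm runs as a subroutine (`sim`) with its
own word length. The steps `row_spec`, `rows_spec`, `query_spec`, `queries_spec`, `repetition_spec`
lead to `mainProg_spec`. Finally `mainTime_le` and the section on growth rates give the running
time: `d = o(lg n / lg lg n)` makes `K ^ d`, and with it the whole overhead, equal to `n ^ o(1)`.
-/

open scoped ENNReal

namespace AvgCase

/-! ### Expectation transformers for programs -/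

/-- The value of `f` at the outcome of a run, where an unfinished run has the value `z`. -/
def optVal (z : ℝ≥0∞) (f : State → ℝ≥0∞) : Option State → ℝ≥0∞
  | none => z
  | some s => f s

/-- The expectation of `f` in the final state of the program, computed by recursion along `exec`;
runs that exceed the nesting depth count with the value `z`. -/
noncomputable def wp (E : Env) (z : ℝ≥0∞) : ℕ → Prog → (State → ℝ≥0∞) → State → ℝ≥0∞
  | 0, _, _, _ => z
  | _ + 1, .skip, f, s => f s.tick
  | _ + 1, .const r k, f, s => f (s.setReg r (k % 2 ^ E.w))
  | _ + 1, .op o r a b, f, s => f (s.setReg r (o.eval E.w (s.reg a) (s.reg b)))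
  | _ + 1, .load r a, f, s => f (s.setReg r (s.mem (s.reg a)))
  | _ + 1, .store a r, f, s => f (s.setMem (s.reg a) (s.reg r))
  | _ + 1, .input r a, f, s => f (s.setReg r (E.input (s.reg a) % 2 ^ E.w))
  | _ + 1, .table r a, f, s => f (s.setReg r (E.table (s.reg a) % 2 ^ E.w))
  | _ + 1, .flip r, f, s =>
      2⁻¹ * f (s.setReg r (0 % 2 ^ E.w)) + 2⁻¹ * f (s.setReg r (1 % 2 ^ E.w))
  | k + 1, .seq x y, f, s => wp E z k x (wp E z k y f) s
  | k + 1, .ite r x y, f, s => if s.reg r ≠ 0 then wp E z k x f s.tick else wp E z k y f s.tick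
  | k + 1, .loop r x, f, s =>
      if s.reg r ≠ 0 then wp E z k x (wp E z k (.loop r x) f) s.tick else f s.tick

/-- The law of total expectation. -/
theorem tsum_bind_mul {α β : Type*} (p : PMF α) (q : α → PMF β) (g : β → ℝ≥0∞) :
    ∑' o, (p.bind q) o * g o = ∑' a, p a * ∑' o, q a o * g o := by
  simp only [PMF.bind_apply, ← ENNReal.tsum_mul_right, ← ENNReal.tsum_mul_left]
  rw [ENNReal.tsum_comm]
  simp only [mul_assoc]

/-- The recursion for `wp` does compute the expectation with respect to the distribution `exec`. -/
theorem wp_eq_tsum (E : Env) (z : ℝ≥0∞) (k : ℕ) (c : Prog) (f : State → ℝ≥0∞) (s : State) :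
    wp E z k c f s = ∑' o, exec E k c s o * optVal z f o := by
  induction k generalizing c f s with
  | zero => simp [wp, exec, optVal]
  | succ k ih =>
    have hbind : ∀ (y : Prog) (f : State → ℝ≥0∞) (p : PMF (Option State))
        (q : Option State → PMF (Option State)), q none = PMF.pure none →
        (∀ s, q (some s) = exec E k y s) →
        ∑' o, (p.bind q) o * optVal z f o = ∑' o, p o * optVal z (wp E z k y f) o := by
      intro y f p q h0 h1
      rw [tsum_bind_mul]
      refine tsum_congr fun o => ?_
      cases o with
      | none => simp [h0, optVal]
      | some s' => simp [h1, optVal, ih]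
    cases c with
    | flip r =>
      simp only [wp, exec, PMF.map, Function.comp_def]
      rw [tsum_bind_mul]
      simp [optVal, PMF.uniformOfFintype_apply, add_comm]
    | seq x y =>
      simp only [wp, exec]
      rw [ih]
      exact (hbind y f _ _ (by rfl) fun _ => by rfl).symm
    | ite r x y =>
      simp only [wp, exec]
      split_ifs <;> rw [ih]
    | loop r x =>
      simp only [wp, exec]
      split_ifs
      · rw [ih]
        exact (hbind (.loop r x) f _ _ (by rfl) fun _ => by rfl).symm
      · simp [optVal]
    | _ => simp [wp, exec, optVal]

theorem wp_mono {E : Env} {z : ℝ≥0∞} {k : ℕ} {c : Prog} {f g : State → ℝ≥0∞} (h : ∀ s, f s ≤ g s)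
    (s : State) : wp E z k c f s ≤ wp E z k c g s := by
  induction k generalizing c f g s with
  | zero => simp [wp]
  | succ k ih =>
    cases c with
    | flip r => simp only [wp]; gcongr <;> apply h
    | seq x y => simp only [wp]; exact ih (ih h) s
    | ite r x y => simp only [wp]; split_ifs <;> exact ih h _
    | loop r x =>
      simp only [wp]; split_ifs
      · exact ih (ih h) _
      · exact h _
    | _ => simp only [wp]; apply h

/-- With the value `∞` for unfinished runs, a larger nesting depth only lowers the expectation. -/
theorem wp_top_succ_le (E : Env) (k : ℕ) (c : Prog) (f : State → ℝ≥0∞) (s : State) :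
    wp E ⊤ (k + 1) c f s ≤ wp E ⊤ k c f s := by
  induction k generalizing c f s with
  | zero => simp [wp]
  | succ k ih =>
    cases c with
    | seq x y => rw [wp, wp]; exact (ih x _ s).trans (wp_mono (ih y f) s)
    | ite r x y => rw [wp, wp]; split_ifs <;> exact ih _ _ _
    | loop r x =>
      rw [wp, wp]; split_ifs
      · exact (ih x _ _).trans (wp_mono (ih _ f) _)
      · exact le_rfl
    | _ => simp only [wp]; exact le_rfl

/-- With the value `0` for unfinished runs, a larger nesting depth only raises the expectation. -/
theorem wp_zero_le_succ (E : Env) (k : ℕ) (c : Prog) (f : State → ℝ≥0∞) (s : State) :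
    wp E 0 k c f s ≤ wp E 0 (k + 1) c f s := by
  induction k generalizing c f s with
  | zero => simp [wp]
  | succ k ih =>
    cases c with
    | seq x y => rw [wp, wp]; exact (wp_mono (ih y f) s).trans (ih x _ s)
    | ite r x y => rw [wp, wp]; split_ifs <;> exact ih _ _ _
    | loop r x =>
      rw [wp, wp]; split_ifs
      · exact (wp_mono (ih _ f) _).trans (ih x _ _)
      · exact le_rfl
    | _ => simp only [wp]; exact le_rfl

theorem wp_top_antitone (E : Env) (c : Prog) (f : State → ℝ≥0∞) (s : State) :
    Antitone fun k => wp E ⊤ k c f s :=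
  antitone_nat_of_succ_le fun k => wp_top_succ_le E k c f s

/-- Only finitely many states are reachable within a given nesting depth, so that a pointwise
choice of a nesting depth for the continuation can be made uniform. -/
theorem exists_wp_le {E : Env} {h : ℕ → State → ℝ≥0∞} {g : State → ℝ≥0∞} (hh : Antitone h)
    (hg : ∀ s, ∃ j, h j s ≤ g s) (k : ℕ) (c : Prog) (s : State) :
    ∃ j, wp E ⊤ k c (h j) s ≤ wp E ⊤ k c g s := by
  induction k generalizing c h g s with
  | zero => exact ⟨0, by simp [wp]⟩
  | succ k ih =>
    have anti : ∀ y, Antitone fun j => wp E ⊤ k y (h j) :=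
      fun y i j hij s => wp_mono (hh hij) s
    cases c with
    | flip r =>
      obtain ⟨i, hi⟩ := hg (s.setReg r (0 % 2 ^ E.w))
      obtain ⟨j, hj⟩ := hg (s.setReg r (1 % 2 ^ E.w))
      refine ⟨max i j, ?_⟩
      simp only [wp]
      gcongr
      · exact (hh (le_max_left i j) _).trans hi
      · exact (hh (le_max_right i j) _).trans hj
    | seq x y =>
      simp only [wp]
      exact ih (anti y) (fun s => ih hh hg y s) x s
    | ite r x y =>
      simp only [wp]
      split_ifs
      · exact ih hh hg _ _
      · exact ih hh hg _ _
    | loop r x =>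
      simp only [wp]
      split_ifs
      · exact ih (anti _) (fun s => ih hh hg _ s) x _
      · exact hg _
    | _ => simp only [wp]; exact hg _

/-- The program halts for all outcomes of its coin tosses, and the expectation of `f` in its final
state is at most `v`. Since `f` may take the value `∞`, a finite `v` also says that the final state
surely avoids the states where `f` is infinite. -/
def Tri (E : Env) (c : Prog) (s : State) (f : State → ℝ≥0∞) (v : ℝ≥0∞) : Prop :=
  ∃ k, wp E ⊤ k c f s ≤ v

namespace Tri

variable {E : Env} {c x y : Prog} {s : State} {f g : State → ℝ≥0∞} {v v' : ℝ≥0∞}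

theorem mono (h : Tri E c s f v) (hf : ∀ s, g s ≤ f s) (hv : v ≤ v') : Tri E c s g v' := by
  obtain ⟨k, hk⟩ := h
  exact ⟨k, (wp_mono hf s).trans (hk.trans hv)⟩

theorem top : Tri E c s f ⊤ := ⟨0, le_top⟩

theorem seq (hx : Tri E x s g v) (hy : ∀ s', Tri E y s' f (g s')) : Tri E (.seq x y) s f v := by
  obtain ⟨k, hk⟩ := hx
  obtain ⟨j, hj⟩ := exists_wp_le (h := fun j => wp E ⊤ j y f)
    (fun i j hij s => wp_top_antitone E y f s hij) hy k x s
  refine ⟨max k j + 1, ?_⟩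
  simp only [wp]
  calc _ ≤ wp E ⊤ (max k j) x (wp E ⊤ j y f) s :=
        wp_mono (fun s => wp_top_antitone E y f s (le_max_right k j)) s
    _ ≤ wp E ⊤ k x (wp E ⊤ j y f) s := wp_top_antitone E x _ s (le_max_left k j)
    _ ≤ v := hj.trans hk

theorem ite {r : ℕ} (hx : s.reg r ≠ 0 → Tri E x s.tick f v) (hy : s.reg r = 0 → Tri E y s.tick f v) :
    Tri E (.ite r x y) s f v := by
  by_cases h : s.reg r = 0
  · obtain ⟨k, hk⟩ := hy h
    exact ⟨k + 1, by simpa [wp, h] using hk⟩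
  · obtain ⟨k, hk⟩ := hx h
    exact ⟨k + 1, by simpa [wp, h] using hk⟩

theorem loop_done {r : ℕ} (h : s.reg r = 0) (hf : f s.tick ≤ v) : Tri E (.loop r x) s f v :=
  ⟨1, by simpa [wp, h] using hf⟩

theorem loop_step {r : ℕ} (h : s.reg r ≠ 0) (hx : Tri E x s.tick g v)
    (hl : ∀ s', Tri E (.loop r x) s' f (g s')) : Tri E (.loop r x) s f v := by
  obtain ⟨k, hk⟩ := Tri.seq hx hl
  cases k with
  | zero => simp only [wp, top_le_iff] at hk; rw [hk]; exact top
  | succ k => exact ⟨k + 1, by simpa [wp, h] using hk⟩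

theorem flip {r : ℕ} (h : 2⁻¹ * f (s.setReg r (0 % 2 ^ E.w)) + 2⁻¹ * f (s.setReg r (1 % 2 ^ E.w)) ≤ v) :
    Tri E (.flip r) s f v := ⟨1, by simpa [wp] using h⟩

/-- Expectations are affine. The factor must not vanish, because the value `∞` stands for a run
that does not halt. -/
theorem affine (h : Tri E c s f v) (a : ℝ≥0∞) {b : ℝ≥0∞} (hb : b ≠ 0) :
    Tri E c s (fun s => a + b * f s) (a + b * v) := by
  obtain ⟨k, hk⟩ := h
  refine ⟨k, le_trans ?_ (add_le_add_right (mul_le_mul_right hk b) a)⟩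
  clear hk
  induction k generalizing c s f with
  | zero => simp [wp, ENNReal.mul_top hb]
  | succ k ih =>
    cases c with
    | flip r =>
      simp only [wp]
      apply le_of_eq
      have : a = 2⁻¹ * a + 2⁻¹ * a := by
        rw [← add_mul, ENNReal.inv_two_add_inv_two, one_mul]
      conv_rhs => rw [this]
      ring
    | seq x y => simp only [wp]; exact (wp_mono (fun s => ih) s).trans ih
    | ite r x y => simp only [wp]; split_ifs <;> exact ih
    | loop r x =>
      simp only [wp]; split_ifs
      · exact (wp_mono (fun s => ih) _).trans ih
      · exact le_rfl
    | _ => simp only [wp]; exact le_rfl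

end Tri

/-! ### Success probability as an expectation -/

/-- The cost of a final state: `0` for the output `out`, `1` for another output, `∞` for a run of
more than `t` steps. -/
noncomputable def penalty (t out : ℕ) (s : State) : ℝ≥0∞ :=
  if s.time ≤ t then if s.reg 0 = out then 0 else 1 else ⊤

theorem penalty_eq_top {t out : ℕ} {s : State} : penalty t out s = ⊤ ↔ ¬ s.time ≤ t := by
  unfold penalty
  split_ifs <;> simp_all

/-- The event that a run has halted with output `out`. -/
def outputs (out : ℕ) : Set (Option State) := {o | ∃ s : State, o = some s ∧ s.reg 0 = out}

theorem toOuterMeasure_outputs (E : Env) (k : ℕ) (c : Prog) (s : State) (out : ℕ) :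
    (exec E k c s).toOuterMeasure (outputs out) =
      wp E 0 k c (fun s => if s.reg 0 = out then 1 else 0) s := by
  rw [wp_eq_tsum, PMF.toOuterMeasure_apply]
  refine tsum_congr fun o => ?_
  cases o with
  | none => simp [optVal, outputs, Set.indicator]
  | some s' => by_cases h : s'.reg 0 = out <;> simp [optVal, outputs, Set.indicator, h]

theorem wp_zero_le_top (E : Env) (k : ℕ) (c : Prog) (f : State → ℝ≥0∞) (s : State) :
    wp E 0 k c f s ≤ wp E ⊤ k c f s := by
  rw [wp_eq_tsum, wp_eq_tsum]
  refine ENNReal.tsum_le_tsum fun o => mul_le_mul_right ?_ _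
  cases o <;> simp [optVal]

/-- A finite expected penalty forces all runs to halt in time. -/
theorem support_of_wp_penalty {E : Env} {k : ℕ} {c : Prog} {s : State} {t out : ℕ}
    (h : wp E ⊤ k c (penalty t out) s ≠ ⊤) :
    ∀ o ∈ (exec E k c s).support, ∃ s' : State, o = some s' ∧ s'.time ≤ t := by
  intro o ho
  rw [wp_eq_tsum] at h
  have h1 := ENNReal.ne_top_of_tsum_ne_top h o
  have h2 : optVal ⊤ (penalty t out) o ≠ ⊤ := by
    intro h3
    rw [h3, ENNReal.mul_top ((PMF.mem_support_iff _ _).1 ho)] at h1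
    exact h1 rfl
  cases o with
  | none => exact absurd rfl h2
  | some s' => exact ⟨s', rfl, not_not.1 fun h3 => h2 (penalty_eq_top.2 h3)⟩

/-- For a run that surely halts in time, the probability of the right output and the expected
penalty add up to one. -/
theorem wp_add_penalty {E : Env} {k : ℕ} {c : Prog} {s : State} {t out : ℕ}
    (h : ∀ o ∈ (exec E k c s).support, ∃ s' : State, o = some s' ∧ s'.time ≤ t) :
    (exec E k c s).toOuterMeasure (outputs out) + wp E ⊤ k c (penalty t out) s = 1 := by
  rw [toOuterMeasure_outputs, wp_eq_tsum, wp_eq_tsum, ← ENNReal.tsum_add,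
    ← (exec E k c s).tsum_coe]
  refine tsum_congr fun o => ?_
  rw [← mul_add]
  by_cases ho : exec E k c s o = 0
  · simp [ho]
  · obtain ⟨s', rfl, hs⟩ := h o ((PMF.mem_support_iff _ _).2 ho)
    by_cases h0 : s'.reg 0 = out <;> simp [optVal, penalty, hs, h0]

/-- Once all runs halt within a nesting depth, larger depths give no further outcomes. -/
theorem iSup_toOuterMeasure_outputs {E : Env} {k : ℕ} {c : Prog} {s : State} {t out : ℕ}
    (h : ∀ o ∈ (exec E k c s).support, ∃ s' : State, o = some s' ∧ s'.time ≤ t) :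
    ⨆ j, (exec E j c s).toOuterMeasure (outputs out) =
      (exec E k c s).toOuterMeasure (outputs out) := by
  refine le_antisymm (iSup_le fun j => ?_) (le_iSup (fun j =>
    (exec E j c s).toOuterMeasure (outputs out)) k)
  simp only [toOuterMeasure_outputs]
  rcases le_total j k with hjk | hjk
  · exact monotone_nat_of_le_succ (f := fun j => wp E 0 j c _ s)
      (fun n => wp_zero_le_succ E n c _ s) hjk
  · refine (wp_zero_le_top E j c _ s).trans ((wp_top_antitone E c _ s hjk).trans (le_of_eq ?_))
    simp only [wp_eq_tsum]
    refine tsum_congr fun o => ?_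
    by_cases ho : exec E k c s o = 0
    · simp [ho]
    · obtain ⟨s', rfl, -⟩ := h o ((PMF.mem_support_iff _ _).2 ho)
      rfl

theorem Algorithm.successProb_nonneg {P : Problem} (A : Algorithm) (G : GoodPolynomial P) (μ : ℝ)
    (n : ℕ) (I : Fin n → Bool) : 0 ≤ A.successProb G μ n I :=
  ENNReal.toReal_nonneg

/-- An algorithm that runs in time `T` has its error probability as its expected penalty. -/
theorem Algorithm.tri_penalty {P : Problem} {A : Algorithm} {G : GoodPolynomial P} {μ : ℝ}
    {T : ℕ → ℕ} (hT : A.RunsInTime G μ T) (n : ℕ) (I : Fin n → Bool) :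
    A.successProb G μ n I ≤ 1 ∧ Tri (A.env G μ n I) A.code State.start (penalty (T n) (P n I))
      (ENNReal.ofReal (1 - A.successProb G μ n I)) := by
  obtain ⟨k, hk⟩ := hT n I
  have h1 := wp_add_penalty (out := P n I) hk
  have h2 : A.successProb G μ n I =
      ((exec (A.env G μ n I) k A.code State.start).toOuterMeasure (outputs (P n I))).toReal :=
    congrArg ENNReal.toReal (iSup_toOuterMeasure_outputs hk)
  have h3 : (exec (A.env G μ n I) k A.code State.start).toOuterMeasure (outputs (P n I)) ≤ 1 := by
    rw [← h1]; exact le_self_add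
  have h4 : (exec (A.env G μ n I) k A.code State.start).toOuterMeasure (outputs (P n I)) ≠ ⊤ :=
    ne_top_of_le_ne_top ENNReal.one_ne_top h3
  refine ⟨?_, k, ?_⟩
  · rw [h2]
    exact ENNReal.toReal_le_of_le_ofReal zero_le_one (by simpa using h3)
  · rw [h2, ENNReal.ofReal_sub _ ENNReal.toReal_nonneg, ENNReal.ofReal_toReal h4,
      ENNReal.ofReal_one]
    refine le_of_eq (ENNReal.eq_sub_of_add_eq h4 ?_)
    rw [add_comm]; exact h1

/-- A bound for the expected penalty that is finite also bounds the running time. -/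
theorem exists_halting_of_tri {E : Env} {c : Prog} {s : State} {t out : ℕ} {v : ℝ≥0∞}
    (h : Tri E c s (penalty t out) v) (hv : v ≠ ⊤) :
    ∃ k, ∀ o ∈ (exec E k c s).support, ∃ s' : State, o = some s' ∧ s'.time ≤ t := by
  obtain ⟨k, hk⟩ := h
  exact ⟨k, support_of_wp_penalty (ne_top_of_le_ne_top hv hk)⟩

/-- A bound for the expected penalty bounds the error probability. -/
theorem Algorithm.le_successProb {P : Problem} {B : Algorithm} {G : GoodPolynomial P} {μ : ℝ}
    {n t : ℕ} {I : Fin n → Bool} {v : ℝ≥0∞} (hv : v ≠ ⊤)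
    (h : Tri (B.env G μ n I) B.code State.start (penalty t (P n I)) v) :
    1 - v.toReal ≤ B.successProb G μ n I := by
  obtain ⟨k, hk⟩ := h
  have hs := support_of_wp_penalty (ne_top_of_le_ne_top hv hk)
  have h1 := wp_add_penalty (out := P n I) hs
  have h2 : B.successProb G μ n I =
      ((exec (B.env G μ n I) k B.code State.start).toOuterMeasure (outputs (P n I))).toReal :=
    congrArg ENNReal.toReal (iSup_toOuterMeasure_outputs hs)
  have h4 : (exec (B.env G μ n I) k B.code State.start).toOuterMeasure (outputs (P n I)) ≠ ⊤ :=
    ne_top_of_le_ne_top ENNReal.one_ne_top (by rw [← h1]; exact le_self_add)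
  rw [h2, sub_le_iff_le_add, ← ENNReal.toReal_add h4 hv]
  rw [← ENNReal.toReal_one]
  refine ENNReal.toReal_mono (ENNReal.add_ne_top.2 ⟨h4, hv⟩) ?_
  rw [← h1]
  gcongr

/-! ### Expressions and structured programs -/

/-- The value `x` if `p` holds, and `∞` otherwise. As the bound of a `Tri` it makes `p` an event of
probability one. -/
noncomputable def guard (p : Prop) (x : ℝ≥0∞) : ℝ≥0∞ := open Classical in if p then x else ⊤

theorem guard_pos {p : Prop} {x : ℝ≥0∞} (h : p) : guard p x = x := if_pos h

theorem guard_le {p : Prop} {x v : ℝ≥0∞} (h : p) (hx : x ≤ v) : guard p x ≤ v := by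
  rwa [guard_pos h]

theorem le_guard {p : Prop} {x v : ℝ≥0∞} (h : p → v ≤ x) : v ≤ guard p x := by
  unfold guard
  split_ifs with hp
  · exact h hp
  · exact le_top

/-- The variables of structured programs are the registers of even index; the registers of odd
index hold intermediate results and are dropped. -/
def State.abs (s : State) : State := ⟨fun v => s.reg (2 * v), s.mem, s.time⟩

/-- Assign `x` to the variable `v`, in `c` steps. -/
def State.set (s : State) (v x c : ℕ) : State := ⟨Function.update s.reg v x, s.mem, s.time + c⟩

/-- Assign `x` to the memory cell `a`, in `c` steps. -/
def State.put (s : State) (a x c : ℕ) : State := ⟨s.reg, Function.update s.mem a x, s.time + c⟩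

@[simp] theorem State.set_reg (s : State) (v x c : ℕ) :
    (s.set v x c).reg = Function.update s.reg v x := rfl
@[simp] theorem State.set_mem (s : State) (v x c : ℕ) : (s.set v x c).mem = s.mem := rfl
@[simp] theorem State.set_time (s : State) (v x c : ℕ) : (s.set v x c).time = s.time + c := rfl
@[simp] theorem State.put_reg (s : State) (v x c : ℕ) : (s.put v x c).reg = s.reg := rfl
@[simp] theorem State.put_mem (s : State) (v x c : ℕ) :
    (s.put v x c).mem = Function.update s.mem v x := rfl
@[simp] theorem State.put_time (s : State) (v x c : ℕ) : (s.put v x c).time = s.time + c := rfl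
@[simp] theorem State.tick_reg (s : State) : s.tick.reg = s.reg := rfl
@[simp] theorem State.tick_mem (s : State) : s.tick.mem = s.mem := rfl
@[simp] theorem State.tick_time (s : State) : s.tick.time = s.time + 1 := rfl

/-- Arithmetic expressions over variables, memory cells, table entries and input bits. -/
inductive Expr
  | const (k : ℕ)
  | var (v : ℕ)
  | op (o : BinOp) (x y : Expr)
  | load (x : Expr)
  | table (x : Expr)
  | input (x : Expr)

namespace Expr

instance : Add Expr := ⟨op .add⟩
instance : Sub Expr := ⟨op .sub⟩
instance : Mul Expr := ⟨op .mul⟩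
instance : Div Expr := ⟨op .div⟩
instance : Mod Expr := ⟨op .mod⟩

/-- The machine code that computes the expression, with the result in the odd register
`2 * k + 1`. -/
def code : Expr → ℕ → Prog
  | const c, k => .const (2 * k + 1) c
  | var v, k => .op .lor (2 * k + 1) (2 * v) (2 * v)
  | op o x y, k =>
      .seq (x.code k) (.seq (y.code (k + 1)) (.op o (2 * k + 1) (2 * k + 1) (2 * (k + 1) + 1)))
  | load x, k => .seq (x.code k) (.load (2 * k + 1) (2 * k + 1))
  | table x, k => .seq (x.code k) (.table (2 * k + 1) (2 * k + 1))
  | input x, k => .seq (x.code k) (.input (2 * k + 1) (2 * k + 1))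

/-- The number of steps of `code`. -/
def cost : Expr → ℕ
  | const _ => 1
  | var _ => 1
  | op _ x y => x.cost + y.cost + 1
  | load x => x.cost + 1
  | table x => x.cost + 1
  | input x => x.cost + 1

/-- The word that the machine computes. -/
def eval (E : Env) (s : State) : Expr → ℕ
  | const c => c % 2 ^ E.w
  | var v => s.reg v % 2 ^ E.w
  | op o x y => o.eval E.w (x.eval E s) (y.eval E s)
  | load x => s.mem (x.eval E s)
  | table x => E.table (x.eval E s) % 2 ^ E.w
  | input x => E.input (x.eval E s) % 2 ^ E.w

/-- The value of the expression in exact arithmetic. -/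
def val (E : Env) (s : State) : Expr → ℕ
  | const c => c
  | var v => s.reg v
  | op .add x y => x.val E s + y.val E s
  | op .sub x y => x.val E s - y.val E s
  | op .mul x y => x.val E s * y.val E s
  | op .div x y => x.val E s / y.val E s
  | op .mod x y => x.val E s % y.val E s
  | op .shl x y => x.val E s * 2 ^ y.val E s
  | op _ _ _ => 0
  | load x => s.mem (x.val E s)
  | table x => E.table (x.val E s)
  | input x => E.input (x.val E s)

/-- The value of the expression is less than the power of `B` with this exponent, when all
variables, memory cells, table entries and constants are less than `B`. -/
def deg : Expr → ℕ
  | const _ => 1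
  | var _ => 1
  | op .add x y => max x.deg y.deg + 1
  | op .mul x y => x.deg + y.deg
  | op _ x y => max x.deg y.deg
  | load x => x.deg
  | table x => x.deg
  | input x => x.deg

/-- Side conditions under which machine arithmetic is exact. -/
def ok (E : Env) (B : ℕ) (s : State) : Expr → Prop
  | const c => c < B
  | var _ => True
  | op .add x y => x.ok E B s ∧ y.ok E B s
  | op .sub x y => x.ok E B s ∧ y.ok E B s ∧ y.val E s ≤ x.val E s
  | op .mul x y => x.ok E B s ∧ y.ok E B s
  | op .div x y => x.ok E B s ∧ y.ok E B s
  | op .mod x y => x.ok E B s ∧ y.ok E B s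
  | op .shl x y => x.ok E B s ∧ y.ok E B s ∧ x.val E s * 2 ^ y.val E s < B
  | op _ _ _ => False
  | load x => x.ok E B s
  | table x => x.ok E B s
  | input x => x.ok E B s

end Expr

/-- Everything that a program can read is less than `B`, and words can hold `B ^ D`. -/
structure EnvOK (E : Env) (B D : ℕ) : Prop where
  two_le : 2 ≤ B
  pow_le : B ^ D ≤ 2 ^ E.w
  table_lt : ∀ a, E.table a < B
  input_lt : ∀ a, E.input a < B

/-- All variables and memory cells are less than `B`. -/
def WF (B : ℕ) (s : State) : Prop := (∀ v, s.reg v < B) ∧ ∀ a, s.mem a < B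

theorem WF.set {B : ℕ} {s : State} (h : WF B s) (v c : ℕ) {x : ℕ} (hx : x < B) :
    WF B (s.set v x c) := by
  refine ⟨fun u => ?_, h.2⟩
  simp only [State.set_reg, Function.update_apply]
  split_ifs
  · exact hx
  · exact h.1 u

theorem WF.put {B : ℕ} {s : State} (h : WF B s) (a c : ℕ) {x : ℕ} (hx : x < B) :
    WF B (s.put a x c) := by
  refine ⟨h.1, fun u => ?_⟩
  simp only [State.put_mem, Function.update_apply]
  split_ifs
  · exact hx
  · exact h.2 u

theorem WF.tick {B : ℕ} {s : State} (h : WF B s) : WF B s.tick := h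

namespace Expr

variable {E : Env} {B D : ℕ} {s : State}

theorem one_le_deg (x : Expr) : 1 ≤ x.deg := by
  induction x with
  | op o x y hx hy => cases o <;> simp only [deg] <;> omega
  | _ => simp_all [deg]

theorem val_lt (hE : EnvOK E B D) (hs : WF B s) {x : Expr} (hx : x.ok E B s) :
    x.val E s < B ^ x.deg := by
  have h1 : ∀ k, 1 ≤ k → B ≤ B ^ k := fun k hk => Nat.le_self_pow (by omega) B
  have h2 := hE.two_le
  have h3 : ∀ {i j}, i ≤ j → B ^ i ≤ B ^ j := fun h => Nat.pow_le_pow_right (by omega) h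
  induction x with
  | const c => exact (show c < B from hx).trans_le (h1 1 le_rfl)
  | var v => simpa [deg, val] using hs.1 v
  | load x _ => exact (hs.2 _).trans_le (h1 _ x.one_le_deg)
  | table x _ => exact (hE.table_lt _).trans_le (h1 _ x.one_le_deg)
  | input x _ => exact (hE.input_lt _).trans_le (h1 _ x.one_le_deg)
  | op o x y ihx ihy =>
    cases o with
    | add =>
      have hx' := (ihx hx.1).trans_le (h3 (le_max_left x.deg y.deg))
      have hy' := (ihy hx.2).trans_le (h3 (le_max_right x.deg y.deg))
      simp only [val, deg, pow_succ]
      nlinarith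
    | sub =>
      have hx' := (ihx hx.1).trans_le (h3 (le_max_left x.deg y.deg))
      simp only [val, deg]
      omega
    | mul =>
      simp only [val, deg, pow_add]
      exact Nat.mul_lt_mul'' (ihx hx.1) (ihy hx.2)
    | div =>
      have hx' := (ihx hx.1).trans_le (h3 (le_max_left x.deg y.deg))
      exact (Nat.div_le_self _ _).trans_lt hx'
    | mod =>
      have hx' := (ihx hx.1).trans_le (h3 (le_max_left x.deg y.deg))
      exact (Nat.mod_le _ _).trans_lt hx'
    | shl =>
      exact hx.2.2.trans_le (h1 _ (one_le_deg (.op .shl x y)))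
    | _ => exact hx.elim

/-- If words hold numbers below `B ^ D`, expressions of degree at most `D` are evaluated without
overflow. -/
theorem eval_eq_val (hE : EnvOK E B D) (hs : WF B s) {x : Expr} (hx : x.ok E B s)
    (hD : x.deg ≤ D) : x.eval E s = x.val E s := by
  have key : ∀ x : Expr, x.ok E B s → x.deg ≤ D → x.val E s < 2 ^ E.w := fun x hx hD =>
    (val_lt hE hs hx).trans_le
      ((Nat.pow_le_pow_right (by have := hE.two_le; omega) hD).trans hE.pow_le)
  induction x with
  | const c => exact Nat.mod_eq_of_lt (key _ hx hD)
  | var v => exact Nat.mod_eq_of_lt (key _ hx hD)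
  | load x ih => simp only [eval, val, ih hx hD]
  | table x ih =>
    simp only [eval, val, ih hx hD]
    exact Nat.mod_eq_of_lt (key (.table x) hx hD)
  | input x ih =>
    simp only [eval, val, ih hx hD]
    exact Nat.mod_eq_of_lt (key (.input x) hx hD)
  | op o x y ihx ihy =>
    have hk := key _ hx hD
    have hdx : x.deg ≤ D := by cases o <;> simp only [deg] at hD <;> omega
    have hdy : y.deg ≤ D := by cases o <;> simp only [deg] at hD <;> omega
    cases o with
    | add => simp only [eval, val, ihx hx.1 hdx, ihy hx.2 hdy, BinOp.eval] at *; exact Nat.mod_eq_of_lt hk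
    | sub =>
      have h1 := key x hx.1 hdx
      have h2 := hx.2.2
      simp only [eval, val, ihx hx.1 hdx, ihy hx.2.1 hdy, BinOp.eval]
      rw [show x.val E s + (2 ^ E.w - y.val E s) = (x.val E s - y.val E s) + 2 ^ E.w by omega,
        Nat.add_mod_right]
      exact Nat.mod_eq_of_lt hk
    | mul => simp only [eval, val, ihx hx.1 hdx, ihy hx.2 hdy, BinOp.eval] at *; exact Nat.mod_eq_of_lt hk
    | div => simp only [eval, val, ihx hx.1 hdx, ihy hx.2 hdy, BinOp.eval] at *; exact Nat.mod_eq_of_lt hk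
    | mod => simp only [eval, val, ihx hx.1 hdx, ihy hx.2 hdy, BinOp.eval] at *; exact Nat.mod_eq_of_lt hk
    | shl =>
      simp only [eval, val, ihx hx.1 hdx, ihy hx.2.1 hdy, BinOp.eval, Nat.shiftLeft_eq] at *
      exact Nat.mod_eq_of_lt hk
    | _ => exact hx.elim

theorem eval_congr (E : Env) {s s' : State} (h1 : s'.reg = s.reg) (h2 : s'.mem = s.mem) (x : Expr) :
    x.eval E s' = x.eval E s := by
  induction x with
  | const => rfl
  | var => simp only [eval, h1]
  | op o x y hx hy => simp only [eval, hx, hy]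
  | load x hx => simp only [eval, hx, h2]
  | table x hx => simp only [eval, hx]
  | input x hx => simp only [eval, hx]

/-- Running `code` puts the value of the expression in its target register and changes neither
variables nor odd registers of smaller index. -/
theorem tri_code (E : Env) (x : Expr) (k : ℕ) (s : State) (f : State → ℝ≥0∞) (v : ℝ≥0∞)
    (h : ∀ s' : State, s'.reg (2 * k + 1) = x.eval E s.abs →
      (∀ j, s'.reg (2 * j) = s.reg (2 * j)) → (∀ j < k, s'.reg (2 * j + 1) = s.reg (2 * j + 1)) →
      s'.mem = s.mem → s'.time = s.time + x.cost → f s' ≤ v) : Tri E (x.code k) s f v := by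
  induction x generalizing k s f v with
  | const c =>
    refine ⟨1, ?_⟩
    simp only [code, wp]
    refine h _ ?_ ?_ ?_ rfl rfl
    · simp [State.setReg, eval]
    · intro j; simp only [State.setReg]; rw [Function.update_of_ne (by omega)]
    · intro j hj; simp only [State.setReg]; rw [Function.update_of_ne (by omega)]
  | var u =>
    refine ⟨1, ?_⟩
    simp only [code, wp]
    refine h _ ?_ ?_ ?_ rfl rfl
    · simp [State.setReg, eval, BinOp.eval, State.abs]
    · intro j; simp only [State.setReg]; rw [Function.update_of_ne (by omega)]
    · intro j hj; simp only [State.setReg]; rw [Function.update_of_ne (by omega)]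
  | load x ih =>
    refine Tri.seq (g := fun s' => wp E ⊤ 1 (.load (2 * k + 1) (2 * k + 1)) f s')
      (ih k s _ _ fun s' h1 h2 h3 h4 h5 => ?_) (fun s' => ⟨1, le_rfl⟩)
    simp only [wp]
    refine h _ ?_ ?_ ?_ h4 ?_
    · simp [State.setReg, eval, h1, h4, State.abs]
    · intro j; simp only [State.setReg]; rw [Function.update_of_ne (by omega), h2]
    · intro j hj; simp only [State.setReg]; rw [Function.update_of_ne (by omega), h3 j hj]
    · simp [State.setReg, h5, cost, add_assoc]
  | table x ih =>
    refine Tri.seq (g := fun s' => wp E ⊤ 1 (.table (2 * k + 1) (2 * k + 1)) f s')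
      (ih k s _ _ fun s' h1 h2 h3 h4 h5 => ?_) (fun s' => ⟨1, le_rfl⟩)
    simp only [wp]
    refine h _ ?_ ?_ ?_ h4 ?_
    · simp [State.setReg, eval, h1]
    · intro j; simp only [State.setReg]; rw [Function.update_of_ne (by omega), h2]
    · intro j hj; simp only [State.setReg]; rw [Function.update_of_ne (by omega), h3 j hj]
    · simp [State.setReg, h5, cost, add_assoc]
  | input x ih =>
    refine Tri.seq (g := fun s' => wp E ⊤ 1 (.input (2 * k + 1) (2 * k + 1)) f s')
      (ih k s _ _ fun s' h1 h2 h3 h4 h5 => ?_) (fun s' => ⟨1, le_rfl⟩)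
    simp only [wp]
    refine h _ ?_ ?_ ?_ h4 ?_
    · simp [State.setReg, eval, h1]
    · intro j; simp only [State.setReg]; rw [Function.update_of_ne (by omega), h2]
    · intro j hj; simp only [State.setReg]; rw [Function.update_of_ne (by omega), h3 j hj]
    · simp [State.setReg, h5, cost, add_assoc]
  | op o x y ihx ihy =>
    refine Tri.seq (g := fun s' => guard (s'.reg (2 * k + 1) = x.eval E s.abs ∧
      (∀ j, s'.reg (2 * j) = s.reg (2 * j)) ∧ (∀ j < k, s'.reg (2 * j + 1) = s.reg (2 * j + 1)) ∧
      s'.mem = s.mem ∧ s'.time = s.time + x.cost) v)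
      (ihx k s _ _ fun s' h1 h2 h3 h4 h5 => guard_le ⟨h1, h2, h3, h4, h5⟩ le_rfl) ?_
    intro s'
    by_cases hg : s'.reg (2 * k + 1) = x.eval E s.abs ∧
      (∀ j, s'.reg (2 * j) = s.reg (2 * j)) ∧ (∀ j < k, s'.reg (2 * j + 1) = s.reg (2 * j + 1)) ∧
      s'.mem = s.mem ∧ s'.time = s.time + x.cost
    swap
    · simp only [guard, if_neg hg]; exact Tri.top
    rw [guard_pos hg]
    obtain ⟨g1, g2, g3, g4, g5⟩ := hg
    refine Tri.seq (g := fun s'' => wp E ⊤ 1 (.op o (2 * k + 1) (2 * k + 1) (2 * (k + 1) + 1)) f s'')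
      (ihy (k + 1) s' _ _ fun s'' h1 h2 h3 h4 h5 => ?_) (fun s' => ⟨1, le_rfl⟩)
    simp only [wp]
    refine h _ ?_ ?_ ?_ ?_ ?_
    · simp only [State.setReg, Function.update_self, eval]
      rw [h1, h3 k (by omega), g1, eval_congr E (s := s.abs) (s' := s'.abs) (funext g2) g4 y]
    · intro j; simp only [State.setReg]; rw [Function.update_of_ne (by omega), h2, g2]
    · intro j hj
      simp only [State.setReg]
      rw [Function.update_of_ne (by omega), h3 j (by omega), g3 j hj]
    · simp [State.setReg, h4, g4]
    · simp only [State.setReg, h5, g5, cost]; omega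

end Expr

/-! ### Rules for structured programs -/

/-- `Tri` for structured programs: the states are those seen through `State.abs`. -/
def TriL (E : Env) (c : Prog) (σ : State) (f : State → ℝ≥0∞) (v : ℝ≥0∞) : Prop :=
  ∀ s : State, s.abs = σ → Tri E c s (fun s' => f s'.abs) v

/-- `v := e` -/
def asg (v : ℕ) (e : Expr) : Prog := .seq (e.code 0) (.op .lor (2 * v) 1 1)

/-- `memory[a] := e` -/
def sto (a e : Expr) : Prog := .seq (a.code 0) (.seq (e.code 1) (.store 1 3))

/-- `if v ≠ 0 then x else y` -/
def cond (v : ℕ) (x y : Prog) : Prog := .ite (2 * v) x y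

/-- `while v ≠ 0 do x` -/
def while_ (v : ℕ) (x : Prog) : Prog := .loop (2 * v) x

/-- Repeat `x`, with `v` counting down to zero. -/
def down (v : ℕ) (x : Prog) : Prog := while_ v (.seq x (asg v (.var v - .const 1)))

/-- `v := 2 * v +` a random bit -/
def flipAdd (v : ℕ) : Prog :=
  .seq (.flip 1) (.seq (.op .add (2 * v) (2 * v) (2 * v)) (.op .add (2 * v) (2 * v) 1))

/-- Run the programs of a list one after the other. -/
def block : List Prog → Prog
  | [] => .skip
  | [x] => x
  | x :: y :: l => .seq x (block (y :: l))

namespace TriL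

variable {E : Env} {B D : ℕ} {c x y : Prog} {σ : State} {f g : State → ℝ≥0∞} {v v' : ℝ≥0∞}

theorem mono (h : TriL E c σ f v) (hf : ∀ s, g s ≤ f s) (hv : v ≤ v') : TriL E c σ g v' :=
  fun s hs => (h s hs).mono (fun _ => hf _) hv

theorem top : TriL E c σ f ⊤ := fun _ _ => Tri.top

theorem of_guard {p : Prop} (h : p → TriL E c σ f v) : TriL E c σ f (guard p v) := by
  unfold guard
  split_ifs with hp
  · exact h hp
  · exact top

theorem affine (h : TriL E c σ f v) (a : ℝ≥0∞) {b : ℝ≥0∞} (hb : b ≠ 0) :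
    TriL E c σ (fun s => a + b * f s) (a + b * v) :=
  fun s hs => (h s hs).affine a hb

theorem seq (hx : TriL E x σ g v) (hy : ∀ σ', TriL E y σ' f (g σ')) : TriL E (.seq x y) σ f v :=
  fun s hs => Tri.seq (hx s hs) fun s' => hy _ s' rfl

theorem skip : TriL E .skip σ f (f σ.tick) := by
  rintro s rfl
  exact ⟨1, le_rfl⟩

theorem asg_eval (u : ℕ) (e : Expr) :
    TriL E (asg u e) σ f (f (σ.set u (e.eval E σ % 2 ^ E.w) (e.cost + 1))) := by
  rintro s rfl
  refine Tri.seq (g := fun s' => wp E ⊤ 1 (.op .lor (2 * u) 1 1) (fun s' => f s'.abs) s')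
    (e.tri_code E 0 s _ _ fun s' h1 h2 _ h4 h5 => le_of_eq ?_) (fun s' => ⟨1, le_rfl⟩)
  simp only [wp]
  congr 1
  rw [State.set, State.abs]
  simp only [mul_zero, zero_add] at h1
  congr 1
  · funext j
    simp only [State.setReg, BinOp.eval, h1, Nat.or_self, Function.update_apply]
    simp [State.abs, h2]
  · simp only [State.setReg, h5]; rfl

theorem asg_of (hE : EnvOK E B D) (hs : WF B σ) {u : ℕ} {e : Expr} (he : e.ok E B σ)
    (hD : e.deg ≤ D) {z : ℕ} (hz : z = e.val E σ) {k : ℕ} (hk : k = e.cost + 1)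
    (hf : f (σ.set u z k) ≤ v) : TriL E (asg u e) σ f v := by
  refine (asg_eval u e).mono (fun _ => le_rfl) (le_trans (le_of_eq ?_) hf)
  have h1 : e.val E σ < 2 ^ E.w := (Expr.val_lt hE hs he).trans_le
      ((Nat.pow_le_pow_right (by have := hE.two_le; omega) hD).trans hE.pow_le)
  rw [Expr.eval_eq_val hE hs he hD, Nat.mod_eq_of_lt h1, hz, hk]

theorem sto_eval (a e : Expr) :
    TriL E (sto a e) σ f (f (σ.put (a.eval E σ) (e.eval E σ) (a.cost + e.cost + 1))) := by
  rintro s rfl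
  refine Tri.seq (g := fun s' => guard (s'.reg 1 = a.eval E s.abs ∧ (∀ j, s'.reg (2 * j) =
    s.reg (2 * j)) ∧ s'.mem = s.mem ∧ s'.time = s.time + a.cost) _)
    (a.tri_code E 0 s _ _ fun s' h1 h2 h3 h4 h5 => guard_le ⟨h1, h2, h4, h5⟩ le_rfl) ?_
  intro s'
  by_cases hg : s'.reg 1 = a.eval E s.abs ∧ (∀ j, s'.reg (2 * j) =
    s.reg (2 * j)) ∧ s'.mem = s.mem ∧ s'.time = s.time + a.cost
  swap
  · simp only [guard, if_neg hg]; exact Tri.top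
  rw [guard_pos hg]
  obtain ⟨g1, g2, g4, g5⟩ := hg
  refine Tri.seq (g := fun s'' => wp E ⊤ 1 (.store 1 3) (fun s => f s.abs) s'')
      (e.tri_code E 1 s' _ _ fun s'' h1 h2 h3 h4 h5 => le_of_eq ?_) (fun s' => ⟨1, le_rfl⟩)
  simp only [wp]
  congr 1
  have h6 : s''.reg 1 = a.eval E s.abs := by rw [← g1]; exact h3 0 (by omega)
  have h7 : s''.reg 3 = e.eval E s.abs := by
    exact h1.trans (Expr.eval_congr E (s := s.abs) (s' := s'.abs) (funext g2) g4 e)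
  rw [State.put, State.abs]
  congr 1
  · funext j
    simp only [State.setMem, h2, g2, State.abs]
  · simp only [State.setMem, h6, h7, h4, g4, State.abs]
  · simp only [State.setMem, h5, g5, State.abs]; omega

theorem sto_of (hE : EnvOK E B D) (hs : WF B σ) {a e : Expr} (ha : a.ok E B σ) (he : e.ok E B σ)
    (haD : a.deg ≤ D) (hD : e.deg ≤ D) {z : ℕ} (hz : z = e.val E σ) {b : ℕ} (hb : b = a.val E σ)
    {k : ℕ} (hk : k = a.cost + e.cost + 1)
    (hf : f (σ.put b z k) ≤ v) : TriL E (sto a e) σ f v := by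
  rw [hz, hb, hk, ← Expr.eval_eq_val hE hs ha haD, ← Expr.eval_eq_val hE hs he hD] at hf
  exact (sto_eval a e).mono (fun _ => le_rfl) hf

theorem cond_of {u : ℕ} (hx : σ.reg u ≠ 0 → TriL E x σ.tick f v)
    (hy : σ.reg u = 0 → TriL E y σ.tick f v) : TriL E (cond u x y) σ f v := by
  rintro s rfl
  exact Tri.ite (fun h => hx h _ rfl) (fun h => hy h _ rfl)

theorem flipAdd_of {u : ℕ} (hu : 2 * σ.reg u + 1 < 2 ^ E.w)
    (hf : 2⁻¹ * f (σ.set u (2 * σ.reg u) 3) + 2⁻¹ * f (σ.set u (2 * σ.reg u + 1) 3) ≤ v) :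
    TriL E (flipAdd u) σ f v := by
  rintro s rfl
  have key : ∀ b : ℕ, b ≤ 1 → ∀ s', s' = s.setReg 1 (b % 2 ^ E.w) →
      Tri E (.seq (.op .add (2 * u) (2 * u) (2 * u)) (.op .add (2 * u) (2 * u) 1)) s'
        (fun s' => f s'.abs) (f (s.abs.set u (2 * s.abs.reg u + b) 3)) := by
    rintro b hb s' rfl
    refine ⟨2, le_of_eq ?_⟩
    simp only [wp]
    congr 1
    have hu' : 2 * s.reg (2 * u) + 1 < 2 ^ E.w := hu
    rw [State.set, State.abs]
    congr 1
    funext j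
    have h1 : (2 * u : ℕ) ≠ 1 := by omega
    have h2 : (1 : ℕ) ≠ 2 * u := by omega
    simp only [State.setReg, BinOp.eval, Function.update_apply, h1, h2, if_true, if_false,
      State.abs]
    have h3 : ∀ j, 2 * j ≠ 1 := fun j => by omega
    by_cases hj : j = u
    · subst hj
      simp only [if_true]
      rw [Nat.mod_eq_of_lt (by omega : b < _), Nat.mod_eq_of_lt (by omega : s.reg (2 * j) + _ < _),
        Nat.mod_eq_of_lt (by omega)]
      omega
    · simp [hj, h3]
  refine Tri.seq (g := fun s' => guard (s' = s.setReg 1 (0 % 2 ^ E.w) ∨ s' = s.setReg 1 (1 % 2 ^ E.w))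
    (if s'.reg 1 = 0 then f (s.abs.set u (2 * s.abs.reg u) 3)
      else f (s.abs.set u (2 * s.abs.reg u + 1) 3))) (Tri.flip ?_) ?_
  · rw [guard_pos (Or.inl rfl), guard_pos (Or.inr rfl), if_pos (by simp [State.setReg]), if_neg]
    · exact hf
    · simp only [State.setReg, Function.update_self]
      rw [Nat.mod_eq_of_lt (by omega)]
      exact one_ne_zero
  · intro s'
    by_cases hg : s' = s.setReg 1 (0 % 2 ^ E.w) ∨ s' = s.setReg 1 (1 % 2 ^ E.w)
    swap
    · simp only [guard, if_neg hg]; exact Tri.top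
    rw [guard_pos hg]
    rcases hg with h0 | h0
    · rw [if_pos (by simp [h0, State.setReg])]
      exact key 0 (by omega) s' h0
    · rw [if_neg]
      · exact key 1 (by omega) s' h0
      · simp only [h0, State.setReg, Function.update_self]
        rw [Nat.mod_eq_of_lt (by omega)]
        exact one_ne_zero

/-- The rule for loops: `k` is the number of remaining rounds, `p` an invariant that holds for
sure, and `φ` bounds the expectation. -/
theorem while_of {u : ℕ} (p : ℕ → State → Prop) (φ : ℕ → State → ℝ≥0∞)
    (hz : ∀ k σ, p k σ → (σ.reg u = 0 ↔ k = 0))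
    (body : ∀ k σ, p (k + 1) σ → TriL E x σ.tick (fun σ' => guard (p k σ') (φ k σ')) (φ (k + 1) σ))
    (done : ∀ σ, p 0 σ → f σ.tick ≤ φ 0 σ) (k : ℕ) (σ : State) (h : p k σ) :
    TriL E (while_ u x) σ f (φ k σ) := by
  induction k generalizing σ with
  | zero =>
    rintro s rfl
    exact Tri.loop_done ((hz 0 _ h).2 rfl) (done _ h)
  | succ k ih =>
    rintro s rfl
    refine Tri.loop_step (fun h0 => ?_) (body k _ h _ rfl) ?_
    · exact absurd ((hz _ _ h).1 h0) (Nat.succ_ne_zero k)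
    · intro s'
      exact of_guard (fun hp => ih _ hp) s' rfl

/-- The rule for loops that count down. -/
theorem down_of {u : ℕ} (p : ℕ → State → Prop) (φ : ℕ → State → ℝ≥0∞)
    (hz : ∀ k σ, p k σ → σ.reg u = k ∧ k < 2 ^ E.w)
    (body : ∀ k σ, p (k + 1) σ → TriL E x σ.tick
      (fun σ' => guard (σ'.reg u = k + 1 ∧ p k (σ'.set u k 4)) (φ k (σ'.set u k 4))) (φ (k + 1) σ))
    (done : ∀ σ, p 0 σ → f σ.tick ≤ φ 0 σ) (k : ℕ) (σ : State) (h : p k σ) :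
    TriL E (down u x) σ f (φ k σ) := by
  refine while_of (fun k σ => p k σ ∧ k < 2 ^ E.w) φ (fun k σ h => by rw [(hz k σ h.1).1])
    (fun k σ h => ?_)
    (fun σ h => done σ h.1) k σ ⟨h, (hz k σ h).2⟩
  refine seq (body k σ h.1) fun σ' => of_guard fun hp => ?_
  have h1 : 1 < 2 ^ E.w := by omega
  refine (asg_eval u _).mono (fun _ => le_rfl) (le_of_eq ?_)
  have : ((Expr.var u - Expr.const 1).eval E σ' % 2 ^ E.w) = k := by
    show (σ'.reg u % 2 ^ E.w + (2 ^ E.w - 1 % 2 ^ E.w)) % 2 ^ E.w % 2 ^ E.w = k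
    rw [hp.1, Nat.mod_eq_of_lt h.2, Nat.mod_eq_of_lt h1, show k + 1 + (2 ^ E.w - 1) =
      k + 2 ^ E.w by omega, Nat.add_mod_right, Nat.mod_mod, Nat.mod_eq_of_lt (by omega)]
  rw [this]
  exact guard_pos ⟨hp.2, by omega⟩

end TriL

/-- `u :=` a uniformly random number with `k` bits, where `k` is the value of the counter `i`. -/
def rand (u i : ℕ) : Prog := .seq (asg u (.const 0)) (down i (flipAdd u))

theorem TriL.rand_loop {E : Env} {u i : ℕ} (hui : u ≠ i) {f : State → ℝ≥0∞} (k : ℕ) (σ : State)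
    (hi : σ.reg i = k) (hk : (σ.reg u + 1) * 2 ^ k ≤ 2 ^ E.w) (hkw : k < 2 ^ E.w) :
    TriL E (down i (flipAdd u)) σ f ((2 ^ k)⁻¹ * ∑ x ∈ Finset.range (2 ^ k),
      f ((σ.set u (σ.reg u * 2 ^ k + x) (8 * k)).set i 0 1)) := by
  have half : ∀ k : ℕ, ∀ a : ℝ≥0∞, 2⁻¹ * ((2 ^ k)⁻¹ * a) = (2 ^ (k + 1))⁻¹ * a := by
    intro k a
    rw [pow_succ, ENNReal.mul_inv (by simp) (by simp)]
    ring
  refine TriL.down_of (fun k σ => σ.reg i = k ∧ (σ.reg u + 1) * 2 ^ k ≤ 2 ^ E.w ∧ k < 2 ^ E.w)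
    (fun k σ => (2 ^ k)⁻¹ * ∑ x ∈ Finset.range (2 ^ k),
      f ((σ.set u (σ.reg u * 2 ^ k + x) (8 * k)).set i 0 1))
    (fun k σ h => ⟨h.1, h.2.2⟩) ?_ ?_ k σ ⟨hi, hk, hkw⟩
  · rintro k σ ⟨h1, h2, h3⟩
    have h4 : 2 * σ.reg u + 1 + 1 ≤ 2 ^ E.w := by
      refine le_trans ?_ h2
      rw [pow_succ]
      nlinarith [Nat.one_le_two_pow (n := k)]
    refine TriL.flipAdd_of (by simpa using (by omega : 2 * σ.reg u + 1 < 2 ^ E.w)) ?_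
    have hiu := hui.symm
    rw [guard_pos, guard_pos]
    · rw [half, half, ← mul_add]
      gcongr
      rw [pow_succ 2 k, mul_two, Finset.sum_range_add]
      apply le_of_eq
      congr 1
      all_goals
        refine Finset.sum_congr rfl fun x hx => congrArg f ?_
        simp only [State.set, State.tick, Function.update_of_ne hui, Function.update_self]
        congr 1
        · funext j
          by_cases hj : j = i
          · simp [hj]
          · by_cases hj' : j = u
            · subst hj'; simp [hj]; ring
            · simp [hj, hj']
        · ring
    · simp only [State.set_reg, State.tick_reg, Function.update_of_ne hui, Function.update_of_ne hiu,
        Function.update_self, h1, true_and]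
      exact ⟨by rw [pow_succ] at h2; nlinarith, by omega⟩
    · simp only [State.set_reg, State.tick_reg, Function.update_of_ne hui, Function.update_of_ne hiu,
        Function.update_self, h1, true_and]
      exact ⟨by rw [pow_succ] at h2; nlinarith, by omega⟩
  · rintro σ ⟨h1, -, -⟩
    simp only [pow_zero, inv_one, Finset.range_one, Finset.sum_singleton, one_mul, mul_one,
      mul_zero, add_zero]
    apply le_of_eq
    congr 1
    simp only [State.set, State.tick, Function.update_eq_self, add_zero]
    rw [show (0 : ℕ) = σ.reg i from h1.symm, Function.update_eq_self]

theorem TriL.rand_of {E : Env} {u i : ℕ} (hui : u ≠ i) {f : State → ℝ≥0∞} {v : ℝ≥0∞} {k : ℕ}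
    {σ : State} (hi : σ.reg i = k) (hk : 2 ^ k ≤ 2 ^ E.w) (hkw : k < 2 ^ E.w)
    (hf : (2 ^ k)⁻¹ * ∑ x ∈ Finset.range (2 ^ k), f ((σ.set u x (8 * k + 3)).set i 0 0) ≤ v) :
    TriL E (rand u i) σ f v := by
  refine TriL.seq (g := fun σ' => guard (σ' = σ.set u 0 2) v)
    ((TriL.asg_eval u _).mono (fun _ => le_rfl) (guard_le ?_ le_rfl))
    fun σ' => TriL.of_guard ?_
  · simp [Expr.eval, Expr.cost]
  · rintro rfl
    refine (TriL.rand_loop hui k _ (by simpa [Function.update_of_ne hui.symm] using hi)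
      (by simpa using hk) hkw).mono (fun _ => le_rfl) (le_trans (le_of_eq ?_) hf)
    congr 1
    refine Finset.sum_congr rfl fun x _ => congrArg f ?_
    simp only [State.set, Function.update_self, zero_mul, zero_add, Function.update_idem]
    congr 1
    ring

/-! ### Running a program as a subroutine -/

theorem BinOp.eval_mod {w w' : ℕ} (hw : w ≤ w') (o : BinOp) {a b : ℕ} (hb : b < 2 ^ w) :
    o.eval w' a b % 2 ^ w = o.eval w a b := by
  have hd : 2 ^ w ∣ 2 ^ w' := Nat.pow_dvd_pow 2 hw
  have hle : 2 ^ w ≤ 2 ^ w' := Nat.le_of_dvd (by positivity) hd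
  cases o with
  | sub =>
    simp only [BinOp.eval]
    rw [Nat.mod_mod_of_dvd _ hd, show a + (2 ^ w' - b) = (a + (2 ^ w - b)) + (2 ^ w' - 2 ^ w) by omega]
    obtain ⟨k, hk⟩ := (Nat.dvd_sub hd (dvd_refl (2 ^ w)))
    rw [hk, Nat.add_mul_mod_self_left]
  | _ => simp only [BinOp.eval]; rw [Nat.mod_mod_of_dvd _ hd]

theorem BinOp.eval_lt (w : ℕ) (o : BinOp) (a b : ℕ) : o.eval w a b < 2 ^ w := by
  cases o <;> exact Nat.mod_lt _ (by positivity)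

/-- All registers that the program mentions are smaller than this number. -/
def Prog.bound : Prog → ℕ
  | .skip => 0
  | .const r _ => r + 1
  | .op _ r a b => max (r + 1) (max (a + 1) (b + 1))
  | .load r a => max (r + 1) (a + 1)
  | .store a r => max (r + 1) (a + 1)
  | .input r a => max (r + 1) (a + 1)
  | .table r a => max (r + 1) (a + 1)
  | .flip r => r + 1
  | .seq x y => max x.bound y.bound
  | .ite r x y => max (r + 1) (max x.bound y.bound)
  | .loop r x => max (r + 1) x.bound

/-- The program contains no loops. -/
def Prog.LoopFree : Prog → Prop
  | .seq x y => x.LoopFree ∧ y.LoopFree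
  | .ite _ x y => x.LoopFree ∧ y.LoopFree
  | .loop _ _ => False
  | _ => True

/-- A nesting depth that suffices for a program without loops. -/
def Prog.depth : Prog → ℕ
  | .seq x y => max x.depth y.depth + 1
  | .ite _ x y => max x.depth y.depth + 1
  | _ => 1

theorem wp_depth_le (E : Env) {c : Prog} (hc : c.LoopFree) (k : ℕ) (f : State → ℝ≥0∞) (s : State) :
    wp E ⊤ c.depth c f s ≤ wp E ⊤ k c f s := by
  induction c generalizing k f s with
  | seq x y hx hy =>
    cases k with
    | zero => simp [wp]
    | succ k =>
      simp only [Prog.depth, wp]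
      calc _ ≤ wp E ⊤ (max x.depth y.depth) x (wp E ⊤ k y f) s :=
            wp_mono (fun s => (wp_top_antitone E y f s (le_max_right _ _)).trans (hy hc.2 k f s)) s
        _ ≤ _ := (wp_top_antitone E x _ s (le_max_left _ _)).trans (hx hc.1 k _ s)
  | ite r x y hx hy =>
    cases k with
    | zero => simp [wp]
    | succ k =>
      simp only [Prog.depth, wp]
      split_ifs
      · exact (wp_top_antitone E x f _ (le_max_left _ _)).trans (hx hc.1 k f _)
      · exact (wp_top_antitone E y f _ (le_max_right _ _)).trans (hy hc.2 k f _)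
  | loop r x => exact hc.elim
  | _ =>
    cases k with
    | zero => simp [wp]
    | succ k => simp only [Prog.depth, wp]; exact le_rfl

theorem Expr.loopFree_code (x : Expr) (k : ℕ) : (x.code k).LoopFree := by
  induction x generalizing k with
  | op o x y hx hy => exact ⟨hx _, hy _, trivial⟩
  | load x hx => exact ⟨hx _, trivial⟩
  | table x hx => exact ⟨hx _, trivial⟩
  | input x hx => exact ⟨hx _, trivial⟩
  | _ => trivial

theorem loopFree_asg (v : ℕ) (e : Expr) : (asg v e).LoopFree := ⟨e.loopFree_code 0, trivial⟩

/-- The translation of a program that is to run as a subroutine: its registers become the variables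
from `b` on, its memory starts at the address in the variable `cv`, its input is read from the
memory cells from `0` on, and its arithmetic is reduced modulo the value of the variable `hv`. -/
def sim (b hv cv : ℕ) : Prog → Prog
  | .skip => .skip
  | .const r k => asg (b + r) (.const k % .var hv)
  | .op o r x y => asg (b + r) (.op o (.var (b + x)) (.var (b + y)) % .var hv)
  | .load r a => asg (b + r) (.load (.var cv + .var (b + a)))
  | .store a r => sto (.var cv + .var (b + a)) (.var (b + r))
  | .input r a => asg (b + r) (.load (.var (b + a)) % .var hv)
  | .table r a => asg (b + r) (.table (.var (b + a)) % .var hv)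
  | .flip r => .seq (asg (b + r) (.const 0)) (.seq (flipAdd (b + r))
      (asg (b + r) (.var (b + r) % .var hv)))
  | .seq x y => .seq (sim b hv cv x) (sim b hv cv y)
  | .ite r x y => cond (b + r) (sim b hv cv x) (sim b hv cv y)
  | .loop r x => while_ (b + r) (sim b hv cv x)

/-- What the subroutine relies on when it is started in the state `σ₀`. -/
structure SimOK (EA EB : Env) (b hv cv : ℕ) (σ₀ : State) : Prop where
  w_lt : EA.w < EB.w
  table_eq : EB.table = EA.table
  hv_lt : hv < b
  cv_lt : cv < b
  reg_hv : σ₀.reg hv = 2 ^ EA.w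
  reg_cv : σ₀.reg cv + 2 ^ EA.w ≤ 2 ^ EB.w
  le_reg_cv : 2 ^ EA.w ≤ σ₀.reg cv
  input_eq : ∀ a < 2 ^ EA.w, σ₀.mem a < 2 ^ EB.w ∧ σ₀.mem a % 2 ^ EA.w = EA.input a % 2 ^ EA.w

/-- The state `σ` represents the state `s` of the subroutine that was started in the state `σ₀` and
uses `m` registers. -/
structure SimRel (EA : Env) (b cv m : ℕ) (σ₀ s σ : State) : Prop where
  reg : ∀ r < m, σ.reg (b + r) = s.reg r
  reg_lt : ∀ r, s.reg r < 2 ^ EA.w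
  mem : ∀ a < 2 ^ EA.w, σ.mem (σ₀.reg cv + a) = s.mem a
  mem_lt : ∀ a, s.mem a < 2 ^ EA.w
  mem_eq : ∀ a, a < σ₀.reg cv ∨ σ₀.reg cv + 2 ^ EA.w ≤ a → σ.mem a = σ₀.mem a
  reg_eq : ∀ v, v < b ∨ b + m ≤ v → σ.reg v = σ₀.reg v
  time : σ.time ≤ σ₀.time + 12 * s.time

namespace SimRel

variable {EA EB : Env} {b hv cv m : ℕ} {σ₀ s σ : State}

theorem set (h : SimRel EA b cv m σ₀ s σ) {r x c : ℕ} (hr : r < m) (hx : x < 2 ^ EA.w)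
    (hc : c ≤ 12) : SimRel EA b cv m σ₀ (s.setReg r x) (σ.set (b + r) x c) where
  reg r' hr' := by simp [State.setReg, Function.update_apply, h.reg r' hr']
  reg_lt r' := by
    simp only [State.setReg, Function.update_apply]
    split_ifs
    · exact hx
    · exact h.reg_lt r'
  mem := h.mem
  mem_lt := h.mem_lt
  mem_eq := h.mem_eq
  reg_eq v hv := by
    simp only [State.set_reg]
    rw [Function.update_of_ne (by omega), h.reg_eq v hv]
  time := by
    have := h.time
    simp only [State.set_time, State.setReg]
    omega

theorem put (h : SimRel EA b cv m σ₀ s σ) {a x c : ℕ} (ha : a < 2 ^ EA.w) (hx : x < 2 ^ EA.w)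
    (hc : c ≤ 12) : SimRel EA b cv m σ₀ (s.setMem a x) (σ.put (σ₀.reg cv + a) x c) where
  reg := h.reg
  reg_lt := h.reg_lt
  mem a' ha' := by simp [State.setMem, Function.update_apply, h.mem a' ha']
  mem_lt a' := by
    simp only [State.setMem, Function.update_apply]
    split_ifs
    · exact hx
    · exact h.mem_lt a'
  mem_eq a' ha' := by
    simp only [State.put_mem]
    rw [Function.update_of_ne (by omega), h.mem_eq a' ha']
  reg_eq := h.reg_eq
  time := by
    have := h.time
    simp only [State.put_time, State.setMem]
    omega

theorem tick (h : SimRel EA b cv m σ₀ s σ) : SimRel EA b cv m σ₀ s.tick σ.tick :=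
  ⟨h.reg, h.reg_lt, h.mem, h.mem_lt, h.mem_eq, h.reg_eq, by
    have := h.time
    simp only [State.tick_time]
    omega⟩

theorem eval_var (h : SimRel EA b cv m σ₀ s σ) (hS : SimOK EA EB b hv cv σ₀) {r : ℕ} (hr : r < m) :
    (Expr.var (b + r)).eval EB σ = s.reg r := by
  have := Nat.pow_lt_pow_right (a := 2) (by norm_num) hS.w_lt
  simp only [Expr.eval, h.reg r hr]
  exact Nat.mod_eq_of_lt ((h.reg_lt r).trans this)

theorem eval_mod (h : SimRel EA b cv m σ₀ s σ) (hS : SimOK EA EB b hv cv σ₀) (x : Expr) :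
    (x % Expr.var hv).eval EB σ % 2 ^ EB.w = x.eval EB σ % 2 ^ EA.w := by
  have h1 := Nat.pow_lt_pow_right (a := 2) (by norm_num) hS.w_lt
  show x.eval EB σ % (σ.reg hv % 2 ^ EB.w) % 2 ^ EB.w % 2 ^ EB.w = _
  rw [h.reg_eq hv (Or.inl hS.hv_lt), hS.reg_hv, Nat.mod_eq_of_lt h1, Nat.mod_mod]
  exact Nat.mod_eq_of_lt ((Nat.mod_lt _ (by positivity)).trans h1)

theorem eval_addr (h : SimRel EA b cv m σ₀ s σ) (hS : SimOK EA EB b hv cv σ₀) {r : ℕ} (hr : r < m) :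
    (Expr.var cv + Expr.var (b + r)).eval EB σ = σ₀.reg cv + s.reg r := by
  have h1 := hS.reg_cv
  have h2 := h.reg_lt r
  show (σ.reg cv % 2 ^ EB.w + (Expr.var (b + r)).eval EB σ) % 2 ^ EB.w = _
  rw [h.eval_var hS hr, h.reg_eq cv (Or.inl hS.cv_lt), Nat.mod_eq_of_lt (by omega : σ₀.reg cv < _),
    Nat.mod_eq_of_lt (by omega)]

end SimRel

/-- A run of the translated program is bounded by a run of the program, in every nesting depth. -/
theorem exists_wp_sim_le {EA EB : Env} {b hv cv m : ℕ} {σ₀ : State}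
    (hS : SimOK EA EB b hv cv σ₀) (k : ℕ) (c : Prog) (hc : c.bound ≤ m) :
    ∃ j, ∀ (f fA : State → ℝ≥0∞) (s sA : State), SimRel EA b cv m σ₀ sA s.abs →
      (∀ sA' s', SimRel EA b cv m σ₀ sA' s'.abs → f s' ≤ fA sA') →
      wp EB ⊤ j (sim b hv cv c) f s ≤ wp EA ⊤ k c fA sA := by
  have h1 := Nat.pow_lt_pow_right (a := 2) (by norm_num) hS.w_lt
  have hpos : 0 < 2 ^ EA.w := by positivity
  -- a single instruction of the subroutine
  have basic : ∀ d : Prog, d.LoopFree → ∀ wA : (State → ℝ≥0∞) → State → ℝ≥0∞,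
      (∀ (f fA : State → ℝ≥0∞) (σ sA : State), SimRel EA b cv m σ₀ sA σ →
        (∀ sA' σ', SimRel EA b cv m σ₀ sA' σ' → f σ' ≤ fA sA') → TriL EB d σ f (wA fA sA)) →
      ∃ j, ∀ (f fA : State → ℝ≥0∞) (s sA : State), SimRel EA b cv m σ₀ sA s.abs →
      (∀ sA' s', SimRel EA b cv m σ₀ sA' s'.abs → f s' ≤ fA sA') →
      wp EB ⊤ j d f s ≤ wA fA sA := by
    intro d hd wA H
    refine ⟨d.depth, fun f fA s sA hrel hf => ?_⟩
    obtain ⟨i, hi⟩ := H (fun σ => ⨆ (s' : State) (_ : s'.abs = σ), f s') fA s.abs sA hrel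
      (fun sA' σ' h => iSup₂_le fun s' hs' => hf sA' s' (hs' ▸ h)) s rfl
    refine (wp_depth_le EB hd i f s).trans (le_trans (wp_mono (fun s' => ?_) s) hi)
    exact le_iSup₂ (f := fun (s'' : State) (_ : s''.abs = s'.abs) => f s'') s' rfl
  induction k generalizing c with
  | zero => exact ⟨0, fun _ _ _ _ _ _ => by simp [wp]⟩
  | succ k ih =>
    cases c with
    | skip =>
      exact basic .skip trivial (fun fA sA => fA sA.tick) fun f fA σ sA hr hf =>
        TriL.skip.mono (fun _ => le_rfl) (hf _ _ hr.tick)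
    | const r q =>
      simp only [Prog.bound] at hc
      refine basic _ (loopFree_asg _ _) (fun fA sA => wp EA ⊤ (k + 1) (.const r q) fA sA)
        fun f fA σ sA hr hf => (TriL.asg_eval _ _).mono (fun _ => le_rfl) (hf _ _ ?_)
      rw [hr.eval_mod hS]
      simp only [Expr.eval]
      rw [Nat.mod_mod_of_dvd _ (Nat.pow_dvd_pow 2 hS.w_lt.le)]
      exact hr.set (by omega) (Nat.mod_lt _ hpos) (Nat.le_of_ble_eq_true rfl)
    | op o r x y =>
      simp only [Prog.bound] at hc
      refine basic _ (loopFree_asg _ _) (fun fA sA => wp EA ⊤ (k + 1) (.op o r x y) fA sA)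
        fun f fA σ sA hr hf => (TriL.asg_eval _ _).mono (fun _ => le_rfl) (hf _ _ ?_)
      rw [hr.eval_mod hS, show ∀ u v : Expr, (Expr.op o u v).eval EB σ = o.eval EB.w (u.eval EB σ)
        (v.eval EB σ) from fun _ _ => rfl, hr.eval_var hS (by omega), hr.eval_var hS (by omega),
        BinOp.eval_mod hS.w_lt.le o (hr.reg_lt y)]
      exact hr.set (by omega) (BinOp.eval_lt _ _ _ _) (Nat.le_of_ble_eq_true rfl)
    | load r a =>
      simp only [Prog.bound] at hc
      refine basic _ (loopFree_asg _ _) (fun fA sA => wp EA ⊤ (k + 1) (.load r a) fA sA)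
        fun f fA σ sA hr hf => (TriL.asg_eval _ _).mono (fun _ => le_rfl) (hf _ _ ?_)
      rw [show ∀ u : Expr, (Expr.load u).eval EB σ = σ.mem (u.eval EB σ) from fun _ => rfl,
        hr.eval_addr hS (by omega), hr.mem _ (hr.reg_lt a),
        Nat.mod_eq_of_lt ((hr.mem_lt _).trans h1)]
      exact hr.set (by omega) (hr.mem_lt _) (Nat.le_of_ble_eq_true rfl)
    | store a r =>
      simp only [Prog.bound] at hc
      refine basic (sim b hv cv (.store a r)) ⟨Expr.loopFree_code _ _, Expr.loopFree_code _ _, trivial⟩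
        (fun fA sA => wp EA ⊤ (k + 1) (.store a r) fA sA) fun f fA σ sA hr hf => ?_
      refine (TriL.sto_eval _ _).mono (fun _ => le_rfl) (hf _ _ ?_)
      rw [hr.eval_addr hS (by omega), hr.eval_var hS (by omega)]
      exact hr.put (hr.reg_lt _) (hr.reg_lt _) (Nat.le_of_ble_eq_true rfl)
    | input r a =>
      simp only [Prog.bound] at hc
      refine basic _ (loopFree_asg _ _) (fun fA sA => wp EA ⊤ (k + 1) (.input r a) fA sA)
        fun f fA σ sA hr hf => (TriL.asg_eval _ _).mono (fun _ => le_rfl) (hf _ _ ?_)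
      rw [hr.eval_mod hS, show ∀ u : Expr, (Expr.load u).eval EB σ = σ.mem (u.eval EB σ) from
        fun _ => rfl, hr.eval_var hS (by omega),
        hr.mem_eq _ (Or.inl ((hr.reg_lt a).trans_le hS.le_reg_cv)), (hS.input_eq _ (hr.reg_lt a)).2]
      exact hr.set (by omega) (Nat.mod_lt _ hpos) (Nat.le_of_ble_eq_true rfl)
    | table r a =>
      simp only [Prog.bound] at hc
      refine basic _ (loopFree_asg _ _) (fun fA sA => wp EA ⊤ (k + 1) (.table r a) fA sA)
        fun f fA σ sA hr hf => (TriL.asg_eval _ _).mono (fun _ => le_rfl) (hf _ _ ?_)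
      rw [hr.eval_mod hS, show ∀ u : Expr, (Expr.table u).eval EB σ = EB.table (u.eval EB σ)
        % 2 ^ EB.w from fun _ => rfl, hr.eval_var hS (by omega), hS.table_eq,
        Nat.mod_mod_of_dvd _ (Nat.pow_dvd_pow 2 hS.w_lt.le)]
      exact hr.set (by omega) (Nat.mod_lt _ hpos) (Nat.le_of_ble_eq_true rfl)
    | flip r =>
      simp only [Prog.bound] at hc
      refine basic (sim b hv cv (.flip r)) ⟨loopFree_asg _ _, ⟨trivial, trivial, trivial⟩, loopFree_asg _ _⟩
        (fun fA sA => wp EA ⊤ (k + 1) (.flip r) fA sA) fun f fA σ sA hr hf => ?_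
      have key : ∀ y : ℕ, y < 2 →
          TriL EB (asg (b + r) (.var (b + r) % .var hv)) ((σ.set (b + r) 0 2).set (b + r) y 3) f
            (fA (sA.setReg r (y % 2 ^ EA.w))) := by
        intro y hy
        refine (TriL.asg_eval _ _).mono (fun _ => le_rfl) (hf _ _ ?_)
        have h3 : ((Expr.var (b + r) % Expr.var hv).eval EB ((σ.set (b + r) 0 2).set (b + r) y 3)
            % 2 ^ EB.w) = y % 2 ^ EA.w := by
          have hne : hv ≠ b + r := by have := hS.hv_lt; omega
          show (Function.update (Function.update σ.reg (b + r) 0) (b + r) y (b + r) % 2 ^ EB.w) %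
            (Function.update (Function.update σ.reg (b + r) 0) (b + r) y hv % 2 ^ EB.w) % 2 ^ EB.w
            % 2 ^ EB.w = _
          rw [Function.update_self, Function.update_of_ne hne, Function.update_of_ne hne,
            hr.reg_eq hv (Or.inl hS.hv_lt), hS.reg_hv, Nat.mod_eq_of_lt h1,
            Nat.mod_eq_of_lt (by omega : y < _), Nat.mod_mod]
          exact Nat.mod_eq_of_lt ((Nat.mod_lt _ hpos).trans h1)
        rw [h3]
        have h4 := hr.set (c := 9) (show r < m by omega) (Nat.mod_lt y hpos) (by norm_num)
        simpa [State.set, Expr.cost, add_assoc] using h4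
      refine TriL.seq (g := fun σ' => guard (σ' = σ.set (b + r) 0 2) _)
        ((TriL.asg_eval _ _).mono (fun _ => le_rfl) (guard_le ?_ le_rfl))
        fun σ' => TriL.of_guard ?_
      · simp [Expr.eval, Expr.cost]
      rintro rfl
      refine TriL.seq (g := fun σ' => guard (∃ y < 2, σ' = (σ.set (b + r) 0 2).set (b + r) y 3)
        (fA (sA.setReg r (σ'.reg (b + r) % 2 ^ EA.w))))
        (TriL.flipAdd_of (by simp only [State.set_reg, Function.update_self]; omega) ?_)
        fun σ' => TriL.of_guard ?_
      · simp only [State.set_reg, Function.update_self, mul_zero, zero_add]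
        rw [guard_pos ⟨0, by norm_num, rfl⟩, guard_pos ⟨1, by norm_num, rfl⟩]
        exact le_rfl
      · rintro ⟨y, hy, rfl⟩
        simpa using key y hy
    | seq x y =>
      simp only [Prog.bound] at hc
      obtain ⟨i, hi⟩ := ih x (by omega)
      obtain ⟨j, hj⟩ := ih y (by omega)
      refine ⟨max i j + 1, fun f fA s sA hr hf => ?_⟩
      simp only [sim, wp]
      refine (wp_top_antitone EB _ _ _ (le_max_left i j)).trans (hi _ _ s sA hr fun sA' s' hr' => ?_)
      exact (wp_top_antitone EB _ _ _ (le_max_right i j)).trans (hj _ _ s' sA' hr' hf)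
    | ite r x y =>
      simp only [Prog.bound] at hc
      obtain ⟨i, hi⟩ := ih x (by omega)
      obtain ⟨j, hj⟩ := ih y (by omega)
      refine ⟨max i j + 1, fun f fA s sA hr hf => ?_⟩
      have hreg : s.reg (2 * (b + r)) = sA.reg r := hr.reg r (by omega)
      simp only [sim, cond, wp, hreg]
      split_ifs
      · exact (wp_top_antitone EB _ _ _ (le_max_left i j)).trans (hi _ _ s.tick _ hr.tick hf)
      · exact (wp_top_antitone EB _ _ _ (le_max_right i j)).trans (hj _ _ s.tick _ hr.tick hf)
    | loop r x =>
      obtain ⟨j, hj⟩ := ih (.loop r x) hc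
      simp only [Prog.bound] at hc
      obtain ⟨i, hi⟩ := ih x (by omega)
      refine ⟨max i j + 1, fun f fA s sA hr hf => ?_⟩
      have hreg : s.reg (2 * (b + r)) = sA.reg r := hr.reg r (by omega)
      simp only [sim, while_, wp, hreg]
      split_ifs
      · refine (wp_top_antitone EB _ _ _ (le_max_left i j)).trans
          (hi _ _ s.tick _ hr.tick fun sA' s' hr' => ?_)
        exact (wp_top_antitone EB _ _ _ (le_max_right i j)).trans (hj _ _ s' sA' hr' hf)
      · exact hf _ s.tick hr.tick

/-- A subroutine that is started with cleared registers and memory, and with its input in the memory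
cells from `0` on, inherits the bounds for the program. -/
theorem TriL.sim_of {EA EB : Env} {b hv cv m : ℕ} {σ : State} {c : Prog}
    (hS : SimOK EA EB b hv cv σ) (hc : c.bound ≤ m) {f fA : State → ℝ≥0∞} {v : ℝ≥0∞}
    (hreg : ∀ r < m, σ.reg (b + r) = 0) (hmem : ∀ a < 2 ^ EA.w, σ.mem (σ.reg cv + a) = 0)
    (hA : Tri EA c State.start fA v)
    (hf : ∀ sA' σ', SimRel EA b cv m σ sA' σ' → f σ' ≤ fA sA') :
    TriL EB (sim b hv cv c) σ f v := by
  rintro s rfl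
  obtain ⟨k, hk⟩ := hA
  obtain ⟨j, hj⟩ := exists_wp_sim_le hS k c hc
  have hpos : 0 < 2 ^ EA.w := by positivity
  exact ⟨j, (hj (fun s => f s.abs) fA s State.start ⟨hreg, fun _ => hpos, hmem, fun _ => hpos,
    fun _ _ => rfl, fun _ _ => rfl, Nat.le_add_right _ _⟩ fun sA' s' h => hf sA' s'.abs h).trans hk⟩

/-- Set the variables `b`, …, `b + m - 1` to zero. -/
def clear (b : ℕ) : ℕ → Prog
  | 0 => .skip
  | m + 1 => .seq (clear b m) (asg (b + m) (.const 0))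

theorem TriL.clear_of {E : Env} (b m : ℕ) {σ : State} {f : State → ℝ≥0∞} :
    TriL E (clear b m) σ f (f ⟨fun v => if b ≤ v ∧ v < b + m then 0 else σ.reg v, σ.mem,
      σ.time + (2 * m + 1)⟩) := by
  induction m generalizing f with
  | zero =>
    refine TriL.skip.mono (fun _ => le_rfl) (le_of_eq (congrArg f ?_))
    simp only [State.tick, add_zero, mul_zero, zero_add]
    congr 1
    funext v
    rw [if_neg (by omega)]
  | succ m ih =>
    refine (TriL.seq (ih (f := fun σ' => f (σ'.set (b + m) 0 2))) fun σ' =>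
      (TriL.asg_eval _ _).mono (fun _ => le_rfl) (le_of_eq ?_)).mono (fun _ => le_rfl)
      (le_of_eq (congrArg f ?_))
    · simp [Expr.eval, Expr.cost]
    · simp only [State.set]
      congr 1
      funext v
      simp only [Function.update_apply]
      split_ifs <;> first | rfl | omega

/-! ### Strongly partite polynomials along affine combinations -/

/-- A strongly partite polynomial is affine in each block of variables. Hence its value at an affine
combination of `K` points is the combination of its values at the `K ^ d` points that take each
block from one of the given points. -/
theorem StronglyPartite.eval_sum {R : Type*} [CommSemiring R] {n d K : ℕ} {part : Fin n → Fin d}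
    {f : MvPolynomial (Fin n) R} (hf : StronglyPartite part f) {c : Fin K → R} (hc : ∑ j, c j = 1)
    (b : Fin n → Fin K → R) :
    MvPolynomial.eval (fun i => ∑ j, c j * b i j) f =
      ∑ τ : Fin d → Fin K, (∏ q, c (τ q)) * MvPolynomial.eval (fun i => b i (τ (part i))) f := by
  simp only [MvPolynomial.eval_eq', Finset.mul_sum]
  rw [Finset.sum_comm]
  refine Finset.sum_congr rfl fun m hm => ?_
  obtain ⟨h1, h2⟩ := hf m hm
  have hmono : ∏ i, (∑ j, c j * b i j) ^ m i =
      ∑ τ : Fin d → Fin K, (∏ q, c (τ q)) * ∏ i, b i (τ (part i)) ^ m i := by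
    have hr : ∀ τ : Fin d → Fin K, (∏ q, c (τ q)) * ∏ i, b i (τ (part i)) ^ m i =
        ∏ q, (c (τ q) * ∏ i with part i = q, b i (τ q) ^ m i) := by
      intro τ
      rw [Finset.prod_mul_distrib, ← Finset.prod_fiberwise Finset.univ part]
      congr 1
      refine Finset.prod_congr rfl fun q _ => Finset.prod_congr rfl fun i hi => ?_
      rw [(Finset.mem_filter.1 hi).2]
    simp only [hr]
    rw [← Fintype.prod_sum fun (q : Fin d) (j : Fin K) => c j * ∏ i with part i = q, b i j ^ m i,
      ← Finset.prod_fiberwise Finset.univ part]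
    refine Finset.prod_congr rfl fun q _ => ?_
    by_cases hq : ∃ i, part i = q ∧ m i ≠ 0
    · obtain ⟨i, rfl, hi⟩ := hq
      have hm1 : m i = 1 := by have := h1 i; omega
      have hz : ∀ i', part i' = part i → i' ≠ i → m i' = 0 := by
        intro i' h3 h4
        by_contra h5
        exact h2 i' i h4 h5 hi h3
      have hsingle : ∀ g : Fin n → R, ∏ i' with part i' = part i, g i' ^ m i' = g i := by
        intro g
        rw [Finset.prod_eq_single i, hm1, pow_one]
        · intro i' h3 h4
          rw [hz i' (Finset.mem_filter.1 h3).2 h4, pow_zero]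
        · simp
      rw [hsingle]
      exact Finset.sum_congr rfl fun j _ => by rw [hsingle fun i => b i j]
    · push Not at hq
      have hone : ∀ g : Fin n → R, ∏ i with part i = q, g i ^ m i = 1 := by
        intro g
        refine Finset.prod_eq_one fun i hi => ?_
        rw [hq i (Finset.mem_filter.1 hi).2, pow_zero]
      rw [hone]
      simp only [hone, mul_one, hc]
  rw [hmono, Finset.mul_sum]
  refine Finset.sum_congr rfl fun τ _ => ?_
  ring

/-! ### Systematic sampling of bits -/

/-- The `q`-th of `R` bits, `N` of which are `1`, placed cyclically from a position given by `s`. -/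
def cyclicBit (R N s q : ℕ) : ℕ := (N + (s + (R - q)) % R) / R

theorem cyclicBit_le_one {R N : ℕ} (hR : 0 < R) (hN : N ≤ R) (s q : ℕ) : cyclicBit R N s q ≤ 1 := by
  have := Nat.mod_lt (s + (R - q)) hR
  unfold cyclicBit
  rw [← Nat.lt_succ_iff, Nat.div_lt_iff_lt_mul hR]
  omega

theorem sum_range_add_mod {β : Type*} [AddCommMonoid β] {R : ℕ} (hR : 0 < R) (g : ℕ → β) (c : ℕ) :
    ∑ s ∈ Finset.range R, g ((s + c) % R) = ∑ z ∈ Finset.range R, g z := by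
  have hmaps : Set.MapsTo (fun s => (s + c) % R) (Finset.range R) (Finset.range R) := by
    intro s _
    simpa using Nat.mod_lt _ hR
  have hinj : Set.InjOn (fun s => (s + c) % R) (Finset.range R) := by
    intro s hs s' hs' h
    simp only [Finset.coe_range, Set.mem_Iio] at hs hs'
    have : s ≡ s' [MOD R] := Nat.ModEq.add_right_cancel' c h
    rwa [Nat.ModEq, Nat.mod_eq_of_lt hs, Nat.mod_eq_of_lt hs'] at this
  exact Finset.sum_nbij (fun s => (s + c) % R) hmaps hinj
    (Finset.surjOn_of_injOn_of_card_le _ hmaps hinj le_rfl) fun _ _ => rfl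

theorem sum_range_add_div {β : Type*} [AddCommMonoid β] {R N : ℕ} (hN : N ≤ R) (g : ℕ → β) :
    ∑ z ∈ Finset.range R, g ((N + z) / R) = N • g 1 + (R - N) • g 0 := by
  have h : R = (R - N) + N := by omega
  conv_lhs => rw [h, Finset.sum_range_add]
  rw [add_comm]
  congr 1
  · rw [Finset.sum_congr rfl (g := fun _ => g 1), Finset.sum_const, Finset.card_range]
    intro z hz
    have hz := Finset.mem_range.1 hz
    congr 1
    rw [show R - N + N = R by omega, show N + (R - N + z) = z + R by omega,
      Nat.add_div_right _ (by omega), Nat.div_eq_of_lt (by omega)]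
  · rw [Finset.sum_congr rfl (g := fun _ => g 0), Finset.sum_const, Finset.card_range]
    intro z hz
    have hz := Finset.mem_range.1 hz
    congr 1
    rw [Nat.div_eq_of_lt (by omega)]

/-- For a uniformly random position `s`, each single bit is `1` with probability `N / R`. -/
theorem sum_cyclicBit {β : Type*} [AddCommMonoid β] {R N : ℕ} (hN : N ≤ R) (g : ℕ → β) (q : ℕ) :
    ∑ s ∈ Finset.range R, g (cyclicBit R N s q) = N • g 1 + (R - N) • g 0 := by
  rcases Nat.eq_zero_or_pos R with rfl | hR
  · obtain rfl : N = 0 := by omega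
    simp
  rw [← sum_range_add_div hN g, ← sum_range_add_mod hR (fun z => g ((N + z) / R)) (R - q)]
  rfl

/-- For every position, exactly `N` of the `R` bits are `1`. -/
theorem sum_cyclicBit_eq {R N s : ℕ} (hN : N ≤ R) :
    ∑ q ∈ Finset.range R, cyclicBit R N s q = N := by
  rcases Nat.eq_zero_or_pos R with rfl | hR
  · obtain rfl : N = 0 := by omega
    simp
  have h1 : ∀ q ∈ Finset.range R, cyclicBit R N s (R - 1 - q) = (N + (q + (s + 1)) % R) / R := by
    intro q hq
    have hq := Finset.mem_range.1 hq
    unfold cyclicBit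
    rw [show s + (R - (R - 1 - q)) = q + (s + 1) by omega]
  rw [← Finset.sum_range_reflect, Finset.sum_congr rfl h1,
    sum_range_add_mod hR (fun z => (N + z) / R), sum_range_add_div hN (fun x => x)]
  simp

/-- Rounding with a uniform offset is exact in expectation. -/
theorem sum_range_add_div_eq (m X : ℕ) (hm : 0 < m) :
    ∑ u ∈ Finset.range m, (X + u) / m = X := by
  induction X with
  | zero =>
    refine Finset.sum_eq_zero fun u hu => ?_
    rw [zero_add, Nat.div_eq_of_lt (Finset.mem_range.1 hu)]
  | succ X ih =>
    have h1 := Finset.sum_range_succ' (fun u => (X + u) / m) m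
    rw [Finset.sum_range_succ, ih] at h1
    have h2 : ∀ u, (X + 1 + u) / m = (X + (u + 1)) / m := fun u => by congr 1; ring
    simp only [h2]
    rw [Nat.add_div_right _ hm] at h1
    simp only [add_zero] at h1
    omega

/-! ### Randomized binary expansions

A number `t` is written as `N₀ + 2 N₁ + 4 N₂ + …`, where each digit is random with the expectation
`y / Q`: the next number is `(t - y / Q) / 2`, rounded up or down at random without bias. -/

/-- The next number in the expansion, for the random offset `u < 2 * Q`. -/
def nextDigit (Q y t u : ℕ) : ℕ := (t * Q - y + u) / (2 * Q)

/-- The numbers `t` that may occur when `k` digits are still to be split off: up to rounding, `t` is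
the expectation `(y / Q) * (2 ^ (k + 1) - 1)` of `k + 1` digits with their weights, plus an excess
of at most `2 ^ k`. -/
def DigitRange (Q y k t : ℕ) : Prop :=
  y * (2 ^ (k + 1) - 1) ≤ t * Q + 2 * Q ∧ t * Q ≤ y * (2 ^ (k + 1) - 1) + (2 ^ k + 2) * Q

section Digits

variable {R Q y k t u : ℕ}

theorem le_of_digitRange (hQ : 2 * Q ≤ y) (h : DigitRange Q y (k + 1) t) : y ≤ t * Q := by
  obtain ⟨h1, -⟩ := h
  have h2 : 3 ≤ 2 ^ (k + 1 + 1) - 1 := by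
    have : 2 ^ 2 ≤ 2 ^ (k + 1 + 1) := Nat.pow_le_pow_right (by norm_num) (by omega)
    omega
  have h3 := Nat.mul_le_mul_left y h2
  omega

theorem nextDigit_bounds (hQ0 : 0 < Q) (hy : y ≤ t * Q) (u : ℕ) :
    2 * Q * nextDigit Q y t u + y ≤ t * Q + u ∧ t * Q + u < 2 * Q * nextDigit Q y t u + y + 2 * Q := by
  have h1 := Nat.div_add_mod (t * Q - y + u) (2 * Q)
  have h2 := Nat.mod_lt (t * Q - y + u) (show 0 < 2 * Q by omega)
  unfold nextDigit
  omega

/-- Each digit lies between `0` and `R`, so that it is a number of ones among `R` bits. -/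
theorem digit_bounds (hQ0 : 0 < Q) (hQ : 2 * Q ≤ y) (hR : y + 3 * Q ≤ R * Q) (hy : y ≤ t * Q)
    (hu : u < 2 * Q) : 2 * nextDigit Q y t u ≤ t ∧ t - 2 * nextDigit Q y t u ≤ R := by
  obtain ⟨h1, h2⟩ := nextDigit_bounds hQ0 hy u
  set t' := nextDigit Q y t u
  have h3 : (2 * t') * Q ≤ t * Q := by nlinarith
  have h4 := Nat.le_of_mul_le_mul_right h3 hQ0
  refine ⟨h4, ?_⟩
  have h5 : t * Q ≤ (R + 2 * t') * Q := by nlinarith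
  have h6 := Nat.le_of_mul_le_mul_right h5 hQ0
  omega

theorem digitRange_next (hQ0 : 0 < Q) (hQ : 2 * Q ≤ y) (h : DigitRange Q y (k + 1) t)
    (hu : u < 2 * Q) : DigitRange Q y k (nextDigit Q y t u) := by
  have hy := le_of_digitRange hQ h
  obtain ⟨h1, h2⟩ := nextDigit_bounds hQ0 hy u
  obtain ⟨h3, h4⟩ := h
  set t' := nextDigit Q y t u
  have e1 : y * (2 ^ (k + 1 + 1) - 1) = 2 * (y * (2 ^ (k + 1) - 1)) + y := by
    have : 2 ^ (k + 1 + 1) - 1 = 2 * (2 ^ (k + 1) - 1) + 1 := by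
      have := Nat.one_le_two_pow (n := k + 1)
      rw [pow_succ]
      omega
    rw [this]; ring
  rw [e1] at h3 h4
  have e2 : (2 ^ (k + 1) + 2) * Q = 2 * (2 ^ k * Q) + 2 * Q := by ring
  have e3 : (2 ^ k + 2) * Q = 2 ^ k * Q + 2 * Q := by ring
  have e4 : 2 * Q * t' = 2 * (t' * Q) := by ring
  constructor
  · omega
  · rw [e3]; omega

theorem last_digit_le (hQ0 : 0 < Q) (hR : y + 3 * Q ≤ R * Q) (h : DigitRange Q y 0 t) : t ≤ R := by
  obtain ⟨-, h2⟩ := h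
  simp only [zero_add, pow_one, pow_zero] at h2
  refine Nat.le_of_mul_le_mul_right ?_ hQ0
  omega

/-- The numerator of the expectation of the last digit; the denominator is `Q * 2 ^ k`. -/
def lastNum (Q y k t : ℕ) : ℕ := t * Q - y * (2 ^ k - 1)

theorem lastNum_bounds (hQ : 2 * Q ≤ y) (hR : y + 3 * Q ≤ R * Q) (h : DigitRange Q y k t) :
    y * (2 ^ k - 1) ≤ t * Q ∧ lastNum Q y k t ≤ Q * 2 ^ k * R := by
  obtain ⟨h1, h2⟩ := h
  have e1 : y * (2 ^ (k + 1) - 1) = y * (2 ^ k - 1) + y * 2 ^ k := by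
    rw [← mul_add]
    congr 1
    have := Nat.one_le_two_pow (n := k)
    rw [pow_succ]
    omega
  rw [e1] at h1 h2
  have h3 : y * 1 ≤ y * 2 ^ k := Nat.mul_le_mul_left y Nat.one_le_two_pow
  refine ⟨by omega, ?_⟩
  have h4 := Nat.mul_le_mul_right (2 ^ k) hR
  have h5 : Q * 1 ≤ Q * 2 ^ k := Nat.mul_le_mul_left Q Nat.one_le_two_pow
  have e2 : (y + 3 * Q) * 2 ^ k = y * 2 ^ k + 3 * (Q * 2 ^ k) := by ring
  have e3 : R * Q * 2 ^ k = Q * 2 ^ k * R := by ring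
  have e4 : (2 ^ k + 2) * Q = Q * 2 ^ k + 2 * Q := by ring
  unfold lastNum
  omega

theorem sum_nextDigit (hQ0 : 0 < Q) : ∑ u ∈ Finset.range (2 * Q), nextDigit Q y t u = t * Q - y :=
  sum_range_add_div_eq (2 * Q) (t * Q - y) (by omega)

theorem sum_digit (hQ0 : 0 < Q) (hQ : 2 * Q ≤ y) (hR : y + 3 * Q ≤ R * Q) (hy : y ≤ t * Q) :
    ∑ u ∈ Finset.range (2 * Q), (t - 2 * nextDigit Q y t u) = 2 * y := by
  have h1 : ∑ u ∈ Finset.range (2 * Q), (t - 2 * nextDigit Q y t u) +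
      2 * ∑ u ∈ Finset.range (2 * Q), nextDigit Q y t u = 2 * Q * t := by
    rw [Finset.mul_sum, ← Finset.sum_add_distrib, Finset.sum_congr rfl (g := fun _ => t)]
    · simp
    · intro u hu
      have := (digit_bounds hQ0 hQ hR hy (Finset.mem_range.1 hu)).1
      omega
  rw [sum_nextDigit hQ0] at h1
  have : 2 * Q * t = 2 * (t * Q) := by ring
  omega

theorem sum_lastNum (hQ0 : 0 < Q) (hQ : 2 * Q ≤ y) (hR : y + 3 * Q ≤ R * Q)
    (h : DigitRange Q y (k + 1) t) :
    ∑ u ∈ Finset.range (2 * Q), lastNum Q y k (nextDigit Q y t u) = Q * lastNum Q y (k + 1) t := by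
  have h1 : ∑ u ∈ Finset.range (2 * Q), lastNum Q y k (nextDigit Q y t u) +
      2 * Q * (y * (2 ^ k - 1)) = (∑ u ∈ Finset.range (2 * Q), nextDigit Q y t u) * Q := by
    rw [Finset.sum_mul]
    have : 2 * Q * (y * (2 ^ k - 1)) = ∑ _u ∈ Finset.range (2 * Q), y * (2 ^ k - 1) := by simp
    rw [this, ← Finset.sum_add_distrib]
    refine Finset.sum_congr rfl fun u hu => ?_
    have := (lastNum_bounds hQ hR (digitRange_next hQ0 hQ h (Finset.mem_range.1 hu))).1
    unfold lastNum
    omega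
  have h3 := (lastNum_bounds hQ hR h).1
  rw [sum_nextDigit hQ0] at h1
  unfold lastNum at *
  have e1 : y * (2 ^ (k + 1) - 1) = 2 * (y * (2 ^ k - 1)) + y := by
    have : 2 ^ (k + 1) - 1 = 2 * (2 ^ k - 1) + 1 := by
      have := Nat.one_le_two_pow (n := k)
      rw [pow_succ]
      omega
    rw [this]; ring
  rw [e1] at h3 ⊢
  obtain ⟨w, hw⟩ := Nat.exists_eq_add_of_le h3
  rw [hw] at h1 ⊢
  have e2 : (2 * (y * (2 ^ k - 1)) + y + w - y) * Q = 2 * Q * (y * (2 ^ k - 1)) + Q * w := by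
    rw [show 2 * (y * (2 ^ k - 1)) + y + w - y = 2 * (y * (2 ^ k - 1)) + w by omega]
    ring
  rw [e2] at h1
  rw [show 2 * (y * (2 ^ k - 1)) + y + w - (2 * (y * (2 ^ k - 1)) + y) = w by omega]
  omega

end Digits

/-! ### Bernoulli expectations of the sampled bits -/

/-- The expectation of `F` at a bit that is `1` with probability `a / b`. -/
noncomputable def bern (a b : ℕ) (F : ℕ → ℝ≥0∞) : ℝ≥0∞ :=
  (a * F 1 + (b - a : ℕ) * F 0) / b

theorem bern_mul {a b m : ℕ} (hm : 0 < m) (F : ℕ → ℝ≥0∞) : bern (m * a) (m * b) F = bern a b F := by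
  unfold bern
  rw [← Nat.mul_sub]
  push_cast
  rw [mul_assoc, mul_assoc, ← mul_add, ENNReal.mul_div_mul_left _ _ (by simpa using hm.ne') (by simp)]

theorem bern_le {a b : ℕ} (hb : 0 < b) (hab : a ≤ b) {w₁ w₀ : ℝ} (h1 : (a : ℝ) ≤ w₁ * b)
    (h0 : (b : ℝ) - a ≤ w₀ * b) (F : ℕ → ℝ≥0∞) :
    bern a b F ≤ ENNReal.ofReal w₁ * F 1 + ENNReal.ofReal w₀ * F 0 := by
  have hb' : (0 : ℝ) < b := by exact_mod_cast hb
  have key : ∀ (c : ℕ) (w : ℝ), (c : ℝ) ≤ w * b → (c : ℝ≥0∞) / b ≤ ENNReal.ofReal w := by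
    intro c w h
    rw [← ENNReal.ofReal_natCast c, ← ENNReal.ofReal_natCast b, ← ENNReal.ofReal_div_of_pos hb']
    exact ENNReal.ofReal_le_ofReal ((div_le_iff₀ hb').2 h)
  unfold bern
  rw [ENNReal.add_div, ENNReal.mul_div_right_comm, ENNReal.mul_div_right_comm]
  gcongr
  · exact key a w₁ h1
  · refine key (b - a) w₀ ?_
    rw [Nat.cast_sub hab]
    exact h0

/-- The average of Bernoulli expectations is a Bernoulli expectation with the average parameter. -/
theorem sum_bern {ι : Type*} (s : Finset ι) (a : ι → ℕ) (b : ℕ) (h : ∀ i ∈ s, a i ≤ b)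
    (F : ℕ → ℝ≥0∞) : ∑ i ∈ s, bern (a i) b F = s.card * bern (∑ i ∈ s, a i) (s.card * b) F := by
  have hsub : ∑ i ∈ s, (b - a i) = s.card * b - ∑ i ∈ s, a i := by
    have h1 : ∑ i ∈ s, (b - a i) + ∑ i ∈ s, a i = s.card * b := by
      rw [← Finset.sum_add_distrib, ← smul_eq_mul, ← Finset.sum_const]
      exact Finset.sum_congr rfl fun i hi => Nat.sub_add_cancel (h i hi)
    omega
  rcases Nat.eq_zero_or_pos s.card with hs | hs
  · simp [Finset.card_eq_zero.1 hs]
  unfold bern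
  rw [← hsub]
  simp only [div_eq_mul_inv, ← Finset.sum_mul, Finset.sum_add_distrib]
  push_cast
  rw [← mul_assoc, mul_comm (s.card : ℝ≥0∞), mul_assoc]
  congr 1
  rw [ENNReal.mul_inv (by simp) (by simp), ← mul_assoc, ENNReal.mul_inv_cancel
    (by simpa using hs.ne') (by simp), one_mul]

theorem sum_bern_cyclicBit {R N : ℕ} (hN : N ≤ R) (F : ℕ → ℝ≥0∞) (q : ℕ) :
    (R : ℝ≥0∞)⁻¹ * ∑ s ∈ Finset.range R, F (cyclicBit R N s q) = bern N R F := by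
  rw [sum_cyclicBit hN, bern, ENNReal.div_eq_inv_mul]
  simp

/-- One step of the expansion: in expectation the digit that is split off gives each of its `R` bits
the probability `y / (Q * R)`, and the prospect for the last digit does not change. -/
theorem digit_step {R Q y k t : ℕ} (hR0 : 0 < R) (hQ0 : 0 < Q) (hQ : 2 * Q ≤ y)
    (hR : y + 3 * Q ≤ R * Q) (h : DigitRange Q y (k + 1) t) (F F' : ℕ → ℕ → ℝ≥0∞) :
    ((2 * Q : ℕ) : ℝ≥0∞)⁻¹ * ∑ u ∈ Finset.range (2 * Q), (R : ℝ≥0∞)⁻¹ * ∑ s ∈ Finset.range R,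
        (∑ q ∈ Finset.range R, F q (cyclicBit R (t - 2 * nextDigit Q y t u) s q) +
          ∑ q ∈ Finset.range R, bern (lastNum Q y k (nextDigit Q y t u)) (Q * 2 ^ k * R) (F' q)) =
      ∑ q ∈ Finset.range R, bern y (Q * R) (F q) +
        ∑ q ∈ Finset.range R, bern (lastNum Q y (k + 1) t) (Q * 2 ^ (k + 1) * R) (F' q) := by
  have hy := le_of_digitRange hQ h
  have hRi : (R : ℝ≥0∞)⁻¹ * R = 1 := ENNReal.inv_mul_cancel (by simpa using hR0.ne') (by simp)
  have h2Q : ((2 * Q : ℕ) : ℝ≥0∞)⁻¹ * (2 * Q : ℕ) = 1 :=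
    ENNReal.inv_mul_cancel (by simpa using hQ0.ne') (ENNReal.natCast_ne_top _)
  have h1 : ∀ u ∈ Finset.range (2 * Q), (R : ℝ≥0∞)⁻¹ * ∑ s ∈ Finset.range R,
        (∑ q ∈ Finset.range R, F q (cyclicBit R (t - 2 * nextDigit Q y t u) s q) +
          ∑ q ∈ Finset.range R, bern (lastNum Q y k (nextDigit Q y t u)) (Q * 2 ^ k * R) (F' q)) =
      ∑ q ∈ Finset.range R, bern (t - 2 * nextDigit Q y t u) R (F q) +
      ∑ q ∈ Finset.range R, bern (lastNum Q y k (nextDigit Q y t u)) (Q * 2 ^ k * R) (F' q) := by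
    intro u hu
    have hd := (digit_bounds hQ0 hQ hR hy (Finset.mem_range.1 hu)).2
    rw [Finset.sum_add_distrib, Finset.sum_const, Finset.card_range, nsmul_eq_mul, mul_add,
      ← mul_assoc, hRi, one_mul, Finset.sum_comm, Finset.mul_sum]
    congr 1
    exact Finset.sum_congr rfl fun q _ => sum_bern_cyclicBit hd (F q) q
  rw [Finset.sum_congr rfl h1, Finset.sum_add_distrib, mul_add, Finset.sum_comm, Finset.mul_sum]
  congr 1
  · refine Finset.sum_congr rfl fun q _ => ?_
    rw [sum_bern _ _ _ fun u hu => (digit_bounds hQ0 hQ hR hy (Finset.mem_range.1 hu)).2,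
      Finset.card_range, ← mul_assoc, h2Q, one_mul, sum_digit hQ0 hQ hR hy, mul_assoc,
      bern_mul (by norm_num)]
  · rw [Finset.sum_comm, Finset.mul_sum]
    refine Finset.sum_congr rfl fun q _ => ?_
    rw [sum_bern _ _ _ fun u hu =>
      (lastNum_bounds hQ hR (digitRange_next hQ0 hQ h (Finset.mem_range.1 hu))).2,
      Finset.card_range, ← mul_assoc, h2Q, one_mul, sum_lastNum hQ0 hQ hR h,
      show 2 * Q * (Q * 2 ^ k * R) = Q * (Q * 2 ^ (k + 1) * R) by ring, bern_mul hQ0]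

/-- The first number in the expansion: the least number from `TT` on that has the right residue. -/
theorem digitRange_start {Q y l p r : ℕ} (hQ0 : 0 < Q) (hp : p ≤ 2 ^ l) (hr : r < p) :
    DigitRange Q y l (y * (2 ^ (l + 1) - 1) / Q + r) := by
  have h1 := Nat.div_add_mod (y * (2 ^ (l + 1) - 1)) Q
  have h2 := Nat.mod_lt (y * (2 ^ (l + 1) - 1)) hQ0
  set TT := y * (2 ^ (l + 1) - 1) / Q
  have e1 : (TT + r) * Q = Q * TT + r * Q := by ring
  have e2 : r * Q ≤ 2 ^ l * Q := Nat.mul_le_mul_right Q (by omega)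
  have e3 : (2 ^ l + 2) * Q = 2 ^ l * Q + 2 * Q := by ring
  constructor
  · rw [e1]; omega
  · rw [e1, e3]; omega

section Marginals

variable {R Q M l p r n : ℕ} {μ : ℝ}

/-- For `n` bits, an error factor `1 + 1 / n` in the probability of each bit is affordable. It covers
the replacement of `μ` by a rational number with denominator `Q`. -/
theorem bern_le_digit (hR0 : 0 < R) (hQ0 : 0 < Q) (hn : 0 < n) (hM : M = ⌊μ * Q⌋₊) (hμ0 : 0 ≤ μ)
    (hQn : 2 * n ≤ (1 - μ) * Q) (F : ℕ → ℝ≥0∞) :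
    bern (R * M) (Q * R) F ≤ ENNReal.ofReal (μ * (1 + 1 / n)) * F 1 +
      ENNReal.ofReal ((1 - μ) * (1 + 1 / n)) * F 0 := by
  have hn' : (0 : ℝ) < n := by exact_mod_cast hn
  have h1 : (M : ℝ) ≤ μ * Q := hM ▸ Nat.floor_le (by positivity)
  have h2 : μ * Q < M + 1 := hM ▸ Nat.lt_floor_add_one _
  have h3 : 2 ≤ (1 - μ) * (1 / n) * Q := by
    rw [mul_one_div, div_mul_eq_mul_div, le_div_iff₀ hn']
    exact hQn
  rw [mul_comm Q R, bern_mul hR0]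
  refine bern_le hQ0 ?_ (by nlinarith) (by nlinarith) F
  have : (M : ℝ) ≤ Q := by nlinarith
  exact_mod_cast this

/-- The last digit carries the residue `r < p`, which moves its expectation by at most `p / 2 ^ l`.
The error factor `1 + 1 / n` covers this as well. -/
theorem bern_le_last (hR0 : 0 < R) (hQ0 : 0 < Q) (hn : 0 < n) (hM : M = ⌊μ * Q⌋₊) (hμ0 : 0 ≤ μ)
    (hQn : 2 * n ≤ (1 - μ) * Q) (hln : 2 * n ≤ (1 - μ) * 2 ^ l)
    (hpn : p * n ≤ μ * 2 ^ l) (hr : r < p) (hQ : 2 * Q ≤ R * M) (hR : R * M + 3 * Q ≤ R * Q)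
    (hp : p ≤ 2 ^ l) (F : ℕ → ℝ≥0∞) :
    bern (lastNum Q (R * M) l (R * M * (2 ^ (l + 1) - 1) / Q + r)) (Q * 2 ^ l * R) F ≤
      ENNReal.ofReal (μ * (1 + 1 / n)) * F 1 + ENNReal.ofReal ((1 - μ) * (1 + 1 / n)) * F 0 := by
  have hb := lastNum_bounds hQ hR (digitRange_start (y := R * M) hQ0 hp hr)
  have hn' : (0 : ℝ) < n := by exact_mod_cast hn
  have hR' : (1 : ℝ) ≤ R := by exact_mod_cast hR0
  have h1 : (M : ℝ) ≤ μ * Q := hM ▸ Nat.floor_le (by positivity)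
  have h2 : μ * Q < M + 1 := hM ▸ Nat.lt_floor_add_one _
  have h3 : 2 ≤ (1 - μ) * (1 / n) * Q := by
    rw [mul_one_div, div_mul_eq_mul_div, le_div_iff₀ hn']
    exact hQn
  have h3' : 2 ≤ (1 - μ) * (1 / n) * 2 ^ l := by
    rw [mul_one_div, div_mul_eq_mul_div, le_div_iff₀ hn']
    exact hln
  have h4 : (p : ℝ) ≤ μ * (1 / n) * 2 ^ l := by
    rw [mul_one_div, div_mul_eq_mul_div, le_div_iff₀ hn']
    exact hpn
  -- the numerator differs from `R * M * 2 ^ l` by at most the rounding of the first number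
  have h5 : (lastNum Q (R * M) l (R * M * (2 ^ (l + 1) - 1) / Q + r) : ℝ) ≤
        R * M * 2 ^ l + r * Q ∧
      (R * M * 2 ^ l : ℝ) ≤ lastNum Q (R * M) l (R * M * (2 ^ (l + 1) - 1) / Q + r) + Q := by
    have g1 := Nat.div_add_mod (R * M * (2 ^ (l + 1) - 1)) Q
    have g2 := Nat.mod_lt (R * M * (2 ^ (l + 1) - 1)) hQ0
    have g3 := hb.1
    unfold lastNum
    set TT := R * M * (2 ^ (l + 1) - 1) / Q
    have e1 : (TT + r) * Q = Q * TT + r * Q := by ring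
    have e2 : R * M * (2 ^ (l + 1) - 1) = R * M * (2 ^ l - 1) + R * M * 2 ^ l := by
      rw [← mul_add]
      congr 1
      have := Nat.one_le_two_pow (n := l)
      rw [pow_succ]
      omega
    rw [e2] at g1 g2
    rw [e1] at g3 ⊢
    constructor
    · norm_cast; omega
    · norm_cast; omega
  obtain ⟨h5, h6⟩ := h5
  have hr' : (r : ℝ) ≤ p := by exact_mod_cast hr.le
  refine bern_le (by positivity) hb.2 ?_ ?_ F
  · push_cast
    have e1 : (r : ℝ) * Q ≤ μ * (1 / n) * 2 ^ l * Q * R := by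
      calc (r : ℝ) * Q ≤ (μ * (1 / n) * 2 ^ l) * Q * 1 := by
            rw [mul_one]; gcongr; exact hr'.trans h4
        _ ≤ _ := by gcongr
    have e2 : (R : ℝ) * M * 2 ^ l ≤ R * (μ * Q) * 2 ^ l := by gcongr
    nlinarith
  · push_cast
    have e3 : (Q : ℝ) * 2 ≤ Q * R * ((1 - μ) * (1 / n) * 2 ^ l) := by
      calc (Q : ℝ) * 2 = Q * 1 * 2 := by ring
        _ ≤ _ := by gcongr
    nlinarith

end Marginals

/-! ### Revealing the bits of a product distribution one by one -/

section Reveal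

variable {n : ℕ} (w : Bool → ℝ≥0∞) (F : (Fin n → Bool) → ℝ≥0∞)

/-- The weighted sum of `F` over all continuations of the first `k` bits of `x`. -/
noncomputable def tailSum (k : ℕ) (x : Fin n → Bool) : ℝ≥0∞ :=
  ∑ z : Fin n → Bool, if ∀ i, i.val < k → z i = x i then (∏ i with k ≤ i.val, w (z i)) * F z else 0

theorem tailSum_self (x : Fin n → Bool) : tailSum w F n x = F x := by
  unfold tailSum
  rw [Finset.sum_eq_single x]
  · have : (Finset.univ.filter fun i : Fin n => n ≤ i.val) = ∅ := by
      ext i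
      simp
    simp [this]
  · intro z _ hz
    rw [if_neg]
    exact fun h => hz (funext fun i => h i i.2)
  · simp

theorem tailSum_zero (x : Fin n → Bool) : tailSum w F 0 x = ∑ z, (∏ i, w (z i)) * F z := by
  simp [tailSum]

theorem tailSum_congr {k : ℕ} {x x' : Fin n → Bool} (h : ∀ i, i.val < k → x i = x' i) :
    tailSum w F k x = tailSum w F k x' := by
  unfold tailSum
  refine Finset.sum_congr rfl fun z _ => ?_
  have : (∀ i, i.val < k → z i = x i) ↔ ∀ i, i.val < k → z i = x' i :=
    forall_congr' fun i => imp_congr_right fun hi => by rw [h i hi]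
  simp only [this]

/-- Revealing one bit with its weight does not change the weighted sum. -/
theorem tailSum_succ (k : Fin n) (x : Fin n → Bool) :
    tailSum w F k x = ∑ β, w β * tailSum w F (k + 1) (Function.update x k β) := by
  unfold tailSum
  simp only [Finset.mul_sum]
  rw [Finset.sum_comm]
  refine Finset.sum_congr rfl fun z _ => ?_
  rw [Finset.sum_eq_single (z k)]
  · have h1 : (∀ i : Fin n, i.val < k.val + 1 → z i = Function.update x k (z k) i) ↔
        ∀ i : Fin n, i.val < k.val → z i = x i := by
      constructor
      · intro h i hi
        have := h i (by omega)
        rwa [Function.update_of_ne (by rintro rfl; omega)] at this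
      · intro h i hi
        by_cases hik : i = k
        · subst hik; simp
        · rw [Function.update_of_ne hik]
          exact h i (by have : i.val ≠ k.val := fun h => hik (Fin.ext h); omega)
    have h2 : (Finset.univ.filter fun i : Fin n => k.val ≤ i.val) =
        insert k (Finset.univ.filter fun i : Fin n => k.val + 1 ≤ i.val) := by
      ext i
      simp only [Finset.mem_filter, Finset.mem_univ, true_and, Finset.mem_insert, Fin.ext_iff]
      omega
    simp only [h1]
    rw [h2, Finset.prod_insert (by simp)]
    split_ifs
    · ring
    · simp
  · intro β _ hβ
    rw [if_neg, mul_zero]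
    intro h
    have := h k (by omega)
    rw [Function.update_self] at this
    exact hβ this.symm
  · simp

end Reveal

/-! ### The algorithm

The main program uses the following variables. The registers of the subroutine are the variables
from `30` on.

* `0` candidate of the majority vote, and output; `18` its lead
* `1` to `15` the parameters `n`, `p`, `d`, `ν`, `Z`, `H`, `G`, `Q`, `y`, `M`, `l`, `K`, `KD`, `TT`,
  `C0` (see `Cfg` and `Par`)
* `16` the address where unused memory starts; `17` the number of repetitions to go
* `19` accumulator for the answers to the queries; `20` the number of rows or queries to go
* `21` pointer or index; `22` number or coefficient; `23`, `25`, `27` counters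
* `24`, `26`, `28` random offset, digit, and scratch values

The memory holds the current query from the address `0` on, the digits of its index from `G` on, and
the sampled bits from `2 * G` on. From `3 * G` on, each call of the subroutine has a fresh block of
`H` cells, so that it finds zeros without any cells being erased. -/

section Program

open AvgCase.Expr

/-- Variables: `24` offset, `25` counter, `26` number `N ≤ R` to be spread, `27` counter, `21`
pointer. Writes `R = 2 ^ ρ` bits, `N` of which are `1`, from the pointer on. -/
def spread (ρ : ℕ) : Prog := block [
  asg 25 (const ρ),
  rand 24 25,
  asg 27 (const (2 ^ ρ)),
  down 27 (.seq
    (sto (var 21) ((var 26 + (var 24 + var 27) % const (2 ^ ρ)) / const (2 ^ ρ)))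
    (asg 21 (var 21 + const 1)))]

/-- Splits one digit off the number in the variable `22` and spreads it. -/
def level (ρ : ℕ) : Prog := block [
  asg 25 (const 2 * var 4 + const 1),
  rand 24 25,
  asg 28 ((var 22 * var 8 - var 9 + var 24) / (const 2 * var 8)),
  asg 26 (var 22 - const 2 * var 28),
  asg 22 (var 28),
  spread ρ]

/-- Samples the `K` bits that encode the input bit at position `n - v`, where `v` is the value of the
variable `20`, and writes them from the pointer `21` on. The first bit absorbs the excess of the
coefficients of the other bits over `1`; those bits expand the least number from `TT` on that has
the remaining residue modulo `p`. -/
def row (ρ : ℕ) : Prog := block [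
  asg 25 (const 2 * var 4),
  rand 24 25,
  asg 26 ((var 10 + var 24) / var 8),
  sto (var 21) (var 26),
  asg 21 (var 21 + const 1),
  asg 22 (var 14 + (input (var 1 - var 20) + var 26 * var 15 + (var 2 - var 14 % var 2)) % var 2),
  asg 23 (var 11),
  down 23 (level ρ),
  asg 26 (var 22),
  spread ρ]

/-- Samples the bits for all input positions. -/
def rows (ρ : ℕ) : Prog := block [
  asg 21 (const 2 * var 7),
  asg 20 (var 1),
  down 20 (row ρ)]

/-- The digits in base `K` of the index in the variable `21` are stored from the address `G` on, and
the product of the coefficients that belong to them is computed in the variable `22`. -/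
def digitsLoop (ρ : ℕ) : Prog := down 23 (block [
  asg 24 (var 21 % var 12),
  sto (var 7 + (var 3 - var 23)) (var 24),
  asg 21 (var 21 / var 12),
  cond 24 (asg 22 ((var 22 * op .shl (const 1) ((var 24 - const 1) / const (2 ^ ρ))) % var 2))
    (asg 22 ((var 22 * (var 2 - var 15 % var 2)) % var 2))])

/-- The query with the stored digits is written to the memory from `0` on. -/
def queryLoop : Prog := down 23
  (sto (var 23 - const 1) (load (const 2 * var 7 + (var 23 - const 1) * var 12 +
    load (var 7 + table (var 23 + const 2)))))

/-- One query: its answer, times the coefficient, is added to the accumulator `19`. -/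
def query (ρ m : ℕ) (c : Prog) : Prog := block [
  asg 21 (var 20 - const 1),
  asg 22 (const 1),
  asg 23 (var 3),
  digitsLoop ρ,
  asg 23 (var 1),
  queryLoop,
  clear 30 m,
  sim 30 6 16 c,
  asg 19 ((var 19 + var 22 * var 30) % var 2),
  asg 16 (var 16 + var 6)]

/-- All queries. -/
def queries (ρ m : ℕ) (c : Prog) : Prog := block [
  asg 19 (const 0),
  asg 20 (var 13),
  down 20 (query ρ m c)]

/-- One step of the majority vote: the candidate is the variable `0` and its lead the variable
`18`. -/
def vote : Prog := cond 18
  (.seq (asg 26 ((var 19 + var 2 - var 0) % var 2))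
    (cond 26 (asg 18 (var 18 - const 1)) (asg 18 (var 18 + const 1))))
  (.seq (asg 0 (var 19)) (asg 18 (const 1)))

/-- One repetition of the randomized evaluation. -/
def repetition (ρ m : ℕ) (c : Prog) : Prog := block [rows ρ, queries ρ m c, vote]

/-- Computes the parameters from `n` and the table. The shift `2 <<< l` is used for `2 ^ (l + 1)`. -/
def setup (ρ c wc : ℕ) : Prog := block [
  asg 2 (table (const 1)),
  asg 3 (table (const 2)),
  asg 4 (const 0),
  asg 5 (const 1),
  asg 6 (const 1),
  asg 26 (var 1),
  while_ 26 (block [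
    asg 26 (var 26 / const 2),
    asg 4 (var 4 + const 1),
    asg 5 (var 5 * const 2),
    asg 6 (var 6 * const (2 ^ wc))]),
  asg 8 (var 5 * var 5),
  asg 7 (var 6 * var 8 * var 8),
  asg 10 (const 0),
  asg 23 (const 2 * var 4),
  asg 24 (var 1 + const 3),
  down 23 (.seq (asg 10 (const 2 * var 10 + table (var 24))) (asg 24 (var 24 + const 1))),
  asg 9 (const (2 ^ ρ) * var 10),
  asg 11 (const (c + 2) * var 4),
  asg 12 (const (2 ^ ρ) * (var 11 + const 1) + const 1),
  asg 13 (const 1),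
  asg 23 (var 3),
  down 23 (asg 13 (var 13 * var 12)),
  asg 26 (op .shl (const 2) (var 11) - const 1),
  asg 14 (var 9 * var 26 / var 8),
  asg 15 (const (2 ^ ρ) * var 26 - const 1),
  asg 16 (const 3 * var 7)]

/-- The whole program. On inputs of length less than `n₀` it halts at once. -/
def mainProg (n₀ ρ c wc m : ℕ) (code : Prog) : Prog := block [
  asg 1 (table (const 0)),
  asg 26 (var 1 / const n₀),
  cond 26 (block [setup ρ c wc, asg 17 (var 4 * var 4), down 17 (repetition ρ m code)]) .skip]

end Program

/-! ### Parameters and invariants -/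

/-- The parameters of the algorithm at one input length, with the inequalities that hold when the
length is large. -/
structure Cfg where
  /-- input length, modulus, number of parts, number of bits of `n` -/
  (n p d ν : ℕ)
  /-- `2 ^ ρ` copies of each digit, `n ^ c` bounds the modulus, word length and number of registers
  of the subroutine, numerator of the approximation to `μ`, bound on all numbers -/
  (ρ c wc m M B : ℕ)
  E : Env
  hE : EnvOK E B 6
  n_pos : 0 < n
  n_lt : n < 2 ^ ν
  p_gt : 1 < p
  p_le : p ≤ 2 ^ ((c + 2) * ν)
  M_lt : M < 2 ^ (2 * ν)
  two_le : 2 * 2 ^ (2 * ν) ≤ 2 ^ ρ * M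
  le_R : 2 ^ ρ * M + 3 * 2 ^ (2 * ν) ≤ 2 ^ ρ * 2 ^ (2 * ν)
  K_le : 2 ^ ρ * ((c + 2) * ν + 1) + 1 ≤ 2 ^ ν
  KD_le : (2 ^ ρ * ((c + 2) * ν + 1) + 1) ^ d ≤ 2 ^ ν
  d_le : d ≤ 2 ^ ν
  ν_sq : ν * ν ≤ 2 ^ ν
  G_lt : 4 * 2 ^ ((wc + 4) * ν) < B
  l_lt : 8 * 2 ^ ρ * 2 ^ ((c + 2) * ν) < B
  table_part : ∀ i < n, E.table (i + 3) < d
  table_p : E.table 1 = p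
  table_d : E.table 2 = d
  input_le : ∀ i, E.input i ≤ 1
  /-- bounds for the probabilities of the two values of a sampled bit -/
  w : Bool → ℝ≥0∞
  bern_le : ∀ F : ℕ → ℝ≥0∞, bern (2 ^ ρ * M) (2 ^ (2 * ν) * 2 ^ ρ) F ≤
    w true * F 1 + w false * F 0
  bern_last_le : ∀ r < p, ∀ F : ℕ → ℝ≥0∞,
    bern (lastNum (2 ^ (2 * ν)) (2 ^ ρ * M) ((c + 2) * ν)
      (2 ^ ρ * M * (2 ^ ((c + 2) * ν + 1) - 1) / 2 ^ (2 * ν) + r))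
      (2 ^ (2 * ν) * 2 ^ ((c + 2) * ν) * 2 ^ ρ) F ≤ w true * F 1 + w false * F 0

namespace Cfg

variable (C : Cfg)

/-- The power of two above `n`. -/
def Z : ℕ := 2 ^ C.ν
/-- The size of the memory of the subroutine. -/
def H : ℕ := 2 ^ (C.wc * C.ν)
/-- The size of each of the segments into which the memory is divided. -/
def G : ℕ := 2 ^ ((C.wc + 4) * C.ν)
/-- The denominator of the approximation `M / Q` to `μ`. -/
def Q : ℕ := 2 ^ (2 * C.ν)
/-- The number of bits into which a digit is spread. -/
def R : ℕ := 2 ^ C.ρ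
/-- The numerator of the expectation `y / Q` of a digit. -/
def y : ℕ := C.R * C.M
/-- The number of digits that are split off one by one; then a last digit is left. -/
def l : ℕ := (C.c + 2) * C.ν
/-- The number of bits in a row, which encodes one input bit. -/
def K : ℕ := C.R * (C.l + 1) + 1
/-- The number of queries, one for each choice of a bit per part. -/
def KD : ℕ := C.K ^ C.d
/-- The rounded expectation of a number with `l + 1` digits. -/
def TT : ℕ := C.y * (2 ^ (C.l + 1) - 1) / C.Q
/-- The negative of the coefficient of the first bit of a row. -/
def C0 : ℕ := C.R * (2 ^ (C.l + 1) - 1) - 1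

theorem Q_pos : 0 < C.Q := by unfold Q; positivity
theorem R_pos : 0 < C.R := by unfold R; positivity
theorem p_pos : 0 < C.p := by have := C.p_gt; omega
theorem two_Q_le : 2 * C.Q ≤ C.y := C.two_le
theorem y_add_le : C.y + 3 * C.Q ≤ C.R * C.Q := C.le_R
theorem K_pos : 0 < C.K := Nat.succ_pos _
theorem H_pos : 0 < C.H := by unfold H; positivity
theorem G_eq : C.G = C.H * C.Z ^ 4 := by
  unfold G H Z
  rw [← pow_mul, ← pow_add]
  ring
theorem Z_pos : 0 < C.Z := by unfold Z; positivity
theorem Z_pow_le_G (k : ℕ) (hk : k ≤ 4) : C.Z ^ k ≤ C.G := by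
  rw [G_eq]
  calc C.Z ^ k ≤ C.Z ^ 4 := Nat.pow_le_pow_right C.Z_pos hk
    _ ≤ _ := Nat.le_mul_of_pos_left _ C.H_pos
theorem four_G_lt : 4 * C.G < C.B := C.G_lt
theorem Q_eq : C.Q = C.Z ^ 2 := by unfold Q Z; rw [← pow_mul]; ring
theorem R_le : C.R ≤ C.Z := by
  have := C.K_le
  have h2 : 2 ^ C.ρ * 1 ≤ 2 ^ C.ρ * ((C.c + 2) * C.ν + 1) := Nat.mul_le_mul_left _ (by omega)
  unfold R Z
  omega

end Cfg

/-- The variables of the parameters have the right values. -/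
structure Par (C : Cfg) (s : State) : Prop where
  n : s.reg 1 = C.n
  p : s.reg 2 = C.p
  d : s.reg 3 = C.d
  ν : s.reg 4 = C.ν
  Z : s.reg 5 = C.Z
  H : s.reg 6 = C.H
  G : s.reg 7 = C.G
  Q : s.reg 8 = C.Q
  y : s.reg 9 = C.y
  M : s.reg 10 = C.M
  l : s.reg 11 = C.l
  K : s.reg 12 = C.K
  KD : s.reg 13 = C.KD
  TT : s.reg 14 = C.TT
  C0 : s.reg 15 = C.C0

/-- The states agree outside the listed variables. -/
def Same (L : List ℕ) (s s' : State) : Prop := ∀ v, v ∉ L → s'.reg v = s.reg v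

theorem Same.refl (L : List ℕ) (s : State) : Same L s s := fun _ _ => rfl

theorem Same.trans {L : List ℕ} {s₁ s₂ s₃ : State} (h : Same L s₁ s₂) (h' : Same L s₂ s₃) :
    Same L s₁ s₃ := fun v hv => (h' v hv).trans (h v hv)

theorem Same.mono {L L' : List ℕ} {s s' : State} (h : Same L s s') (hL : L ⊆ L') : Same L' s s' :=
  fun v hv => h v fun hv' => hv (hL hv')

theorem Same.set {L : List ℕ} {s s' : State} (h : Same L s s') {v : ℕ} (hv : v ∈ L) (x c : ℕ) :
    Same L s (s'.set v x c) := by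
  intro u hu
  rw [State.set_reg, Function.update_of_ne (by rintro rfl; exact hu hv)]
  exact h u hu

theorem Same.put {L : List ℕ} {s s' : State} (h : Same L s s') (a x c : ℕ) :
    Same L s (s'.put a x c) := h

theorem Same.tick {L : List ℕ} {s s' : State} (h : Same L s s') : Same L s s'.tick := h

theorem Par.same {C : Cfg} {L : List ℕ} {s s' : State} (h : Par C s) (hs : Same L s s')
    (hL : ∀ v ∈ L, v = 0 ∨ 16 ≤ v) : Par C s' := by
  have key : ∀ v, 1 ≤ v → v < 16 → s'.reg v = s.reg v := fun v h1 h2 =>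
    hs v fun hv => by have := hL v hv; omega
  constructor <;> rw [key _ (by norm_num) (by norm_num)]
  exacts [h.n, h.p, h.d, h.ν, h.Z, h.H, h.G, h.Q, h.y, h.M, h.l, h.K, h.KD, h.TT, h.C0]

/-! ### Sampling one row -/

namespace Expr

variable {E : Env} {B : ℕ} {s : State} (x y : Expr) (k : ℕ)

@[simp] theorem val_const : (const k).val E s = k := rfl
@[simp] theorem val_var : (var k).val E s = s.reg k := rfl
@[simp] theorem val_add : (x + y).val E s = x.val E s + y.val E s := rfl
@[simp] theorem val_sub : (x - y).val E s = x.val E s - y.val E s := rfl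
@[simp] theorem val_mul : (x * y).val E s = x.val E s * y.val E s := rfl
@[simp] theorem val_div : (x / y).val E s = x.val E s / y.val E s := rfl
@[simp] theorem val_mod : (x % y).val E s = x.val E s % y.val E s := rfl
@[simp] theorem val_shl : (op .shl x y).val E s = x.val E s * 2 ^ y.val E s := rfl
@[simp] theorem val_load : (load x).val E s = s.mem (x.val E s) := rfl
@[simp] theorem val_table : (table x).val E s = E.table (x.val E s) := rfl
@[simp] theorem val_input : (input x).val E s = E.input (x.val E s) := rfl
@[simp] theorem ok_const : (const k).ok E B s ↔ k < B := Iff.rfl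
@[simp] theorem ok_var : (var k).ok E B s ↔ True := Iff.rfl
@[simp] theorem ok_add : (x + y).ok E B s ↔ x.ok E B s ∧ y.ok E B s := Iff.rfl
@[simp] theorem ok_sub :
    (x - y).ok E B s ↔ x.ok E B s ∧ y.ok E B s ∧ y.val E s ≤ x.val E s := Iff.rfl
@[simp] theorem ok_mul : (x * y).ok E B s ↔ x.ok E B s ∧ y.ok E B s := Iff.rfl
@[simp] theorem ok_div : (x / y).ok E B s ↔ x.ok E B s ∧ y.ok E B s := Iff.rfl
@[simp] theorem ok_mod : (x % y).ok E B s ↔ x.ok E B s ∧ y.ok E B s := Iff.rfl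
@[simp] theorem ok_shl : (op .shl x y).ok E B s ↔
    x.ok E B s ∧ y.ok E B s ∧ x.val E s * 2 ^ y.val E s < B := Iff.rfl
@[simp] theorem ok_load : (load x).ok E B s ↔ x.ok E B s := Iff.rfl
@[simp] theorem ok_table : (table x).ok E B s ↔ x.ok E B s := Iff.rfl
@[simp] theorem ok_input : (input x).ok E B s ↔ x.ok E B s := Iff.rfl

end Expr

namespace TriL

variable {E : Env} {B D : ℕ} {x y : Prog} {σ : State} {f : State → ℝ≥0∞} {v : ℝ≥0∞}

/-- A deterministic first part. -/
theorem seq_eq {σ' : State} (hx : TriL E x σ (fun τ => guard (τ = σ') v) v)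
    (hy : TriL E y σ' f v) : TriL E (.seq x y) σ f v :=
  seq hx fun _ => of_guard fun h => h ▸ hy

/-- Run an assignment first. -/
theorem asg_seq (hE : EnvOK E B D) (hs : WF B σ) {u : ℕ} {e : Expr} (z : ℕ) (he : e.ok E B σ)
    (hz : z = e.val E σ) (hf : TriL E y (σ.set u z (e.cost + 1)) f v)
    (hD : e.deg ≤ D := by exact Nat.le_of_ble_eq_true rfl) :
    TriL E (.seq (asg u e) y) σ f v :=
  seq_eq (asg_of hE hs he hD hz rfl (guard_le rfl le_rfl)) hf

/-- Run a store instruction first. -/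
theorem sto_seq (hE : EnvOK E B D) (hs : WF B σ) {a e : Expr} (b z : ℕ) (ha : a.ok E B σ)
    (he : e.ok E B σ) (hb : b = a.val E σ) (hz : z = e.val E σ)
    (hf : TriL E y (σ.put b z (a.cost + e.cost + 1)) f v)
    (haD : a.deg ≤ D := by exact Nat.le_of_ble_eq_true rfl)
    (hD : e.deg ≤ D := by exact Nat.le_of_ble_eq_true rfl) :
    TriL E (.seq (sto a e) y) σ f v :=
  seq_eq (sto_of hE hs ha he haD hD hz hb rfl (guard_le rfl le_rfl)) hf

end TriL

/-- The memory with `g 0`, …, `g (R - 1)` written from the address `a` on. -/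
def writeSeg (mem : ℕ → ℕ) (a R : ℕ) (g : ℕ → ℕ) : ℕ → ℕ :=
  fun x => if a ≤ x ∧ x < a + R then g (x - a) else mem x

theorem Cfg.lt_word (C : Cfg) {x : ℕ} (hx : x < C.B) : x < 2 ^ C.E.w :=
  hx.trans_le ((Nat.le_self_pow (by norm_num) _).trans C.hE.pow_le)

/-- What is certain after `spread`. -/
structure SpreadPost (C : Cfg) (σ : State) (s : ℕ) (σ' : State) : Prop where
  same : Same [21, 24, 25, 27] σ σ'
  ptr : σ'.reg 21 = σ.reg 21 + C.R
  mem : σ'.mem = writeSeg σ.mem (σ.reg 21) C.R (cyclicBit C.R (σ.reg 26) s)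
  time : σ'.time ≤ σ.time + (8 * C.ρ + 40 * C.R + 10)
  wf : WF C.B σ'

/-- The program `spread` writes `cyclicBit R N s` for a uniformly random `s`. -/
theorem spread_spec (C : Cfg) {σ : State} (hs : WF C.B σ) (hN : σ.reg 26 ≤ C.R)
    (hptr : σ.reg 21 + C.R < C.B) {f : State → ℝ≥0∞} (F : ℕ → ℝ≥0∞)
    (hf : ∀ s < C.R, ∀ σ', SpreadPost C σ s σ' → f σ' ≤ F s) :
    TriL C.E (spread C.ρ) σ f ((C.R : ℝ≥0∞)⁻¹ * ∑ s ∈ Finset.range C.R, F s) := by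
  have hRB : C.R < C.B := by omega
  have hR0 := C.R_pos
  have hρ : C.ρ < C.R := Nat.lt_two_pow_self
  have h1B : 1 < C.B := C.hE.two_le
  have hw1 : WF C.B (σ.set 25 C.ρ 2) := hs.set 25 2 (hρ.trans hRB)
  refine TriL.asg_seq C.hE hs C.ρ (by simp; omega) rfl ?_
  refine TriL.seq (g := fun σ' => guard (∃ s < C.R, σ' = ((σ.set 25 C.ρ 2).set 24 s
      (8 * C.ρ + 3)).set 25 0 0) (F (σ'.reg 24))) ?_ fun σ' => TriL.of_guard ?_
  · refine TriL.rand_of (by norm_num) (k := C.ρ) (by simp [Expr.cost]) (C.lt_word hRB).le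
      (C.lt_word (hρ.trans hRB)) ?_
    refine le_of_eq ?_
    have : (2 : ℝ≥0∞) ^ C.ρ = C.R := by unfold Cfg.R; push_cast; rfl
    rw [this]
    congr 1
    refine Finset.sum_congr rfl fun s hs => ?_
    rw [guard_pos ⟨s, Finset.mem_range.1 hs, rfl⟩]
    simp
  · rintro ⟨s, hsR, rfl⟩
    have hw2 := (hw1.set 24 (8 * C.ρ + 3) (hsR.trans hRB)).set 25 0 (show 0 < C.B by omega)
    set σ2 := ((σ.set 25 C.ρ 2).set 24 s (8 * C.ρ + 3)).set 25 0 0 with hσ2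
    have e24 : σ2.reg 24 = s := by simp [hσ2]
    rw [e24]
    refine TriL.asg_seq C.hE hw2 C.R (show 2 ^ C.ρ < C.B from hRB) rfl ?_
    refine (TriL.down_of (u := 27) (fun k σ' => σ'.reg 27 = k ∧ k ≤ C.R ∧ WF C.B σ' ∧
        Same [21, 24, 25, 27] σ σ' ∧ σ'.reg 24 = s ∧ σ'.reg 21 + k = σ.reg 21 + C.R ∧
        (∀ a, σ'.mem a = if σ.reg 21 ≤ a ∧ a < σ'.reg 21 then
          cyclicBit C.R (σ.reg 26) s (a - σ.reg 21) else σ.mem a) ∧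
        σ'.time + 40 * k ≤ σ.time + (8 * C.ρ + 40 * C.R + 9))
      (fun _ _ => F s) ?_ ?_ ?_ C.R _ ?_)
    · rintro k σ' ⟨h1, h2, -⟩
      exact ⟨h1, C.lt_word (by omega)⟩
    · rintro k σ' ⟨h1, h2, h3, h4, h5, h6, h7, h8⟩
      have e26 : σ'.reg 26 = σ.reg 26 := h4 26 (by decide)
      have hbit : cyclicBit C.R (σ.reg 26) s (σ'.reg 21 - σ.reg 21) < C.B :=
        (cyclicBit_le_one hR0 hN _ _).trans_lt h1B
      have hR' : 2 ^ C.ρ < C.B := hRB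
      have hx : cyclicBit C.R (σ.reg 26) s (σ'.reg 21 - σ.reg 21) =
          (σ.reg 26 + (s + (k + 1)) % C.R) / C.R := by
        unfold cyclicBit
        rw [show C.R - (σ'.reg 21 - σ.reg 21) = k + 1 by omega]
      refine TriL.sto_seq C.hE h3.tick (σ'.reg 21) (cyclicBit C.R (σ.reg 26) s (σ'.reg 21 - σ.reg 21))
        (by simp) (by simp [hR']) (by simp) 
        (by rw [hx, ← e26, ← h5, ← h1]; rfl) ?_
      have hw3 := WF.put h3.tick (σ'.reg 21) (1 + 9 + 1) hbit
      refine TriL.asg_of C.hE hw3 (by simp [h1B]) (Nat.le_of_ble_eq_true rfl)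
        (z := σ'.reg 21 + 1) (by simp) rfl (guard_le ?_ le_rfl)
      refine ⟨by simp [h1], by simp, by omega, ?_, ?_, ?_, ?_, ?_, ?_⟩
      · exact (hw3.set 21 _ (by omega)).set 27 _ (by omega)
      · exact ((h4.tick.put _ _ _).set (by decide) _ _).set (by decide) _ _
      · simpa using h5
      · simp; omega
      · intro a
        simp only [State.set_mem, State.put_mem, State.tick_mem, Function.update_apply, h7,
          State.set_reg]
        norm_num
        rcases lt_trichotomy a (σ'.reg 21) with ha | ha | ha
        · simp only [ha.ne, if_false]
          congr 1
          simp only [eq_iff_iff]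
          omega
        · subst ha
          rw [if_pos rfl, if_pos (by omega)]
        · simp only [ha.ne', if_false]
          rw [if_neg (by omega), if_neg (by omega)]
      · simp [Expr.cost]
        show σ'.time + 1 + (1 + 9 + 1) + 4 + 4 + 40 * k ≤ _
        omega
    · rintro σ' ⟨h1, h2, h3, h4, h5, h6, h7, h8⟩
      refine hf s hsR _ ⟨h4.tick, by simpa using h6, ?_, by simp; omega, h3.tick⟩
      funext a
      rw [show σ'.reg 21 = σ.reg 21 + C.R by omega] at h7
      exact h7 a
    · refine ⟨by simp, le_rfl, hw2.set 27 _ hRB, ?_, ?_, ?_, ?_, ?_⟩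
      · exact (((((Same.refl _ σ).set (by decide) _ _).set (by decide) _ _).set (by decide) _ _).set
          (by decide) _ _)
      · simp [hσ2]
      · simp [hσ2]
      · intro a
        simp only [hσ2, State.set_mem, State.set_reg]
        norm_num
      · simp [hσ2, Expr.cost]
        omega

theorem sum_writeSeg {β : Type*} [AddCommMonoid β] (h : ℕ → ℕ → β) (mem g : ℕ → ℕ) (a m R : ℕ) :
    ∑ j ∈ Finset.range (m + R), h j (writeSeg mem (a + m) R g (a + j)) =
      ∑ j ∈ Finset.range m, h j (mem (a + j)) + ∑ q ∈ Finset.range R, h (m + q) (g q) := by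
  rw [Finset.sum_range_add]
  congr 1
  · refine Finset.sum_congr rfl fun j hj => ?_
    have := Finset.mem_range.1 hj
    rw [writeSeg, if_neg (by omega)]
  · refine Finset.sum_congr rfl fun q hq => ?_
    have := Finset.mem_range.1 hq
    rw [writeSeg, if_pos (by omega)]
    congr 2
    omega

namespace Cfg

variable (C : Cfg)

/-- The coefficient of the `j`-th bit of a row. The bits of the digit `i` have the coefficient
`2 ^ i`, and the first bit has the one for which all coefficients add up to `1`. -/
def cf (j : ℕ) : ZMod C.p :=
  if j = 0 then 1 - (C.R : ZMod C.p) * (2 ^ (C.l + 1) - 1) else 2 ^ ((j - 1) / C.R)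

theorem cf_digit {i q : ℕ} (hq : q < C.R) : C.cf (1 + i * C.R + q) = 2 ^ i := by
  rw [cf, if_neg (by omega), show 1 + i * C.R + q - 1 = q + i * C.R by omega,
    Nat.add_mul_div_right _ _ C.R_pos, Nat.div_eq_of_lt hq, zero_add]

theorem sum_cf_mul (k : ℕ) (b : ℕ → ℕ) : ∑ j ∈ Finset.range (1 + k * C.R), C.cf j * (b j : ZMod C.p) =
    C.cf 0 * b 0 + ∑ i ∈ Finset.range k, 2 ^ i * ∑ q ∈ Finset.range C.R,
      (b (1 + i * C.R + q) : ZMod C.p) := by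
  induction k with
  | zero => simp
  | succ k ih =>
    rw [show 1 + (k + 1) * C.R = (1 + k * C.R) + C.R by ring, Finset.sum_range_add, ih,
      Finset.sum_range_succ, add_assoc, Finset.mul_sum _ _ (2 ^ k)]
    congr 2
    exact Finset.sum_congr rfl fun q hq => by rw [C.cf_digit (Finset.mem_range.1 hq)]

theorem K_eq : C.K = 1 + C.l * C.R + C.R := by unfold K; ring

/-- A row is an affine combination, as `StronglyPartite.eval_sum` requires. -/
theorem sum_cf : ∑ j ∈ Finset.range C.K, C.cf j = 1 := by
  have h := C.sum_cf_mul (C.l + 1) (fun _ => 1)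
  simp only [Nat.cast_one, mul_one, Finset.sum_const, Finset.card_range, nsmul_eq_mul] at h
  rw [show C.K = 1 + (C.l + 1) * C.R by unfold K; ring, h, ← Finset.sum_mul]
  have hg : ∑ i ∈ Finset.range (C.l + 1), (2 : ZMod C.p) ^ i = 2 ^ (C.l + 1) - 1 := by
    have := geom_sum_mul (2 : ZMod C.p) (C.l + 1)
    rw [show (2 : ZMod C.p) - 1 = 1 by norm_num, mul_one] at this
    exact this
  rw [hg, cf, if_pos rfl]
  ring

/-- Time for one level. -/
def levelTime : ℕ := 16 * C.ν + 8 * C.ρ + 40 * C.R + 60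

theorem R_lt_B : C.R < C.B := by
  have h1 := C.l_lt
  have h2 := Nat.le_mul_of_pos_right (8 * 2 ^ C.ρ) (show 0 < 2 ^ ((C.c + 2) * C.ν) by positivity)
  unfold R
  omega

theorem one_le_ν : 1 ≤ C.ν := by
  have h1 := C.n_pos
  have h2 := C.n_lt
  rcases Nat.eq_zero_or_pos C.ν with h | h
  · rw [h] at h2; omega
  · exact h

theorem Q_le_G : C.Q ≤ C.G := by rw [Q_eq]; exact C.Z_pow_le_G 2 (by norm_num)
theorem Z_le_G : C.Z ≤ C.G := by simpa using C.Z_pow_le_G 1 (by norm_num)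
theorem n_lt_Z : C.n < C.Z := C.n_lt
theorem ν_lt_Z : C.ν < C.Z := Nat.lt_two_pow_self
theorem two_Q_lt : 2 * C.Q < C.B := by have := C.Q_le_G; have := C.four_G_lt; omega
theorem four_le_G : 4 ≤ C.G := by
  have h2 := C.Q_le_G
  have h3 : 2 ^ 2 ≤ C.Q := Nat.pow_le_pow_right (by norm_num) (by have := C.one_le_ν; omega)
  omega

end Cfg

/-- The invariant of the loop over the levels of a row: `σ` is the state at the start of the row,
`x` the input bit, and `k` digits are still to be split off. -/
structure LevelInv (C : Cfg) (σ : State) (x T k : ℕ) (s : State) : Prop where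
  cnt : s.reg 23 = k
  le : k ≤ C.l
  wf : WF C.B s
  same : Same [21, 22, 23, 24, 25, 26, 27, 28] σ s
  digit : DigitRange C.Q C.y k (s.reg 22)
  ptr : s.reg 21 = σ.reg 21 + (1 + (C.l - k) * C.R)
  bit : ∀ j < 1 + (C.l - k) * C.R, s.mem (σ.reg 21 + j) ≤ 1
  sum : ∑ j ∈ Finset.range (1 + (C.l - k) * C.R), C.cf j * (s.mem (σ.reg 21 + j) : ZMod C.p) +
    2 ^ (C.l - k) * (s.reg 22 : ZMod C.p) = x
  mem : ∀ a, a < σ.reg 21 ∨ σ.reg 21 + C.K ≤ a → s.mem a = σ.mem a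
  time : s.time + C.levelTime * k ≤ T

/-- The bound for the expectation that belongs to `LevelInv`: the weights of the bits that are already
written, and the expected weights of those in the digits to come and in the last digit. -/
noncomputable def levelExp (C : Cfg) (σ : State) (coef : ℕ → ℕ → ℝ≥0∞) (k : ℕ) (s : State) : ℝ≥0∞ :=
  ∑ j ∈ Finset.range (1 + (C.l - k) * C.R), coef j (s.mem (σ.reg 21 + j)) +
    ∑ z ∈ Finset.range (k * C.R), bern C.y (C.Q * C.R) (coef (1 + (C.l - k) * C.R + z)) +
    ∑ q ∈ Finset.range C.R, bern (lastNum C.Q C.y k (s.reg 22)) (C.Q * 2 ^ k * C.R)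
      (coef (1 + C.l * C.R + q))

/-- One round of the loop over the levels: `levelExp` does not grow in expectation, by
`digit_step`. -/
theorem level_spec (C : Cfg) {σ : State} {x T k : ℕ} (coef : ℕ → ℕ → ℝ≥0∞) {s : State}
    (hpar : Par C σ) (hptr : σ.reg 21 + C.K < C.B) (hs : LevelInv C σ x T (k + 1) s) :
    TriL C.E (level C.ρ) s.tick (fun s' => guard (s'.reg 23 = k + 1 ∧
      LevelInv C σ x T k (s'.set 23 k 4)) (levelExp C σ coef k (s'.set 23 k 4)))
      (levelExp C σ coef (k + 1) s) := by
  have hP : Par C s := hpar.same hs.same (by decide)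
  have hR0 := C.R_pos
  have hQ0 := C.Q_pos
  have hyt := le_of_digitRange C.two_Q_le hs.digit
  have hB1 : 1 < C.B := C.hE.two_le
  have hB2 := C.two_Q_lt
  have hν := C.ν_lt_Z
  have hZG := C.Z_le_G
  have h4G := C.four_G_lt
  have h2B : 2 < C.B := by have := C.four_le_G; omega
  -- the part of the expectation that this level does not touch
  set i := C.l - (k + 1) with hi
  have hik : C.l - k = i + 1 := by have := hs.le; omega
  have hptr' := hs.ptr
  rw [← hi] at hptr'
  have hKbound : 1 + i * C.R + C.R ≤ C.K := by
    rw [C.K_eq]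
    have : i * C.R ≤ C.l * C.R := Nat.mul_le_mul_right _ (by omega)
    omega
  set rest : ℝ≥0∞ := ∑ j ∈ Finset.range (1 + i * C.R), coef j (s.mem (σ.reg 21 + j)) +
    ∑ z ∈ Finset.range (k * C.R), bern C.y (C.Q * C.R) (coef (1 + (i + 1) * C.R + z)) with hrest
  set t := s.reg 22 with ht
  let X : ℕ → ℕ → ℝ≥0∞ := fun u r =>
    ∑ q ∈ Finset.range C.R, coef (1 + i * C.R + q) (cyclicBit C.R (t - 2 * nextDigit C.Q C.y t u) r q) +
    ∑ q ∈ Finset.range C.R, bern (lastNum C.Q C.y k (nextDigit C.Q C.y t u)) (C.Q * 2 ^ k * C.R)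
      (coef (1 + C.l * C.R + q))
  have hval : levelExp C σ coef (k + 1) s = ((2 * C.Q : ℕ) : ℝ≥0∞)⁻¹ *
      ∑ u ∈ Finset.range (2 * C.Q), (C.R : ℝ≥0∞)⁻¹ * ∑ r ∈ Finset.range C.R, (rest + X u r) := by
    have hRi : (C.R : ℝ≥0∞)⁻¹ * C.R = 1 := ENNReal.inv_mul_cancel (by simpa using hR0.ne') (by simp)
    have h2Q : ((2 * C.Q : ℕ) : ℝ≥0∞)⁻¹ * (2 * C.Q : ℕ) = 1 :=
      ENNReal.inv_mul_cancel (by simpa using hQ0.ne') (ENNReal.natCast_ne_top _)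
    have h1 : ∀ u, (C.R : ℝ≥0∞)⁻¹ * ∑ r ∈ Finset.range C.R, (rest + X u r) =
        rest + (C.R : ℝ≥0∞)⁻¹ * ∑ r ∈ Finset.range C.R, X u r := by
      intro u
      rw [Finset.sum_add_distrib, Finset.sum_const, Finset.card_range, nsmul_eq_mul, mul_add,
        ← mul_assoc, hRi, one_mul]
    simp only [h1]
    rw [Finset.sum_add_distrib, Finset.sum_const, Finset.card_range, nsmul_eq_mul, mul_add,
        ← mul_assoc, h2Q, one_mul, digit_step hR0 hQ0 C.two_Q_le C.y_add_le hs.digit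
        (fun q => coef (1 + i * C.R + q)) (fun q => coef (1 + C.l * C.R + q)), hrest, levelExp, ← hi,
        show (k + 1) * C.R = C.R + k * C.R by ring, Finset.sum_range_add _ C.R]
    have h2 : ∀ z, 1 + i * C.R + (C.R + z) = 1 + (i + 1) * C.R + z := fun z => by ring
    simp only [h2]
    ring
  rw [hval]
  have hw0 := hs.wf.tick
  have e4 : s.reg 4 = C.ν := hP.ν
  have hw1 : WF C.B (s.tick.set 25 (2 * C.ν + 1) 6) := hw0.set 25 6 (by omega)
  refine TriL.asg_seq C.hE hw0 (2 * C.ν + 1) (by simp [h2B, hB1]) (by simp [e4]) ?_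
  refine TriL.seq (g := fun s' => guard (∃ u < 2 * C.Q, s' = ((s.tick.set 25 (2 * C.ν + 1) 6).set 24 u
      (8 * (2 * C.ν + 1) + 3)).set 25 0 0) ((C.R : ℝ≥0∞)⁻¹ * ∑ r ∈ Finset.range C.R,
      (rest + X (s'.reg 24) r))) ?_ fun s' => TriL.of_guard ?_
  · have h2 : 2 ^ (2 * C.ν + 1) = 2 * C.Q := by unfold Cfg.Q; rw [pow_succ]; ring
    refine TriL.rand_of (by norm_num) (k := 2 * C.ν + 1) (by simp) (h2 ▸ C.lt_word hB2).le
      (C.lt_word (by omega)) (le_of_eq ?_)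
    have h3 : (2 : ℝ≥0∞) ^ (2 * C.ν + 1) = (2 * C.Q : ℕ) := by rw [← h2]; push_cast; rfl
    rw [h2, h3]
    congr 1
    refine Finset.sum_congr rfl fun u hu => ?_
    rw [guard_pos ⟨u, Finset.mem_range.1 hu, rfl⟩]
    simp
  rintro ⟨u, hu, rfl⟩
  obtain ⟨hd1, hd2⟩ := digit_bounds hQ0 C.two_Q_le C.y_add_le hyt hu
  have hnext := digitRange_next hQ0 C.two_Q_le hs.digit hu
  set t' := nextDigit C.Q C.y t u with ht'
  have htB : t < C.B := hs.wf.1 22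
  have hw2 := (hw1.set 24 (8 * (2 * C.ν + 1) + 3) (hu.trans hB2)).set 25 0 (show 0 < C.B by omega)
  set s2 := ((s.tick.set 25 (2 * C.ν + 1) 6).set 24 u (8 * (2 * C.ν + 1) + 3)).set 25 0 0 with hs2
  have e24 : s2.reg 24 = u := by simp [hs2]
  have e8 : s.reg 8 = C.Q := hP.Q
  have e9 : s.reg 9 = C.y := hP.y
  rw [e24]
  refine TriL.asg_seq C.hE hw2 t' (by simp [h2B, hs2, ← ht, e8, e9, hyt])
    (by simp [hs2, e8, e9, ht', nextDigit, ← ht]) ?_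
  have hw3 := hw2.set 28 12 (show t' < C.B by omega)
  refine TriL.asg_seq C.hE hw3 (t - 2 * t') (by simp [h2B, hs2, ← ht, hd1]) (by simp [hs2, ← ht]) ?_
  have hw4 := hw3.set 26 6 (show t - 2 * t' < C.B by omega)
  refine TriL.asg_seq C.hE hw4 t' (by simp) (by simp) ?_
  have hw5 := hw4.set 22 2 (show t' < C.B by omega)
  refine TriL.mono (spread_spec C hw5 ?_ ?_ (fun r => rest + X u r) ?_) (fun _ => le_rfl) le_rfl
  · simpa using hd2
  · simp [hs2]
    rw [hptr']
    omega
  intro r hr s' hpost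
  have hmem : s'.mem = writeSeg s.mem (σ.reg 21 + (1 + i * C.R)) C.R
      (cyclicBit C.R (t - 2 * t') r) := by
    rw [hpost.mem]
    simp [hs2, hptr']
  have e22 : s'.reg 22 = t' := by rw [hpost.same 22 (by decide)]; simp
  have e23 : s'.reg 23 = k + 1 := by rw [hpost.same 23 (by decide)]; simp [hs2, hs.cnt]
  have hlen : 1 + (C.l - k) * C.R = 1 + i * C.R + C.R := by rw [hik]; ring
  refine guard_le ⟨e23, by simp, by omega, hpost.wf.set 23 4 (by have := hs.wf.1 23; rw [hs.cnt] at this; omega), ?_, ?_, ?_, ?_, ?_, ?_, ?_⟩ (le_of_eq ?_)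
  · refine Same.set (Same.trans ?_ (hpost.same.mono (by decide))) (by decide) _ _
    refine ((Same.set (Same.set (Same.set ?_ (by decide) _ _) (by decide) _ _) (by decide) _ _))
    exact ((hs.same.tick.set (by decide) _ _).set (by decide) _ _).set (by decide) _ _
  · simpa [e22] using hnext
  · simp only [State.set_reg]
    rw [Function.update_of_ne (by norm_num), hpost.ptr, hlen]
    simp [hs2, hptr']
    ring
  · intro j hj
    rw [hlen] at hj
    simp only [State.set_mem, hmem, writeSeg]
    split_ifs with hc
    · exact cyclicBit_le_one hR0 hd2 _ _
    · exact hs.bit j (by rw [← hi]; omega)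
  · simp only [State.set_mem, hmem, State.set_reg]
    rw [Function.update_of_ne (by norm_num), e22, hlen,
      sum_writeSeg (fun j z => C.cf j * (z : ZMod C.p)), hik, ← hs.sum, ← hi, ← ht, add_assoc]
    congr 1
    have h1 : ∑ q ∈ Finset.range C.R, C.cf (1 + i * C.R + q) *
        (cyclicBit C.R (t - 2 * t') r q : ZMod C.p) = 2 ^ i * ((t - 2 * t' : ℕ) : ZMod C.p) := by
      conv_rhs => rw [← sum_cyclicBit_eq (s := r) hd2, Nat.cast_sum, Finset.mul_sum]
      exact Finset.sum_congr rfl fun q hq => by rw [C.cf_digit (Finset.mem_range.1 hq)]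
    rw [h1, Nat.cast_sub hd1, pow_succ]
    push_cast
    ring
  · intro a ha
    simp only [State.set_mem, hmem, writeSeg]
    rw [if_neg (by omega), hs.mem a ha]
  · have h1 := hpost.time
    have h2 := hs.time
    have h3 : C.levelTime * (k + 1) = C.levelTime * k + C.levelTime := by ring
    rw [h3] at h2
    simp [hs2] at h1
    simp only [State.set_time]
    have h4 : C.levelTime = 16 * C.ν + 8 * C.ρ + 40 * C.R + 60 := rfl
    omega
  · rw [levelExp]
    simp only [State.set_mem, hmem, State.set_reg]
    rw [Function.update_of_ne (by norm_num), e22, hlen, sum_writeSeg, hrest]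
    have h2 : ∀ z, 1 + i * C.R + C.R + z = 1 + (i + 1) * C.R + z := fun z => by ring
    simp only [h2, X]
    ring

/-- Time for one row. -/
def Cfg.rowTime (C : Cfg) : ℕ := C.levelTime * (C.l + 2)

/-- What is certain after `row`. -/
structure RowPost (C : Cfg) (σ σ' : State) : Prop where
  same : Same [21, 22, 23, 24, 25, 26, 27, 28] σ σ'
  ptr : σ'.reg 21 = σ.reg 21 + C.K
  bit : ∀ j < C.K, σ'.mem (σ.reg 21 + j) ≤ 1
  sum : ∑ j ∈ Finset.range C.K, C.cf j * (σ'.mem (σ.reg 21 + j) : ZMod C.p) =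
    (C.E.input (C.n - σ.reg 20) : ZMod C.p)
  mem : ∀ a, a < σ.reg 21 ∨ σ.reg 21 + C.K ≤ a → σ'.mem a = σ.mem a
  time : σ'.time ≤ σ.time + C.rowTime
  wf : WF C.B σ'

theorem Cfg.TT_add_lt (C : Cfg) : C.TT + C.p + C.C0 < C.B := by
  have h1 : C.R * (2 ^ (C.l + 1) - 1) + 1 ≤ C.R * (2 * 2 ^ C.l) + 1 := by
    rw [pow_succ]
    gcongr
    omega
  have hR0 := C.R_pos
  have h2 : C.y * (2 ^ (C.l + 1) - 1) / C.Q ≤ C.R * (2 ^ (C.l + 1) - 1) := by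
    refine Nat.div_le_of_le_mul ?_
    have h3 : C.y ≤ C.Q * C.R := by
      have := C.y_add_le
      rw [mul_comm C.Q]
      omega
    calc _ ≤ C.Q * C.R * (2 ^ (C.l + 1) - 1) := Nat.mul_le_mul_right _ h3
      _ = _ := by ring
  have h4 : C.p ≤ C.R * 2 ^ C.l := C.p_le.trans (Nat.le_mul_of_pos_left _ hR0)
  have h5 : 8 * (C.R * 2 ^ C.l) < C.B := by
    have := C.l_lt
    rw [mul_assoc] at this
    exact this
  have e1 : C.R * (2 * 2 ^ C.l) = 2 * (C.R * 2 ^ C.l) := by ring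
  unfold Cfg.TT Cfg.C0
  omega

/-- The end of a row: the last number is spread. -/
theorem last_spec (C : Cfg) {σ : State} {x T : ℕ} (coef : ℕ → ℕ → ℝ≥0∞) {s : State}
    (hptr : σ.reg 21 + C.K < C.B) (hs : LevelInv C σ x T 0 s) {f : State → ℝ≥0∞}
    (hf : ∀ s', Same [21, 22, 23, 24, 25, 26, 27, 28] σ s' → s'.reg 21 = σ.reg 21 + C.K →
      (∀ j < C.K, s'.mem (σ.reg 21 + j) ≤ 1) →
      ∑ j ∈ Finset.range C.K, C.cf j * (s'.mem (σ.reg 21 + j) : ZMod C.p) = x →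
      (∀ a, a < σ.reg 21 ∨ σ.reg 21 + C.K ≤ a → s'.mem a = σ.mem a) →
      s'.time ≤ T + C.levelTime → WF C.B s' →
      f s' ≤ ∑ j ∈ Finset.range C.K, coef j (s'.mem (σ.reg 21 + j))) :
    TriL C.E (block [asg 26 (.var 22), spread C.ρ]) s.tick f (levelExp C σ coef 0 s) := by
  have hR0 := C.R_pos
  have hQ0 := C.Q_pos
  have hle := last_digit_le hQ0 C.y_add_le hs.digit
  have hptr' := hs.ptr
  rw [Nat.sub_zero] at hptr'
  have hK := C.K_eq
  set t := s.reg 22 with ht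
  have hw0 := hs.wf.tick
  have hval : levelExp C σ coef 0 s = (C.R : ℝ≥0∞)⁻¹ * ∑ r ∈ Finset.range C.R,
      (∑ j ∈ Finset.range (1 + C.l * C.R), coef j (s.mem (σ.reg 21 + j)) +
        ∑ q ∈ Finset.range C.R, coef (1 + C.l * C.R + q) (cyclicBit C.R t r q)) := by
    have hRi : (C.R : ℝ≥0∞)⁻¹ * C.R = 1 := ENNReal.inv_mul_cancel (by simpa using hR0.ne') (by simp)
    have h1 : lastNum C.Q C.y 0 t = C.Q * t := by simp [lastNum, mul_comm]
    rw [levelExp, ← ht, h1, Finset.sum_add_distrib, Finset.sum_const, Finset.card_range,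
      nsmul_eq_mul, mul_add, ← mul_assoc, hRi, one_mul, Finset.sum_comm, Finset.mul_sum]
    simp only [zero_mul, Finset.range_zero, Finset.sum_empty, add_zero, Nat.sub_zero, pow_zero,
      mul_one]
    congr 1
    refine Finset.sum_congr rfl fun q _ => ?_
    rw [bern_mul hQ0, ← sum_bern_cyclicBit hle _ q]
  rw [hval]
  refine TriL.asg_seq C.hE hw0 t (by simp) (by simp [ht]) ?_
  have hw1 := hw0.set 26 2 (show t < C.B by omega)
  refine TriL.mono (spread_spec C hw1 (by simpa using hle) (by simp; omega) (fun r =>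
    ∑ j ∈ Finset.range (1 + C.l * C.R), coef j (s.mem (σ.reg 21 + j)) +
        ∑ q ∈ Finset.range C.R, coef (1 + C.l * C.R + q) (cyclicBit C.R t r q)) ?_)
      (fun _ => le_rfl) le_rfl
  intro r hr s' hpost
  have hmem : s'.mem = writeSeg s.mem (σ.reg 21 + (1 + C.l * C.R)) C.R (cyclicBit C.R t r) := by
    rw [hpost.mem]
    simp [hptr']
  refine (hf s' ?_ ?_ ?_ ?_ ?_ ?_ hpost.wf).trans (le_of_eq ?_)
  · exact Same.trans ((hs.same.tick.set (by decide) _ _)) (hpost.same.mono (by decide))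
  · rw [hpost.ptr]
    simp [hptr', hK]
    ring
  · intro j hj
    simp only [hmem, writeSeg]
    split_ifs with hc
    · exact cyclicBit_le_one hR0 hle _ _
    · exact hs.bit j (by rw [Nat.sub_zero]; omega)
  · have h1 := hs.sum
    rw [Nat.sub_zero] at h1
    rw [hmem, hK, sum_writeSeg (fun j z => C.cf j * (z : ZMod C.p)), ← h1]
    congr 1
    rw [← ht]
    conv_rhs => rw [← sum_cyclicBit_eq (s := r) hle, Nat.cast_sum, Finset.mul_sum]
    exact Finset.sum_congr rfl fun q hq => by rw [C.cf_digit (Finset.mem_range.1 hq)]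
  · intro a ha
    simp only [hmem, writeSeg]
    rw [if_neg (by omega), hs.mem a ha]
  · have h1 := hpost.time
    have h2 := hs.time
    simp at h1
    have h4 : C.levelTime = 16 * C.ν + 8 * C.ρ + 40 * C.R + 60 := rfl
    omega
  · rw [hmem, hK, sum_writeSeg]

/-- The bits of a row surely encode the input bit. They are far from independent, but weights that
are additive over them only see their marginals, which are dominated by `w` for either input bit. -/
theorem row_spec (C : Cfg) {σ : State} (coef : ℕ → ℕ → ℝ≥0∞) (hpar : Par C σ) (hwf : WF C.B σ)
    (hptr : σ.reg 21 + C.K < C.B) (hI : σ.reg 20 ≤ C.n) {f : State → ℝ≥0∞}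
    (hf : ∀ σ', RowPost C σ σ' → f σ' ≤ ∑ j ∈ Finset.range C.K, coef j (σ'.mem (σ.reg 21 + j))) :
    TriL C.E (row C.ρ) σ f
      (∑ j ∈ Finset.range C.K, (C.w true * coef j 1 + C.w false * coef j 0)) := by
  have hR0 := C.R_pos
  have hQ0 := C.Q_pos
  have hB1 : 1 < C.B := C.hE.two_le
  have hB2 := C.two_Q_lt
  have hν := C.ν_lt_Z
  have hZG := C.Z_le_G
  have h4G := C.four_G_lt
  have h2B : 2 < C.B := by have := C.four_le_G; omega
  have hM : C.M < C.Q := C.M_lt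
  have hK := C.K_eq
  have hTT := C.TT_add_lt
  have hp := C.p_pos
  have hptr2 : σ.reg 21 + 1 < C.B := by omega
  have hlB : C.l < C.B := by
    have h1 := C.l_lt
    have h2 : C.l < 2 ^ C.l := Nat.lt_two_pow_self
    have h3 : 2 ^ C.l ≤ 8 * 2 ^ C.ρ * 2 ^ C.l := Nat.le_mul_of_pos_left _ (by positivity)
    unfold Cfg.l at *
    omega
  set x := C.E.input (C.n - σ.reg 20) with hx
  -- the bound for the part of the row after the first bit
  let Rest : ℝ≥0∞ := ∑ z ∈ Finset.range (C.l * C.R), bern C.y (C.Q * C.R) (coef (1 + z)) +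
    ∑ q ∈ Finset.range C.R, (C.w true * coef (1 + C.l * C.R + q) 1 +
      C.w false * coef (1 + C.l * C.R + q) 0)
  have hval : (C.Q : ℝ≥0∞)⁻¹ * ∑ u ∈ Finset.range C.Q, (coef 0 ((C.M + u) / C.Q) + Rest) ≤
      ∑ j ∈ Finset.range C.K, (C.w true * coef j 1 + C.w false * coef j 0) := by
    have hQi : (C.Q : ℝ≥0∞)⁻¹ * C.Q = 1 := ENNReal.inv_mul_cancel (by simpa using hQ0.ne') (by simp)
    have h1 : (C.Q : ℝ≥0∞)⁻¹ * ∑ u ∈ Finset.range C.Q, coef 0 ((C.M + u) / C.Q) =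
        bern C.y (C.Q * C.R) (coef 0) := by
      rw [sum_range_add_div hM.le, Cfg.y, mul_comm C.Q, bern_mul hR0, bern,
        ENNReal.div_eq_inv_mul]
      simp
    have hb : ∀ j, bern C.y (C.Q * C.R) (coef j) ≤ C.w true * coef j 1 + C.w false * coef j 0 :=
      fun j => C.bern_le _
    rw [Finset.sum_add_distrib, mul_add, h1, Finset.sum_const, Finset.card_range, nsmul_eq_mul,
      ← mul_assoc, hQi, one_mul, hK, Finset.sum_range_add _ _ C.R, Finset.sum_range_add _ 1,
      Finset.sum_range_one]
    simp only [Rest]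
    rw [← add_assoc]
    gcongr
    · exact hb 0
    · exact hb _
  refine TriL.mono ?_ (fun _ => le_rfl) hval
  have e1 := hpar.n
  have e2 := hpar.p
  have e4 := hpar.ν
  have e8 := hpar.Q
  have e10 := hpar.M
  have e11 := hpar.l
  have e14 := hpar.TT
  have e15 := hpar.C0
  refine TriL.asg_seq C.hE hwf (2 * C.ν) (by simp [h2B]) (by simp [e4]) ?_
  have hw1 := hwf.set 25 4 (show 2 * C.ν < C.B by omega)
  refine TriL.seq (g := fun s' => guard (∃ u < C.Q, s' = ((σ.set 25 (2 * C.ν) 4).set 24 u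
      (8 * (2 * C.ν) + 3)).set 25 0 0) (coef 0 ((C.M + s'.reg 24) / C.Q) + Rest)) ?_
      fun s' => TriL.of_guard ?_
  · refine TriL.rand_of (by norm_num) (k := 2 * C.ν) (by simp)
      (C.lt_word (show C.Q < C.B by omega)).le (C.lt_word (by omega)) (le_of_eq ?_)
    have h3 : (2 : ℝ≥0∞) ^ (2 * C.ν) = C.Q := by unfold Cfg.Q; push_cast; rfl
    rw [h3]
    show _ * ∑ u ∈ Finset.range C.Q, _ = _
    congr 1
    refine Finset.sum_congr rfl fun u hu => ?_
    rw [guard_pos ⟨u, Finset.mem_range.1 hu, rfl⟩]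
    simp
  rintro ⟨u, hu, rfl⟩
  have hw2 := (hw1.set 24 (8 * (2 * C.ν) + 3) (show u < C.B by omega)).set 25 0 (show 0 < C.B by omega)
  set s2 := ((σ.set 25 (2 * C.ν) 4).set 24 u (8 * (2 * C.ν) + 3)).set 25 0 0 with hs2
  have e24 : s2.reg 24 = u := by simp [hs2]
  rw [e24]
  set b := (C.M + u) / C.Q with hb
  have hb1 : b ≤ 1 := by
    rw [hb, ← Nat.lt_succ_iff, Nat.div_lt_iff_lt_mul hQ0]
    omega
  refine TriL.asg_seq C.hE hw2 b (by simp) (by simp [hs2, e8, e10, hb]) ?_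
  have hw3 := hw2.set 26 6 (show b < C.B by omega)
  refine TriL.sto_seq C.hE hw3 (σ.reg 21) b (by simp) (by simp) (by simp [hs2]) (by simp) ?_
  have hw4 := hw3.put (σ.reg 21) 3 (show b < C.B by omega)
  refine TriL.asg_seq C.hE hw4 (σ.reg 21 + 1) (by simp [hB1]) (by simp [hs2]) ?_
  have hw5 := hw4.set 21 4 hptr2
  set r := (x + b * C.C0 + (C.p - C.TT % C.p)) % C.p with hr
  have hrp : r < C.p := Nat.mod_lt _ hp
  refine TriL.asg_seq C.hE hw5 (C.TT + r) ?_ (by simp [hs2, e1, e2, e14, e15, ← hx, hr]) ?_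
  · have := Nat.mod_lt C.TT hp
    simp [hs2, e1, e2, e14, hI, this.le]
  have hw6 := hw5.set 22 19 (show C.TT + r < C.B by omega)
  refine TriL.asg_seq C.hE hw6 C.l (by simp) (by simp [hs2, e11]) ?_
  have hw7 := hw6.set 23 2 hlB
  set s7 := ((((((s2.set 26 b 6).put (σ.reg 21) b 3).set 21 (σ.reg 21 + 1) 4).set 22 (C.TT + r)
    19).set 23 C.l 2)) with hs7
  have hxr : C.cf 0 * (b : ZMod C.p) + ((C.TT + r : ℕ) : ZMod C.p) = x := by
    have h1 : ((C.TT + r : ℕ) : ZMod C.p) = (x + b * C.C0 : ℕ) := by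
      rw [ZMod.natCast_eq_natCast_iff]
      have h2 : C.TT + (x + b * C.C0 + (C.p - C.TT % C.p)) = x + b * C.C0 + C.p * (C.TT / C.p + 1) := by
        have h3 := Nat.div_add_mod C.TT C.p
        have h4 := Nat.mod_lt C.TT hp
        rw [mul_add, mul_one]
        omega
      calc C.TT + r ≡ C.TT + (x + b * C.C0 + (C.p - C.TT % C.p)) [MOD C.p] :=
            Nat.ModEq.add_left _ (Nat.mod_modEq _ _)
        _ = x + b * C.C0 + C.p * (C.TT / C.p + 1) := h2
        _ ≡ x + b * C.C0 [MOD C.p] := by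
            simp [Nat.ModEq]
    have h5 : 1 ≤ 2 ^ (C.l + 1) := Nat.one_le_two_pow
    have h6 : 1 ≤ C.R * (2 ^ (C.l + 1) - 1) := by
      have : 1 ≤ 2 ^ (C.l + 1) - 1 := by
        have : 2 ^ 1 ≤ 2 ^ (C.l + 1) := Nat.pow_le_pow_right (by norm_num) (by omega)
        omega
      exact Nat.mul_pos hR0 this
    rw [h1, Cfg.cf, if_pos rfl, Cfg.C0]
    push_cast [Nat.cast_sub h6, Nat.cast_sub h5]
    ring
  have hinv : LevelInv C σ x (s7.time + C.levelTime * C.l) C.l s7 := by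
    refine ⟨by simp [hs7], le_rfl, hw7, ?_, ?_, ?_, ?_, ?_, ?_, le_rfl⟩
    · refine Same.set (Same.set (Same.set (Same.put (Same.set ?_ (by decide) _ _) _ _ _)
        (by decide) _ _) (by decide) _ _) (by decide) _ _
      exact (((Same.refl _ σ).set (by decide) _ _).set (by decide) _ _).set (by decide) _ _
    · have : s7.reg 22 = C.TT + r := by simp [hs7]
      rw [this]
      exact digitRange_start hQ0 C.p_le hrp
    · simp [hs7]
    · intro j hj
      obtain rfl : j = 0 := by simpa using hj
      simpa [hs7] using hb1
    · have : s7.reg 22 = C.TT + r := by simp [hs7]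
      rw [this, ← hxr]
      simp [hs7]
    · intro a ha
      have : a ≠ σ.reg 21 := by omega
      simp [hs7, hs2, this]
  have hφ : levelExp C σ coef C.l s7 ≤ coef 0 b + Rest := by
    have e1 : s7.reg 22 = C.TT + r := by simp [hs7]
    have e2 : s7.mem (σ.reg 21) = b := by simp [hs7]
    simp only [levelExp, Nat.sub_self, zero_mul, add_zero, Finset.sum_range_one, e1, e2, Rest]
    rw [add_assoc]
    gcongr
    exact C.bern_last_le r hrp _
  refine TriL.mono ?_ (fun _ => le_rfl) hφ
  refine TriL.seq (g := fun s' => guard (∃ s, LevelInv C σ x (s7.time + C.levelTime * C.l) 0 s ∧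
    s' = s.tick) (levelExp C σ coef 0 s')) ?_ fun s' => TriL.of_guard ?_
  · refine TriL.down_of (LevelInv C σ x (s7.time + C.levelTime * C.l)) (levelExp C σ coef) ?_ ?_ ?_
      C.l s7 hinv
    · exact fun k s h => ⟨h.cnt, C.lt_word (by have := h.le; omega)⟩
    · exact fun k s h => level_spec C coef hpar hptr h
    · exact fun s h => guard_le ⟨s, h, rfl⟩ le_rfl
  · rintro ⟨s, hs, rfl⟩
    refine last_spec C coef hptr hs fun s' h1 h2 h3 h4 h5 h6 h7 => hf s' ⟨h1, h2, h3, h4, h5, ?_, h7⟩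
    have e : s7.time = σ.time + (16 * C.ν + 41) := by
      simp [hs7, hs2]
      ring
    rw [e] at h6
    have h8 : C.rowTime = C.levelTime * C.l + 2 * C.levelTime := by unfold Cfg.rowTime; ring
    have h9 : C.levelTime = 16 * C.ν + 8 * C.ρ + 40 * C.R + 60 := rfl
    omega

/-! ### Sampling all rows -/

namespace Cfg

variable (C : Cfg)

/-- The address of the bit that the query with index `τ` uses for the input position `i`. The
digits of `τ` in base `K` select one bit per row for each part of the input positions. -/
def addr (τ i : ℕ) : ℕ := 2 * C.G + i * C.K + τ / C.K ^ C.E.table (i + 3) % C.K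

/-- The query with index `τ`. -/
def qry (mem : ℕ → ℕ) (τ : ℕ) (i : Fin C.n) : Bool := mem (C.addr τ i) == 1

theorem digit_lt (τ m : ℕ) : τ / C.K ^ m % C.K < C.K := Nat.mod_lt _ C.K_pos

theorem n_mul_K_le : C.n * C.K ≤ C.G :=
  calc C.n * C.K ≤ C.Z * C.Z := Nat.mul_le_mul C.n_lt_Z.le C.K_le
    _ = C.Z ^ 2 := by ring
    _ ≤ C.G := C.Z_pow_le_G 2 (by norm_num)

/-- The bits for the first `k` input positions are in place: `σ` is the state before sampling. -/
structure RowsInv (k : ℕ) (σ s : State) : Prop where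
  wf : WF C.B s
  same : Same [20, 21, 22, 23, 24, 25, 26, 27, 28] σ s
  bit : ∀ i < k, ∀ j < C.K, s.mem (2 * C.G + i * C.K + j) ≤ 1
  sum : ∀ i < k, ∑ j ∈ Finset.range C.K, C.cf j * (s.mem (2 * C.G + i * C.K + j) : ZMod C.p) =
    (C.E.input i : ZMod C.p)
  mem : ∀ a, a < 2 * C.G ∨ 2 * C.G + C.n * C.K ≤ a → s.mem a = σ.mem a

/-- Time for all rows. -/
def rowsTime : ℕ := C.n * (C.rowTime + 5) + 10

end Cfg

/-- The next row reveals one bit of each query. Each query uses only one bit of the row, so that the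
sum over the queries is additive over the bits of the row and `row_spec` applies. -/
theorem rows_body (C : Cfg) {σ : State} {T k : ℕ} (F : (Fin C.n → Bool) → ℝ≥0∞)
    (hpar : Par C σ) {s : State} (h20 : s.reg 20 = k + 1) (hk : k + 1 ≤ C.n)
    (h21 : s.reg 21 = 2 * C.G + (C.n - (k + 1)) * C.K) (hs : C.RowsInv (C.n - (k + 1)) σ s)
    (hT : s.time + (C.rowTime + 5) * (k + 1) ≤ T) :
    TriL C.E (row C.ρ) s.tick (fun s' => guard (s'.reg 20 = k + 1 ∧
      (s'.set 20 k 4).reg 20 = k ∧ k ≤ C.n ∧ s'.reg 21 = 2 * C.G + (C.n - k) * C.K ∧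
      C.RowsInv (C.n - k) σ (s'.set 20 k 4) ∧ (s'.set 20 k 4).time + (C.rowTime + 5) * k ≤ T)
      (∑ τ ∈ Finset.range C.KD, tailSum C.w F (C.n - k) (C.qry s'.mem τ)))
      (∑ τ ∈ Finset.range C.KD, tailSum C.w F (C.n - (k + 1)) (C.qry s.mem τ)) := by
  have h4G := C.four_G_lt
  have hnK := C.n_mul_K_le
  set i := C.n - (k + 1) with hi
  have hin : i < C.n := by omega
  have hik : C.n - k = i + 1 := by omega
  have hiK : i * C.K + C.K ≤ C.n * C.K := by
    calc i * C.K + C.K = (i + 1) * C.K := by ring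
      _ ≤ _ := Nat.mul_le_mul_right _ hin
  let g : ℕ → Bool → ℝ≥0∞ := fun τ β =>
    tailSum C.w F (i + 1) (Function.update (C.qry s.mem τ) ⟨i, hin⟩ β)
  let dg : ℕ → ℕ := fun τ => τ / C.K ^ C.E.table (i + 3) % C.K
  -- the weight of the bit `j` of the row collects the queries that select this bit
  let coef : ℕ → ℕ → ℝ≥0∞ := fun j z => ∑ τ ∈ Finset.range C.KD,
    if dg τ = j then g τ (z == 1) else 0
  have pick : ∀ z : ℕ → ℕ, ∑ j ∈ Finset.range C.K, coef j (z j) =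
      ∑ τ ∈ Finset.range C.KD, g τ (z (dg τ) == 1) := by
    intro z
    simp only [coef]
    rw [Finset.sum_comm]
    refine Finset.sum_congr rfl fun τ _ => ?_
    rw [Finset.sum_ite_eq, if_pos (Finset.mem_range.2 (C.digit_lt _ _))]
  have hval : ∑ j ∈ Finset.range C.K, (C.w true * coef j 1 + C.w false * coef j 0) =
      ∑ τ ∈ Finset.range C.KD, tailSum C.w F i (C.qry s.mem τ) := by
    rw [Finset.sum_add_distrib, ← Finset.mul_sum, ← Finset.mul_sum, pick fun _ => 1,
      pick fun _ => 0, Finset.mul_sum, Finset.mul_sum, ← Finset.sum_add_distrib]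
    refine Finset.sum_congr rfl fun τ _ => ?_
    rw [tailSum_succ C.w F ⟨i, hin⟩, Fintype.sum_bool]
    rfl
  rw [← hval]
  refine row_spec C (σ := s.tick) coef (hpar.same hs.same (by decide)) hs.wf.tick (by rw [State.tick_reg]; omega)
    (by rw [State.tick_reg]; omega) fun s' hp => ?_
  have e21 : s'.reg 21 = 2 * C.G + i * C.K + C.K := by rw [hp.ptr]; simp [h21]
  have e20 : s'.reg 20 = k + 1 := by rw [hp.same 20 (by decide)]; simp [h20]
  have hmem := hp.mem
  have hbit := hp.bit
  have hsum := hp.sum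
  have htime := hp.time
  simp only [State.tick_reg, State.tick_mem, State.tick_time, h21, h20] at hmem hbit hsum htime
  have hold : ∀ i' < i, ∀ j < C.K, s'.mem (2 * C.G + i' * C.K + j) =
      s.mem (2 * C.G + i' * C.K + j) := by
    intro i' hi' j hj
    refine hmem _ (Or.inl ?_)
    have : i' * C.K + C.K ≤ i * C.K := by
      calc i' * C.K + C.K = (i' + 1) * C.K := by ring
        _ ≤ _ := Nat.mul_le_mul_right _ hi'
    omega
  refine guard_le ⟨e20, by simp, by omega, by rw [e21, hik]; ring, ?_, ?_⟩ (le_of_eq ?_)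
  · rw [hik]
    refine ⟨hp.wf.set 20 4 ?_, ?_, ?_, ?_, ?_⟩
    · have := hs.wf.1 20
      omega
    · exact Same.set (Same.trans hs.same (Same.mono (Same.trans (Same.tick (Same.refl _ _)) hp.same)
        (by decide))) (by decide) _ _
    · intro i' hi' j hj
      rcases Nat.lt_succ_iff_lt_or_eq.1 hi' with h | rfl
      · rw [State.set_mem, hold i' h j hj]
        exact hs.bit i' h j hj
      · exact hbit j hj
    · intro i' hi'
      rcases Nat.lt_succ_iff_lt_or_eq.1 hi' with h | rfl
      · rw [← hs.sum i' h]
        refine Finset.sum_congr rfl fun j hj => ?_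
        rw [State.set_mem, hold i' h j (Finset.mem_range.1 hj)]
      · exact hsum
    · intro a ha
      rw [State.set_mem, hmem a (by omega), hs.mem a ha]
  · simp only [State.set_time]
    have : (C.rowTime + 5) * (k + 1) = (C.rowTime + 5) * k + (C.rowTime + 5) := by ring
    omega
  · rw [pick]
    refine Finset.sum_congr rfl fun τ _ => ?_
    simp only [g, hik]
    refine tailSum_congr C.w F fun i' hi' => ?_
    by_cases hii : i' = ⟨i, hin⟩
    · subst hii
      simp only [Function.update_self, Cfg.qry, Cfg.addr, State.tick_reg, h21, dg]
    · have hlt : i'.val < i := by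
        have : i'.val ≠ i := fun h => hii (Fin.ext h)
        omega
      rw [Function.update_of_ne hii]
      simp only [Cfg.qry, Cfg.addr]
      rw [hold _ hlt _ (C.digit_lt _ _)]

/-- Sampling all rows: the queries behave as if all bits of a query were sampled independently with
the weights `w`, as far as upper bounds for expectations are concerned. -/
theorem rows_spec (C : Cfg) {σ : State} (F : (Fin C.n → Bool) → ℝ≥0∞) (hpar : Par C σ)
    (hwf : WF C.B σ) {f : State → ℝ≥0∞}
    (hf : ∀ s, C.RowsInv C.n σ s → s.time ≤ σ.time + C.rowsTime →
      f s ≤ ∑ τ ∈ Finset.range C.KD, F (C.qry s.mem τ)) :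
    TriL C.E (rows C.ρ) σ f (C.KD * ∑ z, (∏ i, C.w (z i)) * F z) := by
  have h4G := C.four_G_lt
  have hn := C.n_lt_Z
  have hZ := C.Z_le_G
  refine TriL.asg_seq C.hE hwf (2 * C.G) (by simp; omega) (by simp [hpar.G]) ?_
  have hw1 := hwf.set 21 4 (show 2 * C.G < C.B by omega)
  refine TriL.asg_seq C.hE hw1 C.n (by simp) (by simp [hpar.n]) ?_
  have hw2 := hw1.set 20 2 (show C.n < C.B by omega)
  set s2 := (σ.set 21 (2 * C.G) 4).set 20 C.n 2 with hs2
  refine (TriL.down_of (u := 20) (fun k s => s.reg 20 = k ∧ k ≤ C.n ∧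
      s.reg 21 = 2 * C.G + (C.n - k) * C.K ∧ C.RowsInv (C.n - k) σ s ∧
      s.time + (C.rowTime + 5) * k ≤ σ.time + C.rowsTime - 1)
    (fun k s => ∑ τ ∈ Finset.range C.KD, tailSum C.w F (C.n - k) (C.qry s.mem τ)) ?_ ?_ ?_
    C.n s2 ?_).mono (fun _ => le_rfl) (le_of_eq ?_)
  · exact fun k s h => ⟨h.1, C.lt_word (by omega)⟩
  · rintro k s ⟨h1, h2, h3, h4, h5⟩
    refine (rows_body C F hpar h1 h2 h3 h4 h5).mono (fun s' => ?_) le_rfl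
    refine le_guard fun h => guard_le ⟨h.1, h.2.1, h.2.2.1, by simpa using h.2.2.2.1, h.2.2.2.2⟩ ?_
    simp
  · rintro s ⟨h1, h2, h3, h4, h5⟩
    rw [Nat.sub_zero] at h4
    refine (hf s.tick ⟨h4.wf.tick, h4.same.tick, h4.bit, h4.sum, h4.mem⟩ ?_).trans (le_of_eq ?_)
    · simp only [State.tick_time]
      unfold Cfg.rowsTime at *
      omega
    · simp only [Nat.sub_zero, tailSum_self]
      rfl
  · refine ⟨by simp [hs2], le_rfl, by simp [hs2], ?_, ?_⟩
    · rw [Nat.sub_self]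
      refine ⟨hw2, ?_, by simp, by simp, by simp [hs2]⟩
      exact ((Same.refl _ σ).set (by decide) _ _).set (by decide) _ _
    · simp [hs2, Cfg.rowsTime]
      rw [mul_comm]
      omega
  · simp [tailSum_zero]

/-! ### One query -/

namespace Cfg

variable (C : Cfg)

/-- The `m`-th digit of `τ` in base `K`. -/
def dig (τ m : ℕ) : ℕ := τ / C.K ^ m % C.K

theorem p_lt_B : C.p < C.B := by have := C.TT_add_lt; omega

theorem d_le_G : C.d ≤ C.G := (show C.d ≤ C.Z from C.d_le).trans C.Z_le_G

theorem cast_neg_C0 : ((C.p - C.C0 % C.p : ℕ) : ZMod C.p) = C.cf 0 := by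
  have h1 := Nat.mod_lt C.C0 C.p_pos
  have h5 : 1 ≤ 2 ^ (C.l + 1) := Nat.one_le_two_pow
  have h6 : 1 ≤ C.R * (2 ^ (C.l + 1) - 1) := by
    have : 1 ≤ 2 ^ (C.l + 1) - 1 := by
      have : 2 ^ 1 ≤ 2 ^ (C.l + 1) := Nat.pow_le_pow_right (by norm_num) (by omega)
      omega
    exact Nat.mul_pos C.R_pos this
  rw [Nat.cast_sub h1.le, ZMod.natCast_mod, cf, if_pos rfl, C0]
  push_cast [Nat.cast_sub h6, Nat.cast_sub h5, CharP.cast_eq_zero]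
  ring

theorem pow_digit_lt {j : ℕ} (hj : j < C.K) : 2 ^ ((j - 1) / C.R) < C.B := by
  have h1 : (j - 1) / C.R ≤ C.l := by
    rw [← Nat.lt_succ_iff, Nat.div_lt_iff_lt_mul C.R_pos]
    have := C.K_eq
    have : (C.l + 1) * C.R = C.l * C.R + C.R := by ring
    have := C.R_pos
    rw [Nat.succ_eq_add_one]
    omega
  have h2 : 2 ^ ((j - 1) / C.R) ≤ 2 ^ C.l := Nat.pow_le_pow_right (by norm_num) h1
  have h3 : 2 ^ C.l ≤ 8 * 2 ^ C.ρ * 2 ^ C.l := Nat.le_mul_of_pos_left _ (by positivity)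
  have h4 : 8 * 2 ^ C.ρ * 2 ^ C.l < C.B := C.l_lt
  omega

end Cfg

/-- After `q` digits: `σ` is the state at the start of the query with index `τ`. -/
structure DigitsInv (C : Cfg) (σ : State) (τ q : ℕ) (s : State) : Prop where
  wf : WF C.B s
  same : Same [21, 22, 23, 24] σ s
  idx : s.reg 21 = τ / C.K ^ q
  coef_lt : s.reg 22 < C.p
  coef : (s.reg 22 : ZMod C.p) = ∏ m ∈ Finset.range q, C.cf (C.dig τ m)
  digit : ∀ m < q, s.mem (C.G + m) = C.dig τ m
  mem : ∀ a, a < C.G ∨ 2 * C.G ≤ a → s.mem a = σ.mem a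

theorem digits_body (C : Cfg) {σ : State} (hpar : Par C σ) {τ q : ℕ} (hq : q < C.d) {s : State}
    (hs : DigitsInv C σ τ q s) (h23 : s.reg 23 = C.d - q) {f : State → ℝ≥0∞} {v : ℝ≥0∞}
    (hf : ∀ s', DigitsInv C σ τ (q + 1) s' → s'.reg 23 = C.d - q → s'.time ≤ s.time + 50 →
      f s' ≤ v) :
    TriL C.E (block [
      asg 24 (.var 21 % .var 12),
      sto (.var 7 + (.var 3 - .var 23)) (.var 24),
      asg 21 (.var 21 / .var 12),
      cond 24 (asg 22 ((.var 22 * .op .shl (.const 1) ((.var 24 - .const 1) / .const (2 ^ C.ρ))) %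
          .var 2))
        (asg 22 ((.var 22 * (.var 2 - .var 15 % .var 2)) % .var 2))]) s f v := by
  have hP : Par C s := hpar.same hs.same (by decide)
  have e2 := hP.p
  have e3 := hP.d
  have e7 := hP.G
  have e12 := hP.K
  have e15 := hP.C0
  have h1B : 1 < C.B := C.hE.two_le
  have hpB := C.p_lt_B
  have hdG := C.d_le_G
  have hRB : 2 ^ C.ρ < C.B := C.R_lt_B
  have hw0 := hs.wf
  have hKB : C.K < C.B := by have := hw0.1 12; rwa [e12] at this
  set j := C.dig τ q with hj
  have hjK : j < C.K := C.digit_lt _ _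
  refine TriL.asg_seq C.hE hw0 j (by simp) (by simp [hs.idx, e12, hj, Cfg.dig]) ?_
  have hw1 := hw0.set 24 4 (show j < C.B by omega)
  refine TriL.sto_seq C.hE hw1 (C.G + q) j (by simp [e3, h23]) (by simp)
    (by simp [e3, e7, h23]; omega) (by simp) ?_
  have hw2 := hw1.put (C.G + q) 7 (show j < C.B by omega)
  have hdiv : τ / C.K ^ q / C.K = τ / C.K ^ (q + 1) := by rw [Nat.div_div_eq_div_mul, pow_succ]
  refine TriL.asg_seq C.hE hw2 (τ / C.K ^ (q + 1)) (by simp) (by simp [hs.idx, e12, hdiv]) ?_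
  have hlt : τ / C.K ^ (q + 1) < C.B := by
    rw [← hdiv, ← hs.idx]
    exact (Nat.div_le_self _ _).trans_lt (hw0.1 21)
  have hw3 := hw2.set 21 4 hlt
  set s3 := ((s.set 24 j 4).put (C.G + q) j 7).set 21 (τ / C.K ^ (q + 1)) 4 with hs3
  have hmem3 : ∀ a, s3.mem a = if a = C.G + q then j else s.mem a := by
    intro a
    simp [hs3, Function.update_apply]
  have key : ∀ y k, k ≤ 30 → y < C.p → (y : ZMod C.p) = s.reg 22 * C.cf j →
      f (s3.tick.set 22 y k) ≤ v := by
    intro y k hk hy hyc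
    refine hf _ ⟨hw3.tick.set 22 k (by omega), ?_, by simp [hs3], by simpa using hy, ?_, ?_, ?_⟩
      (by simp [hs3, h23]) (by simp [hs3]; omega)
    · refine Same.set (Same.tick (Same.set (Same.put (Same.set hs.same (by decide) _ _) _ _ _)
        (by decide) _ _)) (by decide) _ _
    · rw [Finset.prod_range_succ, ← hs.coef, ← hyc]
      simp
    · intro m hm
      simp only [State.set_mem, State.tick_mem, hmem3]
      rcases Nat.lt_succ_iff_lt_or_eq.1 hm with h | rfl
      · rw [if_neg (by omega)]
        exact hs.digit m h
      · rw [if_pos rfl]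
    · intro a ha
      simp only [State.set_mem, State.tick_mem, hmem3]
      rw [if_neg (by omega)]
      exact hs.mem a ha
  have hC0 := Nat.mod_lt C.C0 C.p_pos
  refine TriL.cond_of (fun h0 => ?_) fun h0 => ?_
  · have hj0 : 1 ≤ j := by
      simp at h0
      omega
    have hpw : 2 ^ ((j - 1) / 2 ^ C.ρ) < C.B := C.pow_digit_lt hjK
    refine TriL.asg_of C.hE hw3.tick (by simp [hs3, h1B, hRB, hj0, hpw]) (Nat.le_of_ble_eq_true rfl)
      (z := s.reg 22 * 2 ^ ((j - 1) / C.R) % C.p) (by simp [hs3, e2, Cfg.R]) rfl ?_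
    refine key _ _ (Nat.le_of_ble_eq_true rfl) (Nat.mod_lt _ C.p_pos) ?_
    rw [ZMod.natCast_mod, Cfg.cf, if_neg (by omega)]
    push_cast
    ring
  · have hj0 : j = 0 := by
      simpa [hs3] using h0
    refine TriL.asg_of C.hE hw3.tick (by simp [hs3, e2, e15, hC0.le]) (Nat.le_of_ble_eq_true rfl)
      (z := s.reg 22 * (C.p - C.C0 % C.p) % C.p) (by simp [hs3, e2, e15]) rfl ?_
    refine key _ _ (Nat.le_of_ble_eq_true rfl) (Nat.mod_lt _ C.p_pos) ?_
    rw [ZMod.natCast_mod, Nat.cast_mul, C.cast_neg_C0, hj0]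

theorem digitsLoop_spec (C : Cfg) {σ : State} (hpar : Par C σ) (hwf : WF C.B σ)
    (h22 : σ.reg 22 = 1) (h23 : σ.reg 23 = C.d) {f : State → ℝ≥0∞} {v : ℝ≥0∞}
    (hf : ∀ s', DigitsInv C σ (σ.reg 21) C.d s' → s'.time ≤ σ.time + (55 * C.d + 1) → f s' ≤ v) :
    TriL C.E (digitsLoop C.ρ) σ f v := by
  have hdG := C.d_le_G
  have h4G := C.four_G_lt
  have hp := C.p_gt
  refine TriL.down_of (u := 23) (fun k s => s.reg 23 = k ∧ k ≤ C.d ∧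
      DigitsInv C σ (σ.reg 21) (C.d - k) s ∧ s.time + 55 * k ≤ σ.time + 55 * C.d)
    (fun _ _ => v) ?_ ?_ ?_ C.d σ ?_
  · exact fun k s h => ⟨h.1, C.lt_word (by omega)⟩
  · rintro k s ⟨h1, h2, h3, h4⟩
    refine digits_body C hpar (q := C.d - (k + 1)) (by omega)
      ⟨h3.wf.tick, h3.same.tick, h3.idx, h3.coef_lt, h3.coef, h3.digit, h3.mem⟩ (by simp; omega)
      fun s' h5 h6 h7 => ?_
    rw [show C.d - (k + 1) + 1 = C.d - k by omega] at h5
    simp only [State.tick_time] at h7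
    refine guard_le ⟨by omega, by simp, by omega, ⟨h5.wf.set 23 4 (by omega),
      h5.same.set (by decide) _ _, by simpa using h5.idx, by simpa using h5.coef_lt,
      by simpa using h5.coef, h5.digit, h5.mem⟩, ?_⟩ le_rfl
    simp only [State.set_time]
    omega
  · rintro s ⟨h1, h2, h3, h4⟩
    rw [Nat.sub_zero] at h3
    exact hf _ ⟨h3.wf.tick, h3.same.tick, h3.idx, h3.coef_lt, h3.coef, h3.digit, h3.mem⟩
      (by simp; omega)
  · refine ⟨h23, le_rfl, ?_, le_rfl⟩
    rw [Nat.sub_self]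
    refine ⟨hwf, Same.refl _ _, by simp, by omega, by simp [h22], by simp, fun _ _ => rfl⟩

/-- The query is copied to the start of the memory. -/
theorem queryLoop_spec (C : Cfg) {σ : State} (hpar : Par C σ) (hwf : WF C.B σ) {τ : ℕ}
    (hd : ∀ m < C.d, σ.mem (C.G + m) = C.dig τ m) (h23 : σ.reg 23 = C.n)
    {f : State → ℝ≥0∞} {v : ℝ≥0∞}
    (hf : ∀ s', WF C.B s' → Same [23] σ s' → (∀ a < C.n, s'.mem a = σ.mem (C.addr τ a)) →
      (∀ a, C.n ≤ a → s'.mem a = σ.mem a) → s'.time ≤ σ.time + (30 * C.n + 1) → f s' ≤ v) :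
    TriL C.E queryLoop σ f v := by
  have h4G := C.four_G_lt
  have hn := C.n_lt_Z
  have hZ := C.Z_le_G
  refine TriL.down_of (u := 23) (fun k s => s.reg 23 = k ∧ k ≤ C.n ∧ WF C.B s ∧ Same [23] σ s ∧
      (∀ a, k ≤ a → a < C.n → s.mem a = σ.mem (C.addr τ a)) ∧
      (∀ a, C.n ≤ a → s.mem a = σ.mem a) ∧ s.time + 30 * k ≤ σ.time + 30 * C.n)
    (fun _ _ => v) ?_ ?_ ?_ C.n σ ?_
  · exact fun k s h => ⟨h.1, C.lt_word (by omega)⟩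
  · rintro k s ⟨h1, h2, h3, h4, h5, h6, h7⟩
    have hP : Par C s := hpar.same h4 (by decide)
    have e7 := hP.G
    have e12 := hP.K
    have hpart := C.table_part k (by omega)
    have hval : s.mem (C.G + C.E.table (k + 3)) = C.dig τ (C.E.table (k + 3)) := by
      rw [h6 _ (by omega), hd _ hpart]
    refine TriL.sto_of C.hE h3.tick (b := k) (z := σ.mem (C.addr τ k)) (by simp [h1]; omega)
      (by simp [h1]; omega) (Nat.le_of_ble_eq_true rfl) (Nat.le_of_ble_eq_true rfl) ?_ (by simp [h1])
      rfl (guard_le ⟨by simp [h1], by simp, by omega, ?_, ?_, ?_, ?_, ?_⟩ le_rfl)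
    · have e : ∀ q, k + 1 + 2 = q → q = k + 3 := by omega
      simp only [Expr.val_load, Expr.val_add, Expr.val_mul, Expr.val_const, Expr.val_var,
        Expr.val_table, Expr.val_sub, State.tick_reg, State.tick_mem, h1, e7, e12,
        Nat.add_sub_cancel, show k + 1 + 2 = k + 3 from rfl, hval]
      rw [h6 _ (by omega)]
      rfl
    · exact (h3.tick.put _ _ (hwf.2 _)).set 23 4 (by omega)
    · exact (h4.tick.put _ _ _).set (by decide) _ _
    · intro a ha1 ha2
      simp only [State.set_mem, State.put_mem, State.tick_mem, Function.update_apply]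
      split_ifs with h
      · rw [h]
      · exact h5 a (by omega) ha2
    · intro a ha
      simp only [State.set_mem, State.put_mem, State.tick_mem, Function.update_apply]
      rw [if_neg (by omega)]
      exact h6 a ha
    · simp only [State.set_time, State.put_time, State.tick_time]
      show s.time + 1 + 22 + 4 + 30 * k ≤ _
      omega
  · rintro s ⟨h1, h2, h3, h4, h5, h6, h7⟩
    exact hf _ h3.tick h4.tick (fun a => h5 a (Nat.zero_le a)) h6 (by simp; omega)
  · exact ⟨h23, le_rfl, hwf, Same.refl _ _, fun a h h' => by omega, fun _ _ => rfl, le_rfl⟩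

/-- The subroutine, with its answers `out`, its running time `T` and bounds `err` for its error
probabilities, a polynomial that computes the answers, and the input `I` of the whole algorithm. -/
structure Call (C : Cfg) where
  code : Prog
  bound_le : code.bound ≤ C.m
  one_le_m : 1 ≤ C.m
  EA : (Fin C.n → Bool) → Env
  w_eq : ∀ x, (EA x).w = C.wc * C.ν
  table_eq : ∀ x, (EA x).table = C.E.table
  input_eq : ∀ x a, (EA x).input a = if h : a < C.n then (x ⟨a, h⟩).toNat else 0
  out : (Fin C.n → Bool) → ℕ
  out_lt : ∀ x, out x < C.p
  T : ℕ
  err : (Fin C.n → Bool) → ℝ≥0∞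
  tri : ∀ x, Tri (EA x) code State.start (penalty T (out x)) (err x)
  part : Fin C.n → Fin C.d
  part_eq : ∀ i : Fin C.n, C.E.table (i + 3) = part i
  f : MvPolynomial (Fin C.n) (ZMod C.p)
  stronglyPartite : StronglyPartite part f
  eval_eq : ∀ x, MvPolynomial.eval (fun i => if x i then 1 else 0) f = (out x : ZMod C.p)
  I : Fin C.n → Bool
  hI : ∀ i : Fin C.n, C.E.input i = (I i).toNat

namespace Call

variable {C : Cfg} (A : Call C)

/-- The coefficient of the query with index `τ`. -/
def coef (_ : Call C) (τ : ℕ) : ZMod C.p := ∏ m ∈ Finset.range C.d, C.cf (C.dig τ m)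

/-- The answers to the queries, with their coefficients, surely add up to the answer for the input of
the whole algorithm. -/
theorem sum_coef_mul_out {k : ℕ} (hk : k = C.n) {σ s : State} (hs : C.RowsInv k σ s) :
    ∑ τ ∈ Finset.range C.KD, A.coef τ * (A.out (C.qry s.mem τ) : ZMod C.p) = A.out A.I := by
  subst hk
  have h := A.stronglyPartite.eval_sum (K := C.K) (c := fun j => C.cf j)
    (by rw [Fin.sum_univ_eq_sum_range]; exact C.sum_cf)
    (fun i j => (s.mem (2 * C.G + i * C.K + j) : ZMod C.p))
  have h1 : (fun i : Fin C.n => ∑ j : Fin C.K, C.cf j * (s.mem (2 * C.G + i * C.K + j) : ZMod C.p))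
      = fun i => if A.I i then 1 else 0 := by
    funext i
    rw [Fin.sum_univ_eq_sum_range (fun j => C.cf j * (s.mem (2 * C.G + i * C.K + j) : ZMod C.p)),
      hs.sum i i.2, A.hI]
    cases A.I i <;> simp
  rw [h1, A.eval_eq] at h
  rw [h, ← Fin.sum_univ_eq_sum_range (fun τ => A.coef τ * (A.out (C.qry s.mem τ) : ZMod C.p))]
  refine (Fintype.sum_equiv finFunctionFinEquiv _ _ fun τ => ?_).symm
  obtain ⟨τ, rfl⟩ := finFunctionFinEquiv.symm.surjective τ
  rw [Equiv.apply_symm_apply]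
  have hdig : ∀ m : Fin C.d, ((finFunctionFinEquiv.symm τ) m : ℕ) = C.dig τ m := fun m => rfl
  congr 1
  · rw [coef, ← Fin.prod_univ_eq_prod_range (fun m => C.cf (C.dig τ m))]
    simp only [hdig]
  · rw [← A.eval_eq]
    congr 2
    funext i
    have hb := hs.bit i i.2 (C.dig τ (A.part i)) (C.digit_lt _ _)
    have ha : C.addr τ i = 2 * C.G + i * C.K + C.dig τ (A.part i) := by
      rw [Cfg.addr, A.part_eq]
      rfl
    rw [hdig, Cfg.qry, ha]
    rcases Nat.le_one_iff_eq_zero_or_eq_one.1 hb with h | h <;> simp [h]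

end Call

/-- The states agree on the variables of the main program outside the list. -/
def Keep (L : List ℕ) (s s' : State) : Prop := ∀ v < 30, v ∉ L → s'.reg v = s.reg v

theorem Same.keep {L : List ℕ} {s s' : State} (h : Same L s s') : Keep L s s' :=
  fun v _ hv => h v hv

theorem Par.keep {C : Cfg} {L : List ℕ} {s s' : State} (h : Par C s) (hs : Keep L s s')
    (hL : ∀ v ∈ L, v = 0 ∨ 16 ≤ v) : Par C s' := by
  have key : ∀ v, 1 ≤ v → v < 16 → s'.reg v = s.reg v := fun v h1 h2 =>
    hs v (by omega) fun hv => by have := hL v hv; omega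
  constructor <;> rw [key _ (by norm_num) (by norm_num)]
  exacts [h.n, h.p, h.d, h.ν, h.Z, h.H, h.G, h.Q, h.y, h.M, h.l, h.K, h.KD, h.TT, h.C0]

/-- The subroutine finds zeros behind its input and in its memory. -/
structure Clean (C : Cfg) (s : State) : Prop where
  behind : ∀ a, C.n ≤ a → a < C.G → s.mem a = 0
  fresh : ∀ a, s.reg 16 ≤ a → s.mem a = 0
  le : 3 * C.G ≤ s.reg 16

/-- Time for one query. -/
def Call.queryTime {C : Cfg} (A : Call C) : ℕ := 55 * C.d + 30 * C.n + 2 * C.m + 12 * A.T + 30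

/-- What is certain after a query. -/
structure QueryPost {C : Cfg} (A : Call C) (s s' : State) : Prop where
  wf : WF C.B s'
  keep : Keep [16, 19, 21, 22, 23, 24] s s'
  next : s'.reg 16 = s.reg 16 + C.H
  clean : Clean C s'
  acc_lt : s'.reg 19 < C.p
  mem : ∀ a, 2 * C.G ≤ a → a < 3 * C.G → s'.mem a = s.mem a
  time : s'.time ≤ s.time + A.queryTime

theorem Cfg.H_le_G (C : Cfg) : C.H ≤ C.G := by
  rw [C.G_eq]
  exact Nat.le_mul_of_pos_right _ (pow_pos C.Z_pos 4)

open Classical in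
/-- A query adds the right term to the accumulator, except with probability at most `A.err`. -/
theorem query_spec {C : Cfg} (A : Call C) {s : State} {τ : ℕ} (hpar : Par C s) (hwf : WF C.B s)
    (h20 : s.reg 20 = τ + 1) (hclean : Clean C s) (h16 : s.reg 16 + C.H ≤ 4 * C.G)
    (hbit : ∀ i < C.n, s.mem (C.addr τ i) ≤ 1)
    {f : State → ℝ≥0∞} {c : ℝ≥0∞}
    (hf : ∀ s', QueryPost A s s' → f s' ≤ c + if (s'.reg 19 : ZMod C.p) =
      s.reg 19 + A.coef τ * A.out (C.qry s.mem τ) then 0 else 1) :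
    TriL C.E (query C.ρ C.m A.code) s f (c + A.err (C.qry s.mem τ)) := by
  have h4G := C.four_G_lt
  have hn := C.n_lt_Z
  have hZ := C.Z_le_G
  have hdG := C.d_le_G
  have hpB := C.p_lt_B
  have hτ : τ < C.B := by have := hwf.1 20; omega
  have hcl := hclean.le
  refine TriL.asg_seq C.hE hwf τ (by simp [h20]; omega) (by simp [h20]) ?_
  have hw1 := hwf.set 21 4 hτ
  refine TriL.asg_seq C.hE hw1 1 (by simp; omega) (by simp) ?_
  have hw2 := hw1.set 22 2 (show 1 < C.B by omega)
  refine TriL.asg_seq C.hE hw2 C.d (by simp) (by simp [hpar.d]) ?_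
  have hw3 := hw2.set 23 2 (show C.d < C.B by omega)
  set s3 := ((s.set 21 τ 4).set 22 1 2).set 23 C.d 2 with hs3
  have hk3 : Same [16, 19, 21, 22, 23, 24] s s3 :=
    (((Same.refl _ s).set (by decide) _ _).set (by decide) _ _).set (by decide) _ _
  have hP3 : Par C s3 := hpar.same hk3 (by decide)
  refine TriL.seq (g := fun s' => guard (DigitsInv C s3 τ C.d s' ∧
    s'.time ≤ s.time + (55 * C.d + 9)) (c + A.err (C.qry s.mem τ))) ?_ fun s4 => TriL.of_guard ?_
  · refine digitsLoop_spec C hP3 hw3 (by simp [hs3]) (by simp [hs3]) fun s' h1 h2 => ?_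
    have e : s3.reg 21 = τ := by simp [hs3]
    rw [e] at h1
    refine guard_le ⟨h1, ?_⟩ le_rfl
    simp [hs3] at h2
    omega
  rintro ⟨hs4, ht4⟩
  have hk4 : Same [16, 19, 21, 22, 23, 24] s s4 := hk3.trans (hs4.same.mono (by decide))
  have hP4 : Par C s4 := hpar.same hk4 (by decide)
  refine TriL.asg_seq C.hE hs4.wf C.n (by simp) (by simp [hP4.n]) ?_
  have hw5 := hs4.wf.set 23 2 (show C.n < C.B by omega)
  set s5 := s4.set 23 C.n 2 with hs5
  have hk5 : Same [16, 19, 21, 22, 23, 24] s s5 := hk4.set (by decide) _ _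
  have hP5 : Par C s5 := hpar.same hk5 (by decide)
  have hm5 : ∀ a, a < C.G ∨ 2 * C.G ≤ a → s5.mem a = s.mem a := fun a ha => hs4.mem a ha
  refine TriL.seq (g := fun s' => guard (WF C.B s' ∧ Same [23] s5 s' ∧
    (∀ a < C.n, s'.mem a = s5.mem (C.addr τ a)) ∧ (∀ a, C.n ≤ a → s'.mem a = s5.mem a) ∧
    s'.time ≤ s5.time + (30 * C.n + 1)) (c + A.err (C.qry s.mem τ))) ?_ fun s6 => TriL.of_guard ?_
  · exact queryLoop_spec C hP5 hw5 (τ := τ) hs4.digit (by simp [hs5])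
      fun s' h1 h2 h3 h4 h5 => guard_le ⟨h1, h2, h3, h4, h5⟩ le_rfl
  rintro ⟨hw6, hk56, hm6, hm6', ht6⟩
  have hk6 : Same [16, 19, 21, 22, 23, 24] s s6 := hk5.trans (hk56.mono (by decide))
  have e22 : s6.reg 22 = s4.reg 22 := by rw [hk56 22 (by decide)]; simp [hs5]
  -- after clearing the registers of the subroutine
  let s7 : State := ⟨fun v => if 30 ≤ v ∧ v < 30 + C.m then 0 else s6.reg v, s6.mem,
    s6.time + (2 * C.m + 1)⟩
  refine TriL.seq_eq (σ' := s7) ((TriL.clear_of 30 C.m).mono (fun _ => le_rfl)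
    (guard_le rfl le_rfl)) ?_
  have hw7 : WF C.B s7 := by
    refine ⟨fun v => ?_, hw6.2⟩
    show (if _ then _ else _) < _
    split_ifs
    · omega
    · exact hw6.1 v
  have hr7 : ∀ v < 30, s7.reg v = s6.reg v := fun v hv => if_neg (by omega)
  have hk7 : Keep [16, 19, 21, 22, 23, 24] s s7 := fun v hv hvL =>
    (hr7 v hv).trans (hk6 v hvL)
  have hP7 : Par C s7 := hpar.keep hk7 (by decide)
  have e16 : s7.reg 16 = s.reg 16 := by
    rw [hr7 16 (by norm_num), hk56 16 (by decide)]
    simp only [hs5, State.set_reg]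
    rw [Function.update_of_ne (by norm_num), hs4.same 16 (by decide)]
    simp [hs3]
  have e19 : s7.reg 19 = s.reg 19 := by
    rw [hr7 19 (by norm_num), hk56 19 (by decide)]
    simp only [hs5, State.set_reg]
    rw [Function.update_of_ne (by norm_num), hs4.same 19 (by decide)]
    simp [hs3]
  have e22' : s7.reg 22 = s4.reg 22 := by rw [hr7 22 (by norm_num), e22]
  set x := C.qry s.mem τ with hx
  have hw : 2 ^ (A.EA x).w = C.H := by rw [A.w_eq]; rfl
  have hm7 : ∀ a, C.n ≤ a → (a < C.G ∨ 2 * C.G ≤ a) → s7.mem a = s.mem a := fun a h1 h2 =>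
    (hm6' a h1).trans (hm5 a h2)
  have haddr : ∀ i < C.n, 2 * C.G ≤ C.addr τ i := fun i hi => by unfold Cfg.addr; omega
  -- the word length of the subroutine is that of its own environment: its memory of `H` cells fits
  -- into the fresh block, and the cells behind the query read as the zeros behind its input
  have hS : SimOK (A.EA x) C.E 30 6 16 s7 := by
    refine ⟨?_, (A.table_eq x).symm, by norm_num, by norm_num, by rw [hw]; exact hP7.H,
      ?_, ?_, ?_⟩
    · have := C.lt_word (show C.H < C.B by omega)
      rw [← hw] at this
      exact (Nat.pow_lt_pow_iff_right (by norm_num)).1 this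
    · rw [hw, e16]
      exact h16.trans (C.lt_word h4G).le
    · rw [hw, e16]
      omega
    · intro a ha
      rw [hw] at ha
      refine ⟨C.lt_word (hw7.2 a), ?_⟩
      rw [A.input_eq]
      split_ifs with h
      · have h1 : s7.mem a = s.mem (C.addr τ a) := (hm6 a h).trans (hm5 _ (Or.inr (haddr a h)))
        have h2 : s.mem (C.addr τ a) ≤ 1 := hbit a h
        rw [h1, hx, Cfg.qry]
        rcases Nat.le_one_iff_eq_zero_or_eq_one.1 h2 with h | h <;> simp [h]
      · rw [hm7 a (by omega) (Or.inl (by omega)), hclean.behind a (by omega) (by omega)]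
  have ht7 : s7.time ≤ s.time + (55 * C.d + 30 * C.n + 2 * C.m + 13) := by
    show s6.time + (2 * C.m + 1) ≤ _
    simp only [hs5, State.set_time] at ht6
    omega
  refine TriL.seq (g := fun s' => guard (∃ sA, SimRel (A.EA x) 30 16 C.m s7 sA s' ∧ sA.time ≤ A.T)
    (c + if s'.reg 30 = A.out x then 0 else 1)) ?_ fun s8 => TriL.of_guard ?_
  · have hA := (A.tri x).affine c (b := 1) one_ne_zero
    rw [one_mul] at hA
    refine TriL.sim_of hS A.bound_le ?_ ?_ hA ?_
    · intro r hr
      show (if _ then _ else _) = _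
      rw [if_pos (by omega)]
    · intro a ha
      rw [hw] at ha
      rw [e16, hm7 _ (by omega) (Or.inr (by omega)), hclean.fresh _ (by omega)]
    · intro sA s' hr
      have h0 : s'.reg 30 = sA.reg 0 := hr.reg 0 A.one_le_m
      rw [h0, one_mul, penalty]
      split_ifs with h1 <;> first | (refine guard_le ⟨sA, hr, by assumption⟩ ?_; simp_all) | simp
  rintro ⟨sA, hr, hsA⟩
  have hr_lt : ∀ r, sA.reg r < C.B := fun r => by have := hr.reg_lt r; rw [hw] at this; omega
  have hr_mem : ∀ r, sA.mem r < C.B := fun r => by have := hr.mem_lt r; rw [hw] at this; omega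
  have hw8 : WF C.B s8 := by
    refine ⟨fun v => ?_, fun a => ?_⟩
    · by_cases hv : v < 30 ∨ 30 + C.m ≤ v
      · rw [hr.reg_eq v hv]; exact hw7.1 v
      · have := hr.reg (v - 30) (by omega)
        rw [show 30 + (v - 30) = v by omega] at this
        rw [this]
        exact hr_lt _
    · by_cases ha : a < s7.reg 16 ∨ s7.reg 16 + 2 ^ (A.EA x).w ≤ a
      · rw [hr.mem_eq a ha]; exact hw7.2 a
      · have := hr.mem (a - s7.reg 16) (by omega)
        rw [show s7.reg 16 + (a - s7.reg 16) = a by omega] at this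
        rw [this]
        exact hr_mem _
  have hk78 : ∀ v < 30, s8.reg v = s7.reg v := fun v hv => hr.reg_eq v (Or.inl hv)
  have hk8 : Keep [16, 19, 21, 22, 23, 24] s s8 := fun v hv hvL =>
    (hk78 v hv).trans (hk7 v hv hvL)
  have hP8 : Par C s8 := hpar.keep hk8 (by decide)
  set y := (s.reg 19 + s4.reg 22 * s8.reg 30) % C.p with hy
  have hyp : y < C.p := Nat.mod_lt _ C.p_pos
  refine TriL.asg_seq C.hE hw8 y (by simp) (by simp [hP8.p, hk78, e19, e22', hy]) ?_
  have hw9 := hw8.set 19 8 (show y < C.B by omega)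
  refine TriL.asg_of C.hE hw9 (by simp) (Nat.le_of_ble_eq_true rfl) (z := s.reg 16 + C.H)
    (by simp [hP8.H, hk78, e16]) rfl ?_
  have hw10 := hw9.set 16 4 (show s.reg 16 + C.H < C.B by omega)
  refine (hf _ ⟨hw10, ?_, by simp, ?_, by simpa using hyp, ?_, ?_⟩).trans ?_
  · intro v hv hvL
    have h1 : v ≠ 16 := fun h => hvL (by simp [h])
    have h2 : v ≠ 19 := fun h => hvL (by simp [h])
    simp only [State.set_reg, Function.update_of_ne h1, Function.update_of_ne h2]
    exact hk8 v hv hvL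
  · refine ⟨fun a h1 h2 => ?_, fun a ha => ?_, by simp; omega⟩
    · simp only [State.set_mem]
      rw [hr.mem_eq a (Or.inl (by omega)), hm7 a h1 (Or.inl h2)]
      exact hclean.behind a h1 h2
    · simp only [State.set_reg, Function.update_self] at ha
      simp only [State.set_mem]
      rw [hr.mem_eq a (Or.inr (by omega)), hm7 a (by omega) (Or.inr (by omega))]
      exact hclean.fresh a (by omega)
  · intro a h1 h2
    simp only [State.set_mem]
    rw [hr.mem_eq a (Or.inl (by omega)), hm7 a (by omega) (Or.inr h1)]
  · have := hr.time
    simp only [State.set_time]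
    show s8.time + 8 + 4 ≤ s.time + A.queryTime
    unfold Call.queryTime
    omega
  · gcongr
    split_ifs with h1 h2
    · exact le_rfl
    · exact zero_le
    · rename_i h
      refine absurd ?_ h1
      simp only [State.set_reg]
      rw [Function.update_of_ne (by norm_num), Function.update_self, hy, ZMod.natCast_mod, h,
        Nat.cast_add, Nat.cast_mul, hs4.coef]
      rfl
    · exact le_rfl

/-! ### Repetitions and the majority vote -/

/-- Time for all queries of a repetition. -/
def Call.queriesTime {C : Cfg} (A : Call C) : ℕ := (A.queryTime + 5) * C.KD + 5

/-- What is certain after the queries of a repetition. -/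
structure QueriesPost {C : Cfg} (A : Call C) (s s' : State) : Prop where
  wf : WF C.B s'
  keep : Keep [16, 19, 20, 21, 22, 23, 24] s s'
  next : s'.reg 16 = s.reg 16 + C.H * C.KD
  clean : Clean C s'
  acc_lt : s'.reg 19 < C.p
  time : s'.time ≤ s.time + A.queriesTime

theorem Cfg.KD_le_Z (C : Cfg) : C.KD ≤ C.Z := C.KD_le

open Classical in
/-- The accumulator is right unless one of the queries is answered wrongly. -/
theorem queries_spec {C : Cfg} (A : Call C) {σ₀ σ : State} (hpar : Par C σ)
    (hrows : C.RowsInv C.n σ₀ σ) (hclean : Clean C σ) (h16 : σ.reg 16 + C.H * C.KD ≤ 4 * C.G)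
    {f : State → ℝ≥0∞} (hf : ∀ s', QueriesPost A σ s' → f s' ≤ if s'.reg 19 = A.out A.I then 0 else 1) :
    TriL C.E (queries C.ρ C.m A.code) σ f
      (∑ τ ∈ Finset.range C.KD, A.err (C.qry σ.mem τ)) := by
  have h4G := C.four_G_lt
  have hZ := C.Z_le_G
  have hKZ := C.KD_le_Z
  have hnK := C.n_mul_K_le
  have hwf := hrows.wf
  have hp := C.p_gt
  refine TriL.asg_seq C.hE hwf 0 (by simp; omega) (by simp) ?_
  have hw1 := hwf.set 19 2 (show 0 < C.B by omega)
  refine TriL.asg_seq C.hE hw1 C.KD (by simp) (by simp [hpar.KD]) ?_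
  have hw2 := hw1.set 20 2 (show C.KD < C.B by omega)
  set s2 := (σ.set 19 0 2).set 20 C.KD 2 with hs2
  have haddr : ∀ τ, ∀ i < C.n, 2 * C.G ≤ C.addr τ i ∧ C.addr τ i < 3 * C.G := by
    intro τ i hi
    have h1 := C.digit_lt τ (C.E.table (i + 3))
    have h2 : i * C.K + C.K ≤ C.n * C.K := by
      calc i * C.K + C.K = (i + 1) * C.K := by ring
        _ ≤ _ := Nat.mul_le_mul_right _ hi
    unfold Cfg.addr
    omega
  refine (TriL.down_of (u := 20) (fun k s => s.reg 20 = k ∧ k ≤ C.KD ∧ WF C.B s ∧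
      Keep [16, 19, 20, 21, 22, 23, 24] σ s ∧ Clean C s ∧
      s.reg 16 + C.H * k = σ.reg 16 + C.H * C.KD ∧ s.reg 19 < C.p ∧
      (∀ a, 2 * C.G ≤ a → a < 3 * C.G → s.mem a = σ.mem a) ∧
      s.time + (A.queryTime + 5) * k ≤ σ.time + (A.queryTime + 5) * C.KD + 4)
    (fun k s => (if (s.reg 19 : ZMod C.p) = ∑ τ ∈ Finset.Ico k C.KD,
        A.coef τ * A.out (C.qry σ.mem τ) then 0 else 1) +
      ∑ τ ∈ Finset.range k, A.err (C.qry σ.mem τ)) ?_ ?_ ?_ C.KD s2 ?_).mono (fun _ => le_rfl) ?_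
  · exact fun k s h => ⟨h.1, C.lt_word (by omega)⟩
  · rintro k s ⟨h1, h2, h3, h4, h5, h6, h7, h8, h9⟩
    have hqry : ∀ τ, C.qry s.mem τ = C.qry σ.mem τ := by
      intro τ
      funext i
      rw [Cfg.qry, Cfg.qry, h8 _ (haddr τ i i.2).1 (haddr τ i i.2).2]
    have e6 : C.H * (k + 1) = C.H * k + C.H := by ring
    set a : ℝ≥0∞ := if (s.reg 19 : ZMod C.p) = ∑ τ ∈ Finset.Ico (k + 1) C.KD,
        A.coef τ * A.out (C.qry σ.mem τ) then 0 else 1 with ha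
    rw [Finset.sum_range_succ, ← add_assoc]
    have h8' : ∀ i < C.n, s.tick.mem (C.addr k i) ≤ 1 := by
      intro i hi
      rw [State.tick_mem, h8 _ (haddr k i hi).1 (haddr k i hi).2]
      exact hrows.bit i hi _ (C.digit_lt _ _)
    refine TriL.mono (query_spec (s := s.tick) (τ := k) A
      (c := a + ∑ τ ∈ Finset.range k, A.err (C.qry σ.mem τ)) (hpar.keep h4 (by decide)) h3.tick h1
      ⟨h5.behind, h5.fresh, h5.le⟩ ?_ h8' fun s' hs' => ?_) (fun _ => le_rfl) ?_
    · simp only [State.tick_reg]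
      omega
    · have e20 : s'.reg 20 = k + 1 := (hs'.keep 20 (by norm_num) (by decide)).trans h1
      have hnext := hs'.next
      have htime := hs'.time
      simp only [State.tick_reg, State.tick_time] at hnext htime
      refine guard_le ⟨e20, by simp, by omega, hs'.wf.set 20 4 (by omega), ?_,
        ⟨hs'.clean.behind, by simpa using hs'.clean.fresh, by simpa using hs'.clean.le⟩, ?_,
        by simpa using hs'.acc_lt, ?_, ?_⟩ ?_
      · intro v hv hvL
        rw [State.set_reg, Function.update_of_ne (by rintro rfl; simp at hvL),
          hs'.keep v hv (by simp at hvL ⊢; tauto)]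
        exact h4 v hv hvL
      · simp
        omega
      · intro a h1 h2
        rw [State.set_mem, hs'.mem a h1 h2]
        exact h8 a h1 h2
      · simp only [State.set_time]
        have e9 : (A.queryTime + 5) * (k + 1) = (A.queryTime + 5) * k + (A.queryTime + 5) := by ring
        omega
      · have e19 : (s'.set 20 k 4).reg 19 = s'.reg 19 := by simp
        simp only [e19, State.tick_reg, State.tick_mem, hqry]
        rw [add_right_comm]
        gcongr
        rw [Finset.sum_eq_sum_Ico_succ_bot (by omega : k < C.KD), ha]
        by_cases g1 : (s.reg 19 : ZMod C.p) = ∑ τ ∈ Finset.Ico (k + 1) C.KD,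
          A.coef τ * A.out (C.qry σ.mem τ)
        · by_cases g2 : (s'.reg 19 : ZMod C.p) = s.reg 19 + A.coef k * A.out (C.qry σ.mem k)
          · rw [if_pos (by rw [g2, g1]; ring)]
            exact bot_le
          · rw [if_neg g2]
            exact le_add_left (by split_ifs <;> simp)
        · rw [if_neg g1]
          exact le_add_right (by split_ifs <;> simp)
    · simp only [State.tick_mem, hqry]
      exact le_rfl
  · rintro s ⟨h1, h2, h3, h4, h5, h6, h7, h8, h9⟩
    refine (hf s.tick ⟨h3.tick, h4, by simpa using h6, ⟨h5.behind, h5.fresh, h5.le⟩, h7, ?_⟩).trans ?_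
    · simp only [State.tick_time]
      unfold Call.queriesTime
      omega
    · rw [← Finset.range_eq_Ico, A.sum_coef_mul_out rfl hrows]
      simp only [State.tick_reg, Finset.range_zero, Finset.sum_empty, add_zero]
      have : s.reg 19 = A.out A.I ↔ (s.reg 19 : ZMod C.p) = A.out A.I := by
        rw [ZMod.natCast_eq_natCast_iff, Nat.ModEq, Nat.mod_eq_of_lt h7,
          Nat.mod_eq_of_lt (A.out_lt _)]
      simp only [this]
      exact le_rfl
  · refine ⟨by simp [hs2], le_rfl, hw2, ?_, ⟨hclean.behind, ?_, ?_⟩, by simp [hs2],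
      by simp [hs2]; omega, fun _ _ _ => rfl, ?_⟩
    · exact (((Same.refl _ σ).set (by decide) _ _).set (by decide) _ _).keep
    · simpa [hs2] using hclean.fresh
    · simpa [hs2] using hclean.le
    · simp [hs2]
      omega
  · simp [hs2]

/-- The potential of the majority vote when the correct answer is `ans`: its expectation halves with
each repetition, and it is at least `1` when the candidate is wrong. -/
noncomputable def potential (ans : ℕ) (s : State) : ℝ≥0∞ :=
  if s.reg 0 = ans then 4⁻¹ ^ s.reg 18 else 4 ^ s.reg 18

theorem potential_eq {ans c l : ℕ} {s : State} (h0 : s.reg 0 = c) (h18 : s.reg 18 = l) :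
    potential ans s = if c = ans then 4⁻¹ ^ l else 4 ^ l := by
  rw [potential, h0, h18]

theorem potential_ne_zero (ans : ℕ) (s : State) : potential ans s ≠ 0 := by
  unfold potential
  split_ifs <;> simp

/-- What is certain after `vote`. -/
structure VotePost (C : Cfg) (s s' : State) : Prop where
  wf : WF C.B s'
  keep : Same [0, 18, 26] s s'
  cand_lt : s'.reg 0 < C.p
  lead : s'.reg 18 ≤ s.reg 18 + 1
  mem : s'.mem = s.mem
  time : s'.time ≤ s.time + 20

/-- A right vote divides the potential by `4` and a wrong one multiplies it by at most `4`; the term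
`4⁻¹ * potential` may be paid in both cases. -/
theorem vote_spec (C : Cfg) {ans : ℕ} (hans : ans < C.p) {s : State} (hpar : Par C s)
    (hwf : WF C.B s) (hc : s.reg 0 < C.p) (ha : s.reg 19 < C.p) (hl : s.reg 18 + 1 < C.B)
    {f : State → ℝ≥0∞} (hf : ∀ s', VotePost C s s' → f s' ≤ potential ans s') :
    TriL C.E vote s f (4⁻¹ * potential ans s +
      4 * potential ans s * if s.reg 19 = ans then 0 else 1) := by
  have hpB := C.p_lt_B
  have h4 : (4 : ℝ≥0∞)⁻¹ * 4 = 1 := ENNReal.inv_mul_cancel (by norm_num) (by norm_num)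
  have h4' : (4 : ℝ≥0∞) * 4⁻¹ = 1 := ENNReal.mul_inv_cancel (by norm_num) (by norm_num)
  refine TriL.cond_of (fun h0 => ?_) fun h0 => ?_
  -- the candidate and the vote are below `p`, so that they agree if and only if they agree modulo `p`
  · have e : (s.reg 19 + C.p - s.reg 0) % C.p = 0 ↔ s.reg 19 = s.reg 0 := by
      constructor
      · intro h
        rcases le_or_gt (s.reg 0) (s.reg 19) with h' | h'
        · rw [show s.reg 19 + C.p - s.reg 0 = (s.reg 19 - s.reg 0) + C.p by omega,
            Nat.add_mod_right, Nat.mod_eq_of_lt (by omega)] at h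
          omega
        · rw [Nat.mod_eq_of_lt (by omega)] at h
          omega
      · intro h
        rw [h]
        simp
    set d := (s.reg 19 + C.p - s.reg 0) % C.p with hd
    have hdp : d < C.p := Nat.mod_lt _ C.p_pos
    refine TriL.asg_seq C.hE hwf.tick d (by simp [hpar.p]; omega) (by simp [hpar.p, hd]) ?_
    have hw1 := hwf.tick.set 26 8 (show d < C.B by omega)
    obtain ⟨l, hl'⟩ : ∃ l, s.reg 18 = l + 1 := ⟨s.reg 18 - 1, by have : s.reg 18 ≠ 0 := h0; omega⟩
    refine TriL.cond_of (fun h1 => ?_) fun h1 => ?_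
    · have h1' : s.reg 19 ≠ s.reg 0 := by simpa [e] using h1
      refine TriL.asg_of C.hE hw1.tick (by simp [hl']; omega) (Nat.le_of_ble_eq_true rfl) (z := l)
        (by simp [hl']) rfl ?_
      refine (hf _ ⟨hw1.tick.set 18 4 (by omega), ?_, by simpa using hc, by simp; omega, rfl,
        by simp⟩).trans ?_
      · exact (((Same.refl _ s).tick.set (by decide) _ _).tick.set (by decide) _ _)
      · rw [potential_eq (c := s.reg 0) (l := l) (by simp) (by simp), potential_eq rfl hl']
        by_cases hca : s.reg 0 = ans
        · rw [if_pos hca, if_pos hca, if_neg (by rw [← hca]; exact h1'), pow_succ, mul_one]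
          calc (4 : ℝ≥0∞)⁻¹ ^ l = 4 * (4⁻¹ ^ l * 4⁻¹) := by rw [mul_comm (4⁻¹ ^ l), ← mul_assoc, h4', one_mul]
            _ ≤ _ := le_add_self
        · rw [if_neg hca, if_neg hca, pow_succ]
          calc (4 : ℝ≥0∞) ^ l = 4⁻¹ * (4 ^ l * 4) := by rw [mul_comm (4 ^ l), ← mul_assoc, h4, one_mul]
            _ ≤ _ := le_self_add
    · have h1' : s.reg 19 = s.reg 0 := by simpa [e] using h1
      refine TriL.asg_of C.hE hw1.tick (by simp; omega) (Nat.le_of_ble_eq_true rfl)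
        (z := s.reg 18 + 1) (by simp) rfl ?_
      refine (hf _ ⟨hw1.tick.set 18 4 hl, ?_, by simpa using hc, by simp, rfl,
        by simp⟩).trans ?_
      · exact (((Same.refl _ s).tick.set (by decide) _ _).tick.set (by decide) _ _)
      · rw [potential_eq (c := s.reg 0) (l := s.reg 18 + 1) (by simp) (by simp),
          potential_eq rfl rfl]
        by_cases hca : s.reg 0 = ans
        · rw [if_pos hca, if_pos hca, if_pos (h1'.trans hca), pow_succ, mul_comm]
          exact le_self_add
        · rw [if_neg hca, if_neg hca, if_neg (by rwa [h1']), pow_succ, mul_one, mul_comm (4 ^ _)]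
          exact le_add_self
  · have h0' : s.reg 18 = 0 := h0
    refine TriL.asg_seq C.hE hwf.tick (s.reg 19) (by simp) (by simp) ?_
    have hw1 := hwf.tick.set 0 2 (show s.reg 19 < C.B by omega)
    refine TriL.asg_of C.hE hw1 (by simp; omega) (Nat.le_of_ble_eq_true rfl) (z := 1)
      (by simp) rfl ?_
    refine (hf _ ⟨hw1.set 18 2 (by omega), ?_, by simpa using ha, by simp, rfl,
      by simp⟩).trans ?_
    · exact (((Same.refl _ s).tick.set (by decide) _ _).set (by decide) _ _)
    · have : potential ans s = 1 := by simp [potential, h0']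
      rw [this, potential_eq (c := s.reg 19) (l := 1) (by simp) (by simp)]
      split_ifs <;> simp

/-- Time for one repetition. -/
def Call.repTime {C : Cfg} (A : Call C) : ℕ := C.rowsTime + A.queriesTime + 20

/-- The invariant of the main loop, with `k` repetitions to go. -/
structure MainInv {C : Cfg} (A : Call C) (T k : ℕ) (s : State) : Prop where
  cnt : s.reg 17 = k
  le : k ≤ C.ν * C.ν
  wf : WF C.B s
  par : Par C s
  clean : Clean C s
  cv : s.reg 16 + C.H * C.KD * k ≤ 4 * C.G
  cand : s.reg 0 < C.p
  lead : s.reg 18 + k ≤ C.ν * C.ν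
  time : s.time + (A.repTime + 5) * k ≤ T

/-- A repetition errs with probability at most `16⁻¹`, so that it multiplies the potential by at most
`4⁻¹ + 4 * 16⁻¹ = 2⁻¹` in expectation. -/
theorem repetition_spec {C : Cfg} (A : Call C)
    (hε : C.KD * ∑ z, (∏ i, C.w (z i)) * A.err z ≤ 16⁻¹) {T k : ℕ} {s : State}
    (hs : MainInv A T (k + 1) s) :
    TriL C.E (repetition C.ρ C.m A.code) s.tick (fun s' => guard (s'.reg 17 = k + 1 ∧
      MainInv A T k (s'.set 17 k 4)) (potential (A.out A.I) s')) (2⁻¹ * potential (A.out A.I) s) := by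
  have h4G := C.four_G_lt
  have hnK := C.n_mul_K_le
  have hZ := C.Z_le_G
  have hνZ : C.ν * C.ν ≤ C.Z := C.ν_sq
  set Φ := potential (A.out A.I) s with hΦ
  have hΦ0 : 4 * Φ ≠ 0 := mul_ne_zero (by norm_num) (potential_ne_zero _ _)
  have hlead := hs.lead
  have hcv := hs.cv
  have e1 : C.H * C.KD * (k + 1) = C.H * C.KD * k + C.H * C.KD := by ring
  -- the bound of `vote_spec` is affine in the error indicator, so that the expectations over the rows
  -- and over the answers to the queries can be inserted one after the other
  have hrows := (rows_spec C (σ := s.tick) (f := fun s' => guard (C.RowsInv C.n s.tick s' ∧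
    s'.time ≤ s.tick.time + C.rowsTime) (∑ τ ∈ Finset.range C.KD, A.err (C.qry s'.mem τ))) A.err
    (hs.par.same (Same.refl [] s).tick (by decide)) hs.wf.tick fun s' h1 h2 => guard_le ⟨h1, h2⟩ le_rfl).affine (4⁻¹ * Φ) hΦ0
  refine TriL.mono (TriL.seq hrows (fun s' => ?_) (f := fun s' => guard (s'.reg 17 = k + 1 ∧
      MainInv A T k (s'.set 17 k 4)) (potential (A.out A.I) s'))) (fun _ => le_rfl) ?_
  swap
  · have h16 : (4 : ℝ≥0∞) * 16⁻¹ = 4⁻¹ := by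
      rw [show (16 : ℝ≥0∞) = 4 * 4 by norm_num, ENNReal.mul_inv (by norm_num) (by norm_num),
        ← mul_assoc, ENNReal.mul_inv_cancel (by norm_num) (by norm_num), one_mul]
    have h2 : (4 : ℝ≥0∞)⁻¹ + 4⁻¹ = 2⁻¹ := by
      rw [← two_mul, show (4 : ℝ≥0∞) = 2 * 2 by norm_num,
        ENNReal.mul_inv (by norm_num) (by norm_num), ← mul_assoc,
        ENNReal.mul_inv_cancel (by norm_num) (by norm_num), one_mul]
    calc 4⁻¹ * Φ + 4 * Φ * (C.KD * ∑ z, (∏ i, C.w (z i)) * A.err z)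
        ≤ 4⁻¹ * Φ + 4 * Φ * 16⁻¹ := by gcongr
      _ = (4⁻¹ + 4 * 16⁻¹) * Φ := by ring
      _ = 2⁻¹ * Φ := by rw [h16, h2]
  by_cases hg : C.RowsInv C.n s.tick s' ∧ s'.time ≤ s.tick.time + C.rowsTime
  swap
  · simp only [guard, if_neg hg]
    rw [ENNReal.mul_top hΦ0, add_top]
    exact TriL.top
  rw [guard_pos hg]
  obtain ⟨hr, ht⟩ := hg
  have hpar' : Par C s' := hs.par.same hr.same (by decide)
  have hreg : ∀ v, v ∉ [20, 21, 22, 23, 24, 25, 26, 27, 28] → s'.reg v = s.reg v := hr.same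
  have hclean' : Clean C s' := by
    refine ⟨fun a h1 h2 => ?_, fun a h => ?_, ?_⟩
    · rw [hr.mem a (Or.inl (by omega))]
      exact hs.clean.behind a h1 h2
    · rw [hreg 16 (by decide)] at h
      have := hs.clean.le
      rw [hr.mem a (Or.inr (by omega))]
      exact hs.clean.fresh a h
    · rw [hreg 16 (by decide)]
      exact hs.clean.le
  have hq := (queries_spec A (f := fun s'' => guard (QueriesPost A s' s'')
      (if s''.reg 19 = A.out A.I then 0 else 1)) hpar' hr hclean'
    (by rw [hreg 16 (by decide)]; omega) fun s'' h => guard_le h (by split_ifs <;> simp)).affine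
    (4⁻¹ * Φ) hΦ0
  refine TriL.seq hq fun s'' => ?_
  by_cases hg : QueriesPost A s' s''
  swap
  · simp only [guard, if_neg hg]
    rw [ENNReal.mul_top hΦ0, add_top]
    exact TriL.top
  rw [guard_pos hg]
  have hreg' : ∀ v < 30, v ∉ [16, 19, 20, 21, 22, 23, 24, 25, 26, 27, 28] →
      s''.reg v = s.reg v := fun v h1 h2 =>
    (hg.keep v h1 (by simp at h2 ⊢; tauto)).trans (hreg v (by simp at h2 ⊢; tauto))
  have hΦ' : potential (A.out A.I) s'' = Φ := by
    rw [hΦ, potential, potential, hreg' 0 (by norm_num) (by decide),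
      hreg' 18 (by norm_num) (by decide)]
  rw [← hΦ']
  have hpar'' : Par C s'' := hpar'.keep hg.keep (by decide)
  refine vote_spec C (A.out_lt _) hpar'' hg.wf
    (by rw [hreg' 0 (by norm_num) (by decide)]; exact hs.cand) hg.acc_lt
    (by rw [hreg' 18 (by norm_num) (by decide)]; omega) fun s3 h3 => ?_
  have e17 : s3.reg 17 = k + 1 := by
    rw [h3.keep 17 (by decide), hreg' 17 (by norm_num) (by decide)]
    exact hs.cnt
  have e16 : s3.reg 16 = s.reg 16 + C.H * C.KD := by
    rw [h3.keep 16 (by decide), hg.next, hreg 16 (by decide)]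
  have e16' : s3.reg 16 = s''.reg 16 := h3.keep 16 (by decide)
  have hl := h3.lead
  rw [hreg' 18 (by norm_num) (by decide)] at hl
  have hpar3 : Par C s3 := hpar''.same h3.keep (by decide)
  have hpar4 : Par C (s3.set 17 k 4) :=
    hpar3.same (L := [17]) ((Same.refl _ s3).set (by decide) _ _) (by decide)
  refine guard_le ⟨e17, by simp, by omega, h3.wf.set 17 4 (by omega), hpar4, ⟨?_, ?_, ?_⟩, ?_, ?_, ?_,
    ?_⟩ le_rfl
  · simp only [State.set_mem, h3.mem]
    exact hg.clean.behind
  · simp only [State.set_mem, h3.mem, State.set_reg]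
    rw [Function.update_of_ne (by norm_num), e16']
    exact hg.clean.fresh
  · simp only [State.set_reg]
    rw [Function.update_of_ne (by norm_num), e16']
    exact hg.clean.le
  · simp only [State.set_reg]
    rw [Function.update_of_ne (by norm_num), e16]
    omega
  · simpa using h3.cand_lt
  · simp only [State.set_reg]
    rw [Function.update_of_ne (by norm_num)]
    omega
  · have h5 := h3.time
    have h6 := hg.time
    have h7 := hs.time
    have h8 : (A.repTime + 5) * (k + 1) = (A.repTime + 5) * k + (A.repTime + 5) := by ring
    simp only [State.set_time, State.tick_time] at *
    have h9 : A.repTime = C.rowsTime + A.queriesTime + 20 := rfl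
    omega

/-- With `k` repetitions to go, the probability of a wrong candidate at the end is at most `2 ^ (-k)`
times the potential. -/
theorem mainLoop_spec {C : Cfg} (A : Call C)
    (hε : C.KD * ∑ z, (∏ i, C.w (z i)) * A.err z ≤ 16⁻¹) {T k : ℕ} {s : State}
    (hs : MainInv A T k s) :
    TriL C.E (down 17 (repetition C.ρ C.m A.code)) s (fun s' => penalty (T + 1) (A.out A.I) s')
      (2⁻¹ ^ k * potential (A.out A.I) s) := by
  refine TriL.down_of (MainInv A T) (fun k s => 2⁻¹ ^ k * potential (A.out A.I) s) ?_ ?_ ?_ k s hs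
  · intro k s h
    refine ⟨h.cnt, C.lt_word ?_⟩
    have := h.wf.1 17
    rwa [h.cnt] at this
  · intro k s h
    -- scale the bound for one repetition by the factor of the repetitions to come
    have h1 := (repetition_spec A hε h).affine 0 (b := 2⁻¹ ^ k) (by simp)
    rw [zero_add, ← mul_assoc, ← pow_succ] at h1
    refine h1.mono (fun s' => ?_) le_rfl
    rw [zero_add]
    by_cases hg : s'.reg 17 = k + 1 ∧ MainInv A T k (s'.set 17 k 4)
    · rw [guard_pos hg, guard_pos hg]
      simp [potential]
    · simp only [guard, if_neg hg]
      rw [ENNReal.mul_top (by simp)]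
  · intro s h
    have h1 := h.time
    rw [penalty, if_pos (by simp only [State.tick_time]; omega), pow_zero, one_mul, potential]
    by_cases hc : s.tick.reg 0 = A.out A.I
    · rw [if_pos hc]
      exact bot_le
    · rw [if_neg hc, if_neg (show ¬ s.reg 0 = A.out A.I from hc)]
      exact one_le_pow_of_one_le' (by norm_num) _

/-! ### Computation of the parameters, and the whole program -/

/-- What the computation of the parameters relies on: `ν` is the number of bits of `n`, and `M`
consists of the first `2 * ν` binary digits of `μ`. -/
structure SetupOK (C : Cfg) (m : ℕ → ℕ) : Prop where
  le_n : 2 ^ (C.ν - 1) ≤ C.n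
  table_n : C.E.table 0 = C.n
  m_zero : m 0 = 0
  m_succ : ∀ j < 2 * C.ν, m (j + 1) = 2 * m j + C.E.table (C.n + 3 + j)
  m_last : m (2 * C.ν) = C.M

/-- The loop that computes `ν`, `Z` and `H`. -/
theorem bits_spec {C : Cfg} {m : ℕ → ℕ} (hC : SetupOK C m) {σ : State} (hwf : WF C.B σ)
    (h26 : σ.reg 26 = C.n) (h4 : σ.reg 4 = 0) (h5 : σ.reg 5 = 1) (h6 : σ.reg 6 = 1)
    {f : State → ℝ≥0∞} {v : ℝ≥0∞}
    (hf : ∀ s, WF C.B s → Same [4, 5, 6, 26] σ s → s.mem = σ.mem → s.reg 4 = C.ν → s.reg 5 = C.Z →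
      s.reg 6 = C.H → s.time ≤ σ.time + (17 * C.ν + 1) → f s ≤ v) :
    TriL C.E (while_ 26 (block [
      asg 26 (.var 26 / .const 2),
      asg 4 (.var 4 + .const 1),
      asg 5 (.var 5 * .const 2),
      asg 6 (.var 6 * .const (2 ^ C.wc))])) σ f v := by
  have h4G := C.four_G_lt
  have hν := C.one_le_ν
  have hνZ := C.ν_lt_Z
  have hZG := C.Z_le_G
  have hHG := C.H_le_G
  have hwc : 2 ^ C.wc < C.B := by
    have : 2 ^ C.wc ≤ C.H := Nat.pow_le_pow_right (by norm_num) (Nat.le_mul_of_pos_right _ hν)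
    omega
  refine TriL.while_of (u := 26) (fun k s => k ≤ C.ν ∧ WF C.B s ∧ Same [4, 5, 6, 26] σ s ∧
      s.mem = σ.mem ∧ s.reg 26 = C.n / 2 ^ (C.ν - k) ∧ s.reg 4 = C.ν - k ∧
      s.reg 5 = 2 ^ (C.ν - k) ∧ s.reg 6 = 2 ^ (C.wc * (C.ν - k)) ∧
      s.time + 17 * k ≤ σ.time + 17 * C.ν) (fun _ _ => v) ?_ ?_ ?_ C.ν σ ?_
  · rintro k s ⟨hk, -, -, -, e, -⟩
    rw [e, Nat.div_eq_zero_iff]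
    constructor
    · rintro (h | h)
      · simp at h
      · by_contra h0
        have : 2 ^ (C.ν - k) ≤ 2 ^ (C.ν - 1) := Nat.pow_le_pow_right (by norm_num) (by omega)
        have := hC.le_n
        omega
    · rintro rfl
      exact Or.inr C.n_lt
  · rintro k s ⟨hk, hw, hsame, hmem, e26, e4, e5, e6, ht⟩
    have ek : C.ν - k = C.ν - (k + 1) + 1 := by omega
    set j := C.ν - (k + 1) with hj
    have hpow : 2 ^ (j + 1) ≤ C.Z := Nat.pow_le_pow_right (by norm_num) (by omega)
    have hpow' : 2 ^ (C.wc * (j + 1)) ≤ C.H :=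
      Nat.pow_le_pow_right (by norm_num) (Nat.mul_le_mul_left _ (by omega))
    have hnj : C.n / 2 ^ (j + 1) < C.B := by
      have := C.n_lt_Z
      have := Nat.div_le_self C.n (2 ^ (j + 1))
      omega
    have h1B : 1 < C.B := by omega
    have h2B : 2 < C.B := by omega
    refine TriL.asg_seq C.hE hw.tick (C.n / 2 ^ (j + 1)) (by simp [h2B])
      (by simp [e26, Nat.div_div_eq_div_mul, pow_succ]) ?_
    have hw1 := hw.tick.set 26 4 hnj
    refine TriL.asg_seq C.hE hw1 (j + 1) (by simp [h1B]) (by simp [e4]) ?_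
    have hw2 := hw1.set 4 4 (show j + 1 < C.B by omega)
    refine TriL.asg_seq C.hE hw2 (2 ^ (j + 1)) (by simp [h2B]) (by simp [e5, pow_succ]) ?_
    have hw3 := hw2.set 5 4 (show 2 ^ (j + 1) < C.B by omega)
    refine TriL.asg_of C.hE hw3 (by simp [hwc]) (Nat.le_of_ble_eq_true rfl)
      (z := 2 ^ (C.wc * (j + 1))) (by simp [e6, mul_add, pow_add]) rfl (guard_le ?_ le_rfl)
    refine ⟨by omega, hw3.set 6 4 (by omega), ?_, hmem, by simp [ek], by simp [ek], by simp [ek],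
      by simp [ek], ?_⟩
    · exact (((hsame.tick.set (by decide) _ _).set (by decide) _ _).set (by decide) _ _).set
        (by decide) _ _
    · simp only [State.set_time, State.tick_time]
      show s.time + 1 + 4 + 4 + 4 + 4 + 17 * k ≤ _
      omega
  · rintro s ⟨hk, hw, hsame, hmem, e26, e4, e5, e6, ht⟩
    exact hf _ hw.tick hsame.tick hmem e4 e5 e6 (by simp; omega)
  · exact ⟨le_rfl, hwf, Same.refl _ _, rfl, by simp [h26], by simp [h4], by simp [h5], by simp [h6],
      le_rfl⟩

/-- The loop that computes `M`. -/
theorem digitsOfMu_spec {C : Cfg} {m : ℕ → ℕ} (hC : SetupOK C m) {σ : State} (hwf : WF C.B σ)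
    (h10 : σ.reg 10 = 0) (h23 : σ.reg 23 = 2 * C.ν) (h24 : σ.reg 24 = C.n + 3)
    {f : State → ℝ≥0∞} {v : ℝ≥0∞}
    (hf : ∀ s, WF C.B s → Same [10, 23, 24] σ s → s.mem = σ.mem → s.reg 10 = C.M →
      s.time ≤ σ.time + (40 * C.ν + 1) → f s ≤ v) :
    TriL C.E (down 23 (.seq (asg 10 (.const 2 * .var 10 + .table (.var 24)))
      (asg 24 (.var 24 + .const 1)))) σ f v := by
  have h4G := C.four_G_lt
  have hνZ := C.ν_lt_Z
  have hnZ := C.n_lt_Z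
  have hZG := C.Z_le_G
  have hM : C.M < C.Q := C.M_lt
  have hQG := C.Q_le_G
  have hmono : ∀ i j, i + j = 2 * C.ν → m j ≤ C.M := by
    intro i
    induction i with
    | zero => intro j hj; rw [show j = 2 * C.ν by omega, hC.m_last]
    | succ i ih =>
      intro j hj
      refine le_trans ?_ (ih (j + 1) (by omega))
      rw [hC.m_succ j (by omega)]
      omega
  refine TriL.down_of (u := 23) (fun k s => s.reg 23 = k ∧ k ≤ 2 * C.ν ∧ WF C.B s ∧
      Same [10, 23, 24] σ s ∧ s.mem = σ.mem ∧ s.reg 10 = m (2 * C.ν - k) ∧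
      s.reg 24 = C.n + 3 + (2 * C.ν - k) ∧ s.time + 20 * k ≤ σ.time + 20 * (2 * C.ν))
      (fun _ _ => v) ?_ ?_ ?_ (2 * C.ν) σ ?_
  · exact fun k s h => ⟨h.1, C.lt_word (by omega)⟩
  · rintro k s ⟨e23, hk, hw, hsame, hmem, e10, e24, ht⟩
    have ek : 2 * C.ν - k = 2 * C.ν - (k + 1) + 1 := by omega
    set j := 2 * C.ν - (k + 1) with hj
    have h1B : 1 < C.B := by omega
    have h2B : 2 < C.B := by omega
    have hmj := hmono k (j + 1) (by omega)
    refine TriL.asg_seq C.hE hw.tick (m (j + 1)) (by simp [h2B])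
      (by simp [e10, e24, hC.m_succ j (by omega)]) ?_
    have hw1 := hw.tick.set 10 7 (show m (j + 1) < C.B by omega)
    refine TriL.asg_of C.hE hw1 (by simp [h1B]) (Nat.le_of_ble_eq_true rfl)
      (z := C.n + 3 + (j + 1)) (by simp [e24]; ring) rfl (guard_le ?_ le_rfl)
    refine ⟨by simp [e23], by simp, by omega, (hw1.set 24 4 (by omega)).set 23 4 (by omega), ?_,
      hmem, by simp [ek], by simp [ek], ?_⟩
    · exact ((hsame.tick.set (by decide) _ _).set (by decide) _ _).set (by decide) _ _
    · simp only [State.set_time, State.tick_time]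
      show s.time + 1 + 7 + 4 + 4 + 20 * k ≤ _
      omega
  · rintro s ⟨e23, hk, hw, hsame, hmem, e10, e24, ht⟩
    rw [Nat.sub_zero, hC.m_last] at e10
    exact hf _ hw.tick hsame.tick hmem e10 (by simp; omega)
  · exact ⟨h23, le_rfl, hwf, Same.refl _ _, rfl, by simp [h10, hC.m_zero], by simp [h24], le_rfl⟩

/-- The loop that computes the number of queries. -/
theorem power_spec (C : Cfg) {σ : State} (hwf : WF C.B σ)
    (h12 : σ.reg 12 = C.K) (h13 : σ.reg 13 = 1) (h23 : σ.reg 23 = C.d)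
    {f : State → ℝ≥0∞} {v : ℝ≥0∞}
    (hf : ∀ s, WF C.B s → Same [13, 23] σ s → s.mem = σ.mem → s.reg 13 = C.KD →
      s.time ≤ σ.time + (10 * C.d + 1) → f s ≤ v) :
    TriL C.E (down 23 (asg 13 (.var 13 * .var 12))) σ f v := by
  have h4G := C.four_G_lt
  have hdG := C.d_le_G
  have hZG := C.Z_le_G
  have hKZ := C.KD_le_Z
  refine TriL.down_of (u := 23) (fun k s => s.reg 23 = k ∧ k ≤ C.d ∧ WF C.B s ∧
      Same [13, 23] σ s ∧ s.mem = σ.mem ∧ s.reg 13 = C.K ^ (C.d - k) ∧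
      s.time + 10 * k ≤ σ.time + 10 * C.d)
      (fun _ _ => v) ?_ ?_ ?_ C.d σ ?_
  · exact fun k s h => ⟨h.1, C.lt_word (by omega)⟩
  · rintro k s ⟨e23, hk, hw, hsame, hmem, e13, ht⟩
    have ek : C.d - k = C.d - (k + 1) + 1 := by omega
    set j := C.d - (k + 1) with hj
    have hpow : C.K ^ (j + 1) ≤ C.KD := Nat.pow_le_pow_right C.K_pos (by omega)
    have e12 : s.reg 12 = C.K := (hsame 12 (by decide)).trans h12
    refine TriL.asg_of C.hE hw.tick (by simp) (Nat.le_of_ble_eq_true rfl)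
      (z := C.K ^ (j + 1)) (by simp [e13, e12, pow_succ]) rfl (guard_le ?_ le_rfl)
    refine ⟨by simp [e23], by simp, by omega, (hw.tick.set 13 4 (by omega)).set 23 4 (by omega), ?_,
      hmem, by simp [ek], ?_⟩
    · exact (hsame.tick.set (by decide) _ _).set (by decide) _ _
    · simp only [State.set_time, State.tick_time]
      show s.time + 1 + 4 + 4 + 10 * k ≤ _
      omega
  · rintro s ⟨e23, hk, hw, hsame, hmem, e13, ht⟩
    exact hf _ hw.tick hsame.tick hmem e13 (by simp; omega)
  · exact ⟨h23, le_rfl, hwf, Same.refl _ _, rfl, by simp [h13], le_rfl⟩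

/-- Time for the computation of the parameters. -/
def Cfg.setupTime (C : Cfg) : ℕ := 57 * C.ν + 10 * C.d + 120

/-- What is certain after `setup`. -/
structure SetupPost (C : Cfg) (σ s : State) : Prop where
  wf : WF C.B s
  par : Par C s
  same : Same [2, 3, 4, 5, 6, 7, 8, 9, 10, 11, 12, 13, 14, 15, 16, 23, 24, 26] σ s
  cv : s.reg 16 = 3 * C.G
  mem : s.mem = σ.mem
  time : s.time ≤ σ.time + C.setupTime

theorem setup_spec {C : Cfg} {m : ℕ → ℕ} (hC : SetupOK C m) {σ : State} (hwf : WF C.B σ)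
    (h1 : σ.reg 1 = C.n) {f : State → ℝ≥0∞} {v : ℝ≥0∞} (hf : ∀ s, SetupPost C σ s → f s ≤ v) :
    TriL C.E (setup C.ρ C.c C.wc) σ f v := by
  have h4G := C.four_G_lt
  have hν := C.one_le_ν
  have hνZ := C.ν_lt_Z
  have hnZ := C.n_lt_Z
  have hdG := C.d_le_G
  have hZG := C.Z_le_G
  have hKZ : C.K ≤ C.Z := C.K_le
  have hQG := C.Q_le_G
  have hpB := C.p_lt_B
  have hRB : 2 ^ C.ρ < C.B := C.R_lt_B
  have hTT := C.TT_add_lt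
  have h0B : 0 < C.B := by omega
  have h1B : 1 < C.B := by omega
  have h2B : 2 < C.B := by omega
  have h3B : 3 < C.B := by omega
  have hy : C.y < C.B := by
    have h3 := C.y_add_le
    have h5 : C.R * C.Q ≤ C.Z ^ 3 := by
      rw [C.Q_eq, pow_succ' C.Z 2]
      exact Nat.mul_le_mul_right _ C.R_le
    have h6 := C.Z_pow_le_G 3 (by norm_num)
    omega
  have hl8 : 8 * 2 ^ C.l < C.B := by
    have h1 : 8 * 2 ^ C.ρ * 2 ^ C.l < C.B := C.l_lt
    have h3 : 2 ^ C.l ≤ 2 ^ C.ρ * 2 ^ C.l := Nat.le_mul_of_pos_left _ (by positivity)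
    rw [mul_assoc] at h1
    omega
  have hll : C.l < 2 ^ C.l := Nat.lt_two_pow_self
  have hcl : C.c + 2 ≤ C.l := Nat.le_mul_of_pos_right _ hν
  have hcB : C.c + 2 < C.B := by omega
  let L := [2, 3, 4, 5, 6, 7, 8, 9, 10, 11, 12, 13, 14, 15, 16, 23, 24, 26]
  refine TriL.asg_seq C.hE hwf C.p (by simp [h1B]) (by simp [C.table_p]) ?_
  have hw1 := hwf.set 2 3 hpB
  refine TriL.asg_seq C.hE hw1 C.d (by simp [h2B]) (by simp [C.table_d]) ?_
  have hw2 := hw1.set 3 3 (show C.d < C.B by omega)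
  refine TriL.asg_seq C.hE hw2 0 (by simp [h0B]) (by simp) ?_
  have hw3 := hw2.set 4 2 h0B
  refine TriL.asg_seq C.hE hw3 1 (by simp [h1B]) (by simp) ?_
  have hw4 := hw3.set 5 2 h1B
  refine TriL.asg_seq C.hE hw4 1 (by simp [h1B]) (by simp) ?_
  have hw5 := hw4.set 6 2 h1B
  refine TriL.asg_seq C.hE hw5 C.n (by simp) (by simp [h1]) ?_
  have hw6 := hw5.set 26 2 (show C.n < C.B by omega)
  set s6 := ((((((σ.set 2 C.p 3).set 3 C.d 3).set 4 0 2).set 5 1 2).set 6 1 2).set 26 C.n 2)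
    with hs6
  have same6 : Same L σ s6 :=
    (((((((Same.refl L σ).set (by decide) _ _).set (by decide) _ _).set (by decide) _ _).set
      (by decide) _ _).set (by decide) _ _).set (by decide) _ _)
  refine TriL.seq (g := fun s => guard (WF C.B s ∧ Same [4, 5, 6, 26] s6 s ∧ s.mem = σ.mem ∧
    s.reg 4 = C.ν ∧ s.reg 5 = C.Z ∧ s.reg 6 = C.H ∧ s.time ≤ σ.time + (17 * C.ν + 15)) v) ?_
    fun s7 => TriL.of_guard ?_
  · refine bits_spec hC hw6 (by simp [hs6]) (by simp [hs6]) (by simp [hs6]) (by simp [hs6])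
      fun s g1 g2 g3 g4 g5 g6 g7 => guard_le ⟨g1, g2, g3, g4, g5, g6, ?_⟩ le_rfl
    have : s6.time = σ.time + 14 := by simp [hs6]
    omega
  rintro ⟨hw7, same67, hm7, a4, a5, a6, ht7⟩
  have same7 : Same L σ s7 := same6.trans (same67.mono (by decide))
  have a1 : s7.reg 1 = C.n := (same7 1 (by decide)).trans h1
  have a2 : s7.reg 2 = C.p := by rw [same67 2 (by decide)]; simp [hs6]
  have a3 : s7.reg 3 = C.d := by rw [same67 3 (by decide)]; simp [hs6]
  refine TriL.asg_seq C.hE hw7 C.Q (by simp) (by simp [a5, C.Q_eq, sq]) ?_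
  have hw8 := hw7.set 8 4 (show C.Q < C.B by omega)
  refine TriL.asg_seq C.hE hw8 C.G (by simp) (by simp [a6, C.Q_eq, C.G_eq]; ring) ?_
  have hw9 := hw8.set 7 6 (show C.G < C.B by omega)
  refine TriL.asg_seq C.hE hw9 0 (by simp [h0B]) (by simp) ?_
  have hw10 := hw9.set 10 2 h0B
  refine TriL.asg_seq C.hE hw10 (2 * C.ν) (by simp [h2B]) (by simp [a4]) ?_
  have hw11 := hw10.set 23 4 (show 2 * C.ν < C.B by omega)
  refine TriL.asg_seq C.hE hw11 (C.n + 3) (by simp [h3B]) (by simp [a1]) ?_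
  have hw12 := hw11.set 24 4 (show C.n + 3 < C.B by omega)
  set s12 := (((((s7.set 8 C.Q 4).set 7 C.G 6).set 10 0 2).set 23 (2 * C.ν) 4).set 24 (C.n + 3) 4)
    with hs12
  have same712 : Same [7, 8, 10, 23, 24] s7 s12 :=
    ((((((Same.refl _ s7).set (by decide) _ _).set (by decide) _ _).set (by decide) _ _).set
      (by decide) _ _).set (by decide) _ _)
  refine TriL.seq (g := fun s => guard (WF C.B s ∧ Same [10, 23, 24] s12 s ∧ s.mem = σ.mem ∧
    s.reg 10 = C.M ∧ s.time ≤ σ.time + (57 * C.ν + 36)) v) ?_ fun s13 => TriL.of_guard ?_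
  · refine digitsOfMu_spec hC hw12 (by simp [hs12]) (by simp [hs12]) (by simp [hs12])
      fun s g1 g2 g3 g4 g5 => guard_le ⟨g1, g2, g3.trans hm7, g4, ?_⟩ le_rfl
    have : s12.time = s7.time + 20 := by simp [hs12]
    omega
  rintro ⟨hw13, same1213, hm13, a10, ht13⟩
  have same713 : Same [7, 8, 10, 23, 24] s7 s13 := same712.trans (same1213.mono (by decide))
  have same13 : Same L σ s13 := same7.trans (same713.mono (by decide))
  have a1 := (same713 1 (by decide)).trans a1
  have a2 := (same713 2 (by decide)).trans a2
  have a3 := (same713 3 (by decide)).trans a3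
  have a4 := (same713 4 (by decide)).trans a4
  have a5 := (same713 5 (by decide)).trans a5
  have a6 := (same713 6 (by decide)).trans a6
  have a7 : s13.reg 7 = C.G := by rw [same1213 7 (by decide)]; simp [hs12]
  have a8 : s13.reg 8 = C.Q := by rw [same1213 8 (by decide)]; simp [hs12]
  refine TriL.asg_seq C.hE hw13 C.y (by simp [hRB]) (by simp [a10]; rfl) ?_
  have hw14 := hw13.set 9 4 hy
  refine TriL.asg_seq C.hE hw14 C.l (by simp [hcB]) (by simp [a4]; rfl) ?_
  have hw15 := hw14.set 11 4 (show C.l < C.B by omega)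
  refine TriL.asg_seq C.hE hw15 C.K (by simp [hRB, h1B]) (by simp; rfl) ?_
  have hw16 := hw15.set 12 8 (show C.K < C.B by omega)
  refine TriL.asg_seq C.hE hw16 1 (by simp [h1B]) (by simp) ?_
  have hw17 := hw16.set 13 2 h1B
  refine TriL.asg_seq C.hE hw17 C.d (by simp) (by simp [a3]) ?_
  have hw18 := hw17.set 23 2 (show C.d < C.B by omega)
  set s18 := (((((s13.set 9 C.y 4).set 11 C.l 4).set 12 C.K 8).set 13 1 2).set 23 C.d 2) with hs18
  have same1318 : Same [9, 11, 12, 13, 23] s13 s18 :=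
    ((((((Same.refl _ s13).set (by decide) _ _).set (by decide) _ _).set (by decide) _ _).set
      (by decide) _ _).set (by decide) _ _)
  refine TriL.seq (g := fun s => guard (WF C.B s ∧ Same [13, 23] s18 s ∧ s.mem = σ.mem ∧
    s.reg 13 = C.KD ∧ s.time ≤ σ.time + (57 * C.ν + 10 * C.d + 57)) v) ?_
    fun s19 => TriL.of_guard ?_
  · refine power_spec C hw18 (by simp [hs18]) (by simp [hs18]) (by simp [hs18])
      fun s g1 g2 g3 g4 g5 => guard_le ⟨g1, g2, g3.trans hm13, g4, ?_⟩ le_rfl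
    have : s18.time = s13.time + 20 := by simp [hs18]
    omega
  rintro ⟨hw19, same1819, hm19, a13, ht19⟩
  have same1319 : Same [9, 11, 12, 13, 23] s13 s19 := same1318.trans (same1819.mono (by decide))
  have same19 : Same L σ s19 := same13.trans (same1319.mono (by decide))
  have a1 := (same1319 1 (by decide)).trans a1
  have a2 := (same1319 2 (by decide)).trans a2
  have a3 := (same1319 3 (by decide)).trans a3
  have a4 := (same1319 4 (by decide)).trans a4
  have a5 := (same1319 5 (by decide)).trans a5
  have a6 := (same1319 6 (by decide)).trans a6
  have a7 := (same1319 7 (by decide)).trans a7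
  have a8 := (same1319 8 (by decide)).trans a8
  have a10 := (same1319 10 (by decide)).trans a10
  have a9 : s19.reg 9 = C.y := by rw [same1819 9 (by decide)]; simp [hs18]
  have a11 : s19.reg 11 = C.l := by rw [same1819 11 (by decide)]; simp [hs18]
  have a12 : s19.reg 12 = C.K := by rw [same1819 12 (by decide)]; simp [hs18]
  have e2l : 2 * 2 ^ C.l = 2 ^ (C.l + 1) := by ring
  have hN : 1 ≤ 2 ^ (C.l + 1) - 1 := by
    have : 2 ^ 1 ≤ 2 ^ (C.l + 1) := Nat.pow_le_pow_right (by norm_num) (by omega)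
    omega
  refine TriL.asg_seq C.hE hw19 (2 ^ (C.l + 1) - 1)
    (by simp [h2B, h1B, a11, e2l]; exact ⟨by omega, Nat.one_le_two_pow⟩) (by simp [a11, e2l]) ?_
  have hw20 := hw19.set 26 6 (show 2 ^ (C.l + 1) - 1 < C.B by omega)
  refine TriL.asg_seq C.hE hw20 C.TT (by simp) (by simp [a9, a8]; rfl) ?_
  have hw21 := hw20.set 14 6 (show C.TT < C.B by omega)
  refine TriL.asg_seq C.hE hw21 C.C0
    (by simp [hRB, h1B]; exact Nat.mul_pos (by positivity) hN) (by simp; rfl) ?_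
  have hw22 := hw21.set 15 6 (show C.C0 < C.B by omega)
  refine TriL.asg_of C.hE hw22 (by simp [h3B]) (Nat.le_of_ble_eq_true rfl) (z := 3 * C.G)
    (by simp [a7]) rfl ?_
  refine hf _ ⟨hw22.set 16 4 (by omega), ?_, ?_, by simp, hm19, ?_⟩
  · constructor <;> simp [a1, a2, a3, a4, a5, a6, a7, a8, a9, a10, a11, a12, a13]
  · exact ((((same19.set (by decide) _ _).set (by decide) _ _).set (by decide) _ _).set
      (by decide) _ _)
  · simp only [State.set_time]
    show s19.time + 6 + 6 + 6 + 4 ≤ σ.time + (57 * C.ν + 10 * C.d + 120)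
    omega

/-- A bound for the running time of the whole program. -/
def Call.mainTime {C : Cfg} (A : Call C) : ℕ :=
  C.setupTime + (A.repTime + 5) * (C.ν * C.ν) + 30

/-- The whole program, at a length that is not short, given that the expected number of wrong answers
in a repetition is at most `16⁻¹`. -/
theorem mainProg_spec {C : Cfg} (A : Call C) {m : ℕ → ℕ} (hC : SetupOK C m)
    (hε : C.KD * ∑ z, (∏ i, C.w (z i)) * A.err z ≤ 16⁻¹) {n₀ : ℕ} (h0 : 0 < n₀) (hn : n₀ ≤ C.n) :
    TriL C.E (mainProg n₀ C.ρ C.c C.wc C.m A.code) State.start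
      (fun s' => penalty A.mainTime (A.out A.I) s') (2⁻¹ ^ (C.ν * C.ν)) := by
  have h4G := C.four_G_lt
  have hnZ := C.n_lt_Z
  have hZG := C.Z_le_G
  have hνZ : C.ν * C.ν ≤ C.Z := C.ν_sq
  have h0B : 0 < C.B := by omega
  have hw0 : WF C.B State.start := ⟨fun _ => h0B, fun _ => h0B⟩
  refine TriL.asg_seq C.hE hw0 C.n (by simp [h0B]) (by simp [hC.table_n]) ?_
  have hw1 := hw0.set 1 3 (show C.n < C.B by omega)
  refine TriL.asg_seq C.hE hw1 (C.n / n₀) (by simp; omega) (by simp) ?_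
  have hq : C.n / n₀ < C.B := by have := Nat.div_le_self C.n n₀; omega
  have hw2 := hw1.set 26 4 hq
  refine TriL.cond_of (fun _ => ?_) fun h => ?_
  swap
  · exfalso
    simp only [State.set_reg, Function.update_self, Nat.div_eq_zero_iff] at h
    omega
  set s2 := ((State.start.set 1 C.n 3).set 26 (C.n / n₀) 4).tick with hs2
  have hr2 : ∀ v, v ≠ 1 → v ≠ 26 → s2.reg v = 0 := by
    intro v h1 h2
    simp [hs2, Function.update_of_ne h1, Function.update_of_ne h2]
    rfl
  refine TriL.seq (g := fun s => guard (SetupPost C s2 s) (2⁻¹ ^ (C.ν * C.ν))) 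
    (setup_spec hC hw2.tick (by simp) fun s h => guard_le h le_rfl) fun s3 => TriL.of_guard fun h3 => ?_
  refine TriL.asg_seq C.hE h3.wf (C.ν * C.ν) (by simp) (by simp [h3.par.ν]) ?_
  have hw4 := h3.wf.set 17 4 (show C.ν * C.ν < C.B by omega)
  have e0 : s3.reg 0 = 0 := (h3.same 0 (by decide)).trans (hr2 0 (by norm_num) (by norm_num))
  have e18 : s3.reg 18 = 0 := (h3.same 18 (by decide)).trans (hr2 18 (by norm_num) (by norm_num))
  have ht := h3.time
  have ht2 : s2.time = 8 := by simp [hs2]; rfl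
  have hmem : ∀ a, s3.mem a = 0 := fun a => by rw [h3.mem]; rfl
  have hinv : MainInv A (A.mainTime - 1) (C.ν * C.ν) (s3.set 17 (C.ν * C.ν) 4) := by
    refine ⟨by simp, le_rfl, hw4, ?_, ⟨fun a _ _ => hmem a, fun a _ => hmem a, ?_⟩, ?_, ?_, ?_, ?_⟩
    · exact h3.par.same (L := [17]) ((Same.refl _ s3).set (by decide) _ _) (by decide)
    · simp [h3.cv]
    · have h5 : C.H * C.KD * (C.ν * C.ν) ≤ C.G := by
        rw [C.G_eq, mul_assoc]
        refine Nat.mul_le_mul_left _ ?_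
        calc C.KD * (C.ν * C.ν) ≤ C.Z * C.Z := Nat.mul_le_mul C.KD_le_Z hνZ
          _ = C.Z ^ 2 := by ring
          _ ≤ C.Z ^ 4 := Nat.pow_le_pow_right C.Z_pos (by norm_num)
      simp [h3.cv]
      omega
    · simp [e0]
      exact C.p_pos
    · simp [e18]
    · simp only [State.set_time]
      unfold Call.mainTime
      omega
  have hmt : A.mainTime - 1 + 1 = A.mainTime := by unfold Call.mainTime; omega
  have h6 := mainLoop_spec A hε hinv
  rw [hmt, potential_eq (c := 0) (l := 0) (by simp [e0]) (by simp [e18])] at h6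
  exact h6.mono (fun _ => le_rfl) (by simp)

/-! ### The parameters at one input length -/

/-- The number of bits of `n` (for `0 < n`). -/
def bitLen (n : ℕ) : ℕ := Nat.log 2 n + 1

theorem lt_two_pow_bitLen (n : ℕ) : n < 2 ^ bitLen n := Nat.lt_pow_succ_log_self (by norm_num) n

/-- The number of bits that encode one input bit. -/
def rowLen (ρ c n : ℕ) : ℕ := 2 ^ ρ * ((c + 2) * bitLen n + 1) + 1

/-- The length `n` is large enough for the algorithm. -/
structure Large (μ : ℝ) (ρ c p d n : ℕ) : Prop where
  two_le : 2 ≤ (1 - μ) * n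
  one_le : 1 ≤ μ * n
  eight_le : 8 ≤ n
  p_lt : p < n ^ c
  rowLen_le : rowLen ρ c n ≤ n
  pow_le : rowLen ρ c n ^ d ≤ n
  d_le : d ≤ n

theorem sq_le_two_pow {k : ℕ} (hk : 4 ≤ k) : k * k ≤ 2 ^ k := by
  induction k, hk using Nat.le_induction with
  | base => norm_num
  | succ k hk ih =>
    rw [pow_succ]
    nlinarith

theorem floor_mul_two_pow_succ (μ : ℝ) (j : ℕ) :
    ⌊μ * 2 ^ (j + 1)⌋₊ = 2 * ⌊μ * 2 ^ j⌋₊ + ⌊μ * 2 ^ (j + 1)⌋₊ % 2 := by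
  have h1 : ⌊μ * 2 ^ j⌋₊ = ⌊μ * 2 ^ (j + 1)⌋₊ / 2 := by
    rw [← Nat.floor_div_natCast]
    congr 1
    push_cast
    rw [pow_succ]
    ring
  rw [h1]
  omega

namespace Large

variable {μ : ℝ} {ρ c p d n : ℕ}

theorem four_le_bitLen (h : Large μ ρ c p d n) : 4 ≤ bitLen n := by
  have h1 := h.eight_le
  have h2 := lt_two_pow_bitLen n
  by_contra h3
  have : 2 ^ bitLen n ≤ 2 ^ 3 := Nat.pow_le_pow_right (by norm_num) (by omega)
  omega

theorem pow_le_two_pow (n k : ℕ) : (n : ℝ) ^ k ≤ 2 ^ (k * bitLen n) := by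
  have : (n : ℝ) ≤ 2 ^ bitLen n := by exact_mod_cast (lt_two_pow_bitLen n).le
  calc (n : ℝ) ^ k ≤ (2 ^ bitLen n) ^ k := by gcongr
    _ = _ := by rw [← pow_mul, mul_comm]

theorem two_mul_le (h : Large μ ρ c p d n) (hμ : μ < 1) (k : ℕ) :
    2 * n ≤ (1 - μ) * 2 ^ ((k + 2) * bitLen n) := by
  have hn : (1 : ℝ) ≤ n := by exact_mod_cast (show 1 ≤ n by have := h.eight_le; omega)
  have h1 : (n : ℝ) ^ 2 ≤ n ^ (k + 2) := pow_le_pow_right₀ hn (by omega)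
  have h2 := h1.trans (pow_le_two_pow n (k + 2))
  have h3 := h.two_le
  nlinarith

theorem p_mul_le (h : Large μ ρ c p d n) (hμ : 0 < μ) :
    p * n ≤ μ * 2 ^ ((c + 2) * bitLen n) := by
  have h1 := pow_le_two_pow n (c + 2)
  have h2 := h.one_le
  have h3 : (p : ℝ) ≤ n ^ c := by exact_mod_cast h.p_lt.le
  calc (p : ℝ) * n ≤ n ^ c * n * 1 := by rw [mul_one]; gcongr
    _ ≤ n ^ c * n * (μ * n) := by gcongr
    _ = μ * n ^ (c + 2) := by ring
    _ ≤ _ := by gcongr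

theorem p_le (h : Large μ ρ c p d n) : p ≤ 2 ^ ((c + 2) * bitLen n) := by
  have h1 : n ^ c ≤ (2 ^ bitLen n) ^ c := Nat.pow_le_pow_left (lt_two_pow_bitLen n).le c
  have h2 : (2 ^ bitLen n) ^ c ≤ 2 ^ ((c + 2) * bitLen n) := by
    rw [← pow_mul]
    exact Nat.pow_le_pow_right (by norm_num) (by nlinarith)
  exact h.p_lt.le.trans (h1.trans h2)

theorem two_pow_le (h : Large μ ρ c p d n) : 2 ^ ρ ≤ n := by
  have := h.rowLen_le
  have h2 : 2 ^ ρ * 1 ≤ 2 ^ ρ * ((c + 2) * bitLen n + 1) := Nat.mul_le_mul_left _ (by omega)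
  unfold rowLen at this
  omega

theorem le_mul_floor (h : Large μ ρ c p d n) (hμ : 0 < μ) (hρ : 4 ≤ μ * 2 ^ ρ) :
    2 * 2 ^ (2 * bitLen n) ≤ 2 ^ ρ * ⌊μ * (2 ^ (2 * bitLen n) : ℕ)⌋₊ := by
  have h1 : (2 : ℝ) ^ ρ ≤ 2 ^ (2 * bitLen n) := by
    have h1 := h.two_pow_le.trans (lt_two_pow_bitLen n).le
    have h2 : 2 ^ bitLen n ≤ 2 ^ (2 * bitLen n) := Nat.pow_le_pow_right (by norm_num) (by omega)
    exact_mod_cast h1.trans h2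
  have h2 := Nat.lt_floor_add_one (μ * (2 ^ (2 * bitLen n) : ℕ))
  set M := ⌊μ * (2 ^ (2 * bitLen n) : ℕ)⌋₊
  push_cast at h2
  have h3 : (0 : ℝ) < 2 ^ ρ := by positivity
  have h4 : (0 : ℝ) < 2 ^ (2 * bitLen n) := by positivity
  have : (2 : ℝ) * 2 ^ (2 * bitLen n) ≤ 2 ^ ρ * M := by nlinarith
  exact_mod_cast this

theorem mul_floor_add_le (hμ0 : 0 < μ) (hμ : μ < 1) (hρ : 3 ≤ (1 - μ) * 2 ^ ρ) :
    2 ^ ρ * ⌊μ * (2 ^ (2 * bitLen n) : ℕ)⌋₊ + 3 * 2 ^ (2 * bitLen n) ≤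
      2 ^ ρ * 2 ^ (2 * bitLen n) := by
  have h2 := Nat.floor_le (show 0 ≤ μ * (2 ^ (2 * bitLen n) : ℕ) by positivity)
  set M := ⌊μ * (2 ^ (2 * bitLen n) : ℕ)⌋₊
  push_cast at h2
  have h3 : (0 : ℝ) < 2 ^ ρ := by positivity
  have h4 : (0 : ℝ) < 2 ^ (2 * bitLen n) := by positivity
  have : (2 : ℝ) ^ ρ * M + 3 * 2 ^ (2 * bitLen n) ≤ 2 ^ ρ * 2 ^ (2 * bitLen n) := by nlinarith
  exact_mod_cast this

theorem floor_lt (hμ0 : 0 < μ) (hμ : μ < 1) :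
    ⌊μ * (2 ^ (2 * bitLen n) : ℕ)⌋₊ < 2 ^ (2 * bitLen n) := by
  rw [Nat.floor_lt (by positivity)]
  have h4 : (0 : ℝ) < (2 ^ (2 * bitLen n) : ℕ) := by positivity
  nlinarith

end Large

/-- A common bound for all numbers that occur. -/
def numBound (c wc n : ℕ) : ℕ := 2 ^ ((wc + c + 10) * bitLen n)

theorem lt_numBound {c wc n x k : ℕ} (hx : x < 2 ^ (k * bitLen n)) (hk : k ≤ wc + c + 10) :
    x < numBound c wc n :=
  hx.trans_le (Nat.pow_le_pow_right (by norm_num) (Nat.mul_le_mul_right _ hk))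

theorem Large.table_lt {P : Problem} (G : GoodPolynomial P) {μ : ℝ} {ρ c wc n : ℕ}
    (h : Large μ ρ c (G.p n) (G.d n) n) (a : ℕ) : problemTable G μ n a < numBound c wc n := by
  have hn := lt_two_pow_bitLen n
  have hd := h.d_le
  match a with
  | 0 => exact lt_numBound (k := 1) (by simpa [problemTable] using hn) (by omega)
  | 1 =>
    refine (show G.p n ≤ _ from h.p_le).trans_lt ?_
    exact Nat.pow_lt_pow_right (by norm_num) (Nat.mul_lt_mul_of_pos_right (by omega) (Nat.succ_pos _))
  | 2 => exact lt_numBound (k := 1) (by simpa [problemTable] using (by omega : G.d n < _)) (by omega)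
  | k + 3 =>
    refine lt_numBound (k := 1) ?_ (by omega)
    rw [problemTable, one_mul]
    split_ifs with hk
    · exact (Fin.is_lt _).trans_le (hd.trans hn.le)
    · have := Nat.mod_lt ⌊μ * 2 ^ (k - n + 1)⌋₊ (show 2 > 0 by norm_num)
      have := h.eight_le
      omega

/-- The parameters for an input of large length. -/
noncomputable def config {P : Problem} (G : GoodPolynomial P) {μ : ℝ} (hμ0 : 0 < μ) (hμ1 : μ < 1)
    (B : Algorithm) {ρ c wc : ℕ} (m : ℕ) (hB : 6 * (wc + c + 10) ≤ B.wordConst)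
    (hρ : 4 ≤ μ * 2 ^ ρ) (hρ' : 3 ≤ (1 - μ) * 2 ^ ρ) {n : ℕ}
    (h : Large μ ρ c (G.p n) (G.d n) n) (I : Fin n → Bool) : Cfg where
  n := n
  p := G.p n
  d := G.d n
  ν := bitLen n
  ρ := ρ
  c := c
  wc := wc
  m := m
  M := ⌊μ * (2 ^ (2 * bitLen n) : ℕ)⌋₊
  B := numBound c wc n
  E := B.env G μ n I
  hE := by
    have h2 : 2 ≤ numBound c wc n := by
      refine lt_numBound (k := 1) ?_ (by omega)
      have := lt_two_pow_bitLen n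
      have := h.eight_le
      rw [one_mul]
      omega
    refine ⟨h2, ?_, h.table_lt G, fun a => lt_of_le_of_lt ?_ h2⟩
    · rw [numBound, ← pow_mul]
      refine Nat.pow_le_pow_right (by norm_num) ?_
      calc (wc + c + 10) * bitLen n * 6 = 6 * (wc + c + 10) * bitLen n := by ring
        _ ≤ B.wordConst * bitLen n := Nat.mul_le_mul_right _ hB
    · show (if h : a < n then (I ⟨a, h⟩).toNat else 0) ≤ 1
      split_ifs
      · exact Bool.toNat_le _
      · exact zero_le_one
  n_pos := by have := h.eight_le; omega
  n_lt := lt_two_pow_bitLen n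
  p_gt := (G.p_prime n).one_lt
  p_le := h.p_le
  M_lt := Large.floor_lt hμ0 hμ1
  two_le := h.le_mul_floor hμ0 hρ
  le_R := Large.mul_floor_add_le hμ0 hμ1 hρ'
  K_le := h.rowLen_le.trans (lt_two_pow_bitLen n).le
  KD_le := h.pow_le.trans (lt_two_pow_bitLen n).le
  d_le := h.d_le.trans (lt_two_pow_bitLen n).le
  ν_sq := sq_le_two_pow h.four_le_bitLen
  -- `numBound` leaves room for the memory layout and for the numbers in the expansions
  G_lt := by
    have := h.four_le_bitLen
    rw [numBound, show 4 = 2 ^ 2 by norm_num, ← pow_add]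
    exact Nat.pow_lt_pow_right (by norm_num) (by nlinarith)
  l_lt := by
    have := h.four_le_bitLen
    have h1 := h.two_pow_le.trans (lt_two_pow_bitLen n).le
    calc 8 * 2 ^ ρ * 2 ^ ((c + 2) * bitLen n)
        ≤ 2 ^ 3 * 2 ^ bitLen n * 2 ^ ((c + 2) * bitLen n) := by gcongr; norm_num
      _ = 2 ^ (3 + bitLen n + (c + 2) * bitLen n) := by rw [pow_add, pow_add]
      _ < numBound c wc n := Nat.pow_lt_pow_right (by norm_num) (by nlinarith)
  table_part i hi := by
    show problemTable G μ n (i + 3) < _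
    rw [problemTable, dif_pos hi]
    exact Fin.is_lt _
  table_p := rfl
  table_d := rfl
  input_le a := by
    show (if h : a < n then (I ⟨a, h⟩).toNat else 0) ≤ 1
    split_ifs
    · exact Bool.toNat_le _
    · exact zero_le_one
  -- the probabilities of `Ber(μ)` with the error factor of `bern_le_digit` and `bern_le_last`
  w b := ENNReal.ofReal ((if b then μ else 1 - μ) * (1 + 1 / n))
  bern_le F := by
    have := h.eight_le
    refine bern_le_digit (by positivity) (by positivity) (by omega : 0 < n) rfl hμ0.le ?_ F
    simpa using h.two_mul_le hμ1 0
  bern_last_le r hr F := by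
    have := h.eight_le
    refine bern_le_last (p := G.p n) (by positivity) (by positivity) (by omega : 0 < n) rfl hμ0.le ?_
      (h.two_mul_le hμ1 c) (h.p_mul_le hμ0) hr (h.le_mul_floor hμ0 hρ)
      (Large.mul_floor_add_le hμ0 hμ1 hρ') h.p_le F
    simpa using h.two_mul_le hμ1 0

theorem problemTable_part {P : Problem} (G : GoodPolynomial P) (μ : ℝ) {n : ℕ} (i : Fin n) :
    problemTable G μ n (i + 3) = G.part n i := by
  rw [problemTable, dif_pos i.2]

theorem Algorithm.env_input {P : Problem} (B : Algorithm) (G : GoodPolynomial P) (μ : ℝ) {n : ℕ}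
    (I : Fin n → Bool) (i : Fin n) : (B.env G μ n I).input i = (I i).toNat :=
  dif_pos i.2

section

variable {P : Problem} (G : GoodPolynomial P) {μ : ℝ} (hμ0 : 0 < μ) (hμ1 : μ < 1)
    (B : Algorithm) {A : Algorithm} {T : ℕ → ℕ} {ρ c : ℕ}
    (hB : 6 * (A.wordConst + c + 10) ≤ B.wordConst)
    (hρ : 4 ≤ μ * 2 ^ ρ) (hρ' : 3 ≤ (1 - μ) * 2 ^ ρ) {n : ℕ}
    (h : Large μ ρ c (G.p n) (G.d n) n) (I : Fin n → Bool)

/-- The given algorithm as a subroutine. -/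
noncomputable def call (hT : A.RunsInTime G μ T) :
    Call (config G hμ0 hμ1 B (A.code.bound + 1) hB hρ hρ' h I) where
  code := A.code
  bound_le := Nat.le_succ _
  one_le_m := Nat.succ_pos _
  EA x := A.env G μ n x
  w_eq _ := rfl
  table_eq _ := rfl
  input_eq _ _ := rfl
  out := P n
  out_lt := G.output_lt n
  T := T n
  err x := ENNReal.ofReal (1 - A.successProb G μ n x)
  tri x := (Algorithm.tri_penalty hT n x).2
  part := G.part n
  part_eq := problemTable_part G μ
  f := G.f n
  stronglyPartite := G.stronglyPartite n
  eval_eq := G.eval_eq n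
  I := I
  hI := B.env_input G μ I

theorem setupOK : SetupOK (config G hμ0 hμ1 B (A.code.bound + 1) hB hρ hρ' h I)
    (fun j => ⌊μ * 2 ^ j⌋₊) where
  le_n := Nat.pow_log_le_self 2 (by have := h.eight_le; omega)
  table_n := rfl
  m_zero := by simpa using hμ1
  m_succ j _ := by
    rw [floor_mul_two_pow_succ]
    congr 1
    show _ = problemTable G μ n (n + 3 + j)
    rw [show n + 3 + j = n + j + 3 by ring, problemTable, dif_neg (by omega),
      Nat.add_sub_cancel_left]
  m_last := by
    show ⌊μ * 2 ^ (2 * bitLen n)⌋₊ = ⌊μ * (2 ^ (2 * bitLen n) : ℕ)⌋₊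
    push_cast
    rfl

/-- The weights of a query exceed the product distribution by the factor `(1 + 1 / n) ^ n ≤ 3` at
most, so that the expected error of a query is at most three times the average-case error. -/
theorem sum_err_le (hT : A.RunsInTime G μ T) {δ : ℝ} (hA : 1 - δ ≤ A.avgSuccessProb G μ n) :
    ∑ z : Fin n → Bool, (∏ i, (config G hμ0 hμ1 B (A.code.bound + 1) hB hρ hρ' h I).w (z i)) *
      ENNReal.ofReal (1 - A.successProb G μ n z) ≤ ENNReal.ofReal (3 * δ) := by
  have hn : (0 : ℝ) < n := by exact_mod_cast (show 0 < n by have := h.eight_le; omega)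
  have hw : ∀ b : Bool, 0 ≤ (if b then μ else 1 - μ) := by intro b; split_ifs <;> linarith
  have h1 : ∀ z : Fin n → Bool,
      (∏ i, (config G hμ0 hμ1 B (A.code.bound + 1) hB hρ hρ' h I).w (z i)) *
        ENNReal.ofReal (1 - A.successProb G μ n z) =
      ENNReal.ofReal ((1 + 1 / n) ^ n *
        ((∏ i, if z i then μ else 1 - μ) * (1 - A.successProb G μ n z))) := by
    intro z
    show (∏ i : Fin n, ENNReal.ofReal ((if z i then μ else 1 - μ) * (1 + 1 / n))) * _ = _
    rw [← ENNReal.ofReal_prod_of_nonneg fun i _ => mul_nonneg (hw _) (by positivity),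
      ← ENNReal.ofReal_mul (Finset.prod_nonneg fun i _ => mul_nonneg (hw _) (by positivity)),
      Finset.prod_mul_distrib, Finset.prod_const, Finset.card_univ, Fintype.card_fin]
    ring_nf
  have h2 : ∀ z : Fin n → Bool,
      0 ≤ (∏ i, if z i then μ else 1 - μ) * (1 - A.successProb G μ n z) := fun z =>
    mul_nonneg (Finset.prod_nonneg fun i _ => hw _)
      (sub_nonneg.2 (Algorithm.tri_penalty hT n z).1)
  simp only [h1]
  rw [← ENNReal.ofReal_sum_of_nonneg fun z _ => mul_nonneg (by positivity) (h2 z),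
    ← Finset.mul_sum]
  apply ENNReal.ofReal_le_ofReal
  have h3 : ∑ z : Fin n → Bool, ∏ i, (if z i then μ else 1 - μ) = 1 := by
    have := Finset.prod_univ_sum (fun _ : Fin n => (Finset.univ : Finset Bool))
      (fun _ b => if b then μ else 1 - μ)
    simp only [Fintype.sum_bool, Fintype.piFinset_univ] at this
    rw [← this]
    simp
  have h4 : ∑ z : Fin n → Bool, (∏ i, if z i then μ else 1 - μ) * (1 - A.successProb G μ n z) =
      1 - A.avgSuccessProb G μ n := by
    simp only [mul_sub, mul_one, Finset.sum_sub_distrib, h3]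
    rfl
  have h5 : (1 + 1 / (n : ℝ)) ^ n ≤ 3 := by
    have h6 : (1 + 1 / (n : ℝ)) ^ n ≤ Real.exp 1 := by
      calc (1 + 1 / (n : ℝ)) ^ n ≤ (Real.exp (1 / n)) ^ n := by
            gcongr
            rw [add_comm]
            exact Real.add_one_le_exp _
        _ = Real.exp 1 := by
            rw [← Real.exp_nat_mul]
            congr 1
            field_simp
    exact h6.trans (by linarith [Real.exp_one_lt_d9])
  have h7 : 0 ≤ 1 - A.avgSuccessProb G μ n := by
    rw [← h4]
    exact Finset.sum_nonneg fun z _ => h2 z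
  rw [h4]
  calc _ ≤ 3 * (1 - A.avgSuccessProb G μ n) := by gcongr
    _ ≤ _ := by linarith

/-- The leading constant of the running time. -/
def timeConst (ρ c m : ℕ) : ℕ := (8 * ρ + 40 * 2 ^ ρ + 76) * (c + 4) + 2 * m + 400

/-- The overhead is at most the number of queries times four logarithmic factors: two for the
repetitions and two for the sampling of a row. -/
theorem mainTime_le (hT : A.RunsInTime G μ T) : (call G hμ0 hμ1 B hB hρ hρ' h I hT).mainTime ≤
    timeConst ρ c (A.code.bound + 1) * (bitLen n ^ 4 * (rowLen ρ c n ^ G.d n * (n + T n))) := by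
  set m := A.code.bound + 1
  have e : (call G hμ0 hμ1 B hB hρ hρ' h I hT).mainTime =
      57 * bitLen n + 10 * G.d n + 120 + ((n * ((16 * bitLen n + 8 * ρ + 40 * 2 ^ ρ + 60) *
        ((c + 2) * bitLen n + 2) + 5) + 10) + ((55 * G.d n + 30 * n + 2 * m + 12 * T n + 30 + 5) *
        rowLen ρ c n ^ G.d n + 5) + 20 + 5) * (bitLen n * bitLen n) + 30 := rfl
  rw [e]
  have h4 := h.four_le_bitLen
  have hd := h.d_le
  have hn := h.eight_le
  have hνn : bitLen n ≤ n := by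
    have := Nat.log_lt_self 2 (show n ≠ 0 by omega)
    unfold bitLen
    omega
  have hX : 1 ≤ rowLen ρ c n ^ G.d n := Nat.one_le_pow _ _ (Nat.succ_pos _)
  set ν := bitLen n
  set X := rowLen ρ c n ^ G.d n
  set L := 8 * ρ + 40 * 2 ^ ρ + 76 with hL
  set N := n + T n with hN
  have hNn : n ≤ N := Nat.le_add_right _ _
  have hν1 : 1 ≤ ν := by omega
  have hν2 : 1 ≤ ν ^ 2 := Nat.one_le_pow _ _ (by omega)
  have hXN : N ≤ X * N := Nat.le_mul_of_pos_left _ hX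
  have hYN : X * N ≤ ν ^ 2 * (X * N) := Nat.le_mul_of_pos_left _ hν2
  have hZN : ν ^ 2 * (X * N) ≤ ν ^ 4 * (X * N) := by
    apply Nat.mul_le_mul_right
    exact Nat.pow_le_pow_right (by omega) (by norm_num)
  have g1 : 16 * ν + 8 * ρ + 40 * 2 ^ ρ + 60 ≤ L * ν := by
    have : 8 * ρ + 40 * 2 ^ ρ + 60 ≤ (8 * ρ + 40 * 2 ^ ρ + 60) * ν := Nat.le_mul_of_pos_right _ hν1
    calc 16 * ν + 8 * ρ + 40 * 2 ^ ρ + 60 ≤ 16 * ν + (8 * ρ + 40 * 2 ^ ρ + 60) * ν := by omega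
      _ = L * ν := by rw [hL]; ring
  have g2 : (c + 2) * ν + 2 ≤ (c + 4) * ν := by nlinarith
  have g3 : n * ((16 * ν + 8 * ρ + 40 * 2 ^ ρ + 60) * ((c + 2) * ν + 2)) ≤
      L * (c + 4) * (ν ^ 2 * (X * N)) := by
    calc n * ((16 * ν + 8 * ρ + 40 * 2 ^ ρ + 60) * ((c + 2) * ν + 2))
        ≤ (X * N) * ((L * ν) * ((c + 4) * ν)) := by gcongr; omega
      _ = _ := by ring
  have g4 : (55 * G.d n + 30 * n + 2 * m + 12 * T n + 30 + 5) * X ≤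
      (132 + 2 * m) * (ν ^ 2 * (X * N)) := by
    have : 2 * m * 1 ≤ 2 * m * N := Nat.mul_le_mul_left _ (by omega)
    have g5 : 55 * G.d n + 30 * n + 2 * m + 12 * T n + 30 + 5 ≤ (132 + 2 * m) * N := by
      rw [add_mul]
      omega
    calc _ ≤ (132 + 2 * m) * N * X := Nat.mul_le_mul_right _ g5
      _ = (132 + 2 * m) * (X * N) := by ring
      _ ≤ _ := Nat.mul_le_mul_left _ hYN
  have g6 : n * ((16 * ν + 8 * ρ + 40 * 2 ^ ρ + 60) * ((c + 2) * ν + 2) + 5) + 10 +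
      ((55 * G.d n + 30 * n + 2 * m + 12 * T n + 30 + 5) * X + 5) + 20 + 5 ≤
      (L * (c + 4) + 2 * m + 177) * (ν ^ 2 * (X * N)) := by
    have : (L * (c + 4) + 2 * m + 177) * (ν ^ 2 * (X * N)) = L * (c + 4) * (ν ^ 2 * (X * N)) +
      (132 + 2 * m) * (ν ^ 2 * (X * N)) + 45 * (ν ^ 2 * (X * N)) := by ring
    rw [this, mul_add]
    omega
  have g7 := Nat.mul_le_mul_right (ν * ν) g6
  have g8 : (L * (c + 4) + 2 * m + 177) * (ν ^ 2 * (X * N)) * (ν * ν) =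
      (L * (c + 4) + 2 * m + 177) * (ν ^ 4 * (X * N)) := by ring
  rw [g8] at g7
  have g9 : timeConst ρ c m * (ν ^ 4 * (X * N)) =
      (L * (c + 4) + 2 * m + 177) * (ν ^ 4 * (X * N)) + 223 * (ν ^ 4 * (X * N)) := by
    rw [timeConst, ← hL]
    ring
  rw [g9]
  omega

end

/-! ### Growth rates -/

theorem tendsto_lg : Tendsto lg atTop atTop := Real.tendsto_logb_atTop (by norm_num)

theorem tendsto_lg_natCast : Tendsto (fun n : ℕ => lg n) atTop atTop :=
  tendsto_lg.comp tendsto_natCast_atTop_atTop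

theorem tendsto_lg_div : Tendsto (fun x => lg x / x) atTop (𝓝 0) := by
  have h := Real.isLittleO_log_id_atTop.tendsto_div_nhds_zero.div_const (Real.log 2)
  rw [zero_div] at h
  refine h.congr fun x => ?_
  simp only [lg, Real.logb, id]
  ring

theorem bitLen_le {n : ℕ} : (bitLen n : ℝ) ≤ lg n + 1 := by
  unfold bitLen lg
  push_cast
  gcongr
  exact Real.natLog_le_logb n 2

theorem lg_le_bitLen {n : ℕ} (hn : 0 < n) : lg n ≤ bitLen n := by
  have hn' : (0 : ℝ) < n := by exact_mod_cast hn
  rw [lg, Real.logb_le_iff_le_rpow (by norm_num) hn', Real.rpow_natCast]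
  exact_mod_cast (lt_two_pow_bitLen n).le

theorem two_rpow_lg {x : ℝ} (hx : 0 < x) : (2 : ℝ) ^ lg x = x :=
  Real.rpow_logb (by norm_num) (by norm_num) hx

/-- Powers of `lg n` as powers of `n`. -/
theorem rpow_eq_lg_pow {n : ℕ} (hn : 0 < n) (hlg : 0 < lg n) (k : ℕ) :
    (n : ℝ) ^ (k * lg (lg n) / lg n) = lg n ^ k := by
  have hn' : (0 : ℝ) < n := by exact_mod_cast hn
  calc (n : ℝ) ^ (k * lg (lg n) / lg n) = ((2 : ℝ) ^ lg n) ^ (k * lg (lg n) / lg n) := by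
        rw [two_rpow_lg hn']
    _ = ((2 : ℝ) ^ lg (lg n)) ^ (k : ℝ) := by
        rw [← Real.rpow_mul (by norm_num), ← Real.rpow_mul (by norm_num)]
        congr 1
        field_simp
    _ = lg n ^ k := by rw [two_rpow_lg hlg, Real.rpow_natCast]

/-- The length of a row is of smaller order than `lg n * lg (lg n)`. -/
theorem eventually_rowLen_le (ρ c : ℕ) :
    ∀ᶠ n : ℕ in atTop, (rowLen ρ c n : ℝ) ≤ lg n * lg (lg n) := by
  filter_upwards [tendsto_lg_natCast.eventually_ge_atTop 1,
    (tendsto_lg.comp tendsto_lg_natCast).eventually_ge_atTop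
      ((2 : ℝ) ^ ρ * ((c + 2) * 2 + 1) + 1)] with n h1 h2
  have h3 := bitLen_le (n := n)
  simp only [Function.comp] at h2
  unfold rowLen
  push_cast
  calc (2 : ℝ) ^ ρ * ((c + 2) * bitLen n + 1) + 1
      ≤ 2 ^ ρ * ((c + 2) * (2 * lg n) + lg n) + lg n := by gcongr; linarith
    _ = lg n * (2 ^ ρ * ((c + 2) * 2 + 1) + 1) := by ring
    _ ≤ _ := by gcongr

theorem eventually_lg_lg_le : ∀ᶠ n : ℕ in atTop, lg (lg n) ≤ lg n := by
  filter_upwards [(tendsto_lg_div.comp tendsto_lg_natCast).eventually_le_const zero_lt_one,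
    tendsto_lg_natCast.eventually_gt_atTop 0] with n h1 h2
  simpa [div_le_one h2] using h1

section

variable {P : Problem} (G : GoodPolynomial P)

/-- The exponent `ε` for which `n ^ ε` bounds the overhead of the algorithm. -/
noncomputable def overheadExp (n : ℕ) : ℝ := (2 * G.d n + 5 : ℕ) * lg (lg n) / lg n

theorem tendsto_overheadExp : Tendsto (overheadExp G) atTop (𝓝 0) := by
  have h1 := G.d_isLittleO.tendsto_div_nhds_zero.const_mul 2
  have h2 := (tendsto_lg_div.comp tendsto_lg_natCast).const_mul 5
  have h3 := h1.add h2
  simp only [mul_zero, add_zero] at h3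
  refine h3.congr fun n => ?_
  simp only [overheadExp, Function.comp, div_div_eq_mul_div]
  push_cast
  ring

theorem eventually_lg_pow_le : ∀ᶠ n : ℕ in atTop, lg n ^ (2 * G.d n + 5) ≤ n := by
  filter_upwards [(tendsto_overheadExp G).eventually_le_const zero_lt_one, eventually_ge_atTop 1,
    tendsto_lg_natCast.eventually_gt_atTop 0] with n h1 h2 h3
  rw [← rpow_eq_lg_pow (by omega) h3]
  calc (n : ℝ) ^ _ ≤ (n : ℝ) ^ (1 : ℝ) :=
        Real.rpow_le_rpow_of_exponent_le (by exact_mod_cast h2) h1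
    _ = n := Real.rpow_one _

theorem eventually_d_le : ∀ᶠ n : ℕ in atTop, (G.d n : ℝ) ≤ lg n := by
  filter_upwards [(tendsto_overheadExp G).eventually_le_const zero_lt_one,
    tendsto_lg_natCast.eventually_gt_atTop 0,
    (tendsto_lg.comp tendsto_lg_natCast).eventually_ge_atTop 1] with n h1 h2 h3
  simp only [Function.comp] at h3
  rw [overheadExp, div_le_one h2] at h1
  push_cast at h1
  nlinarith [(Nat.cast_nonneg (G.d n) : (0 : ℝ) ≤ G.d n)]

/-- The number of queries of a repetition. -/
theorem eventually_rowLen_pow_le (ρ c : ℕ) : ∀ᶠ n : ℕ in atTop,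
    (rowLen ρ c n : ℝ) ^ G.d n ≤ lg n ^ (2 * G.d n) := by
  filter_upwards [eventually_rowLen_le ρ c, eventually_lg_lg_le,
    tendsto_lg_natCast.eventually_gt_atTop 0] with n h1 h2 h3
  rw [pow_mul]
  refine pow_le_pow_left₀ (by positivity) (h1.trans ?_) _
  rw [sq]
  gcongr

theorem eventually_large {μ : ℝ} (hμ0 : 0 < μ) (hμ1 : μ < 1) (ρ : ℕ) {c : ℕ}
    (hc : ∀ᶠ n in atTop, G.p n < n ^ c) : ∀ᶠ n in atTop, Large μ ρ c (G.p n) (G.d n) n := by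
  have hlin : ∀ a b : ℝ, 0 < a → ∀ᶠ n : ℕ in atTop, b ≤ a * n := fun a b ha =>
    (tendsto_natCast_atTop_atTop.const_mul_atTop ha).eventually_ge_atTop b
  filter_upwards [hc, hlin (1 - μ) 2 (by linarith), hlin μ 1 hμ0, eventually_ge_atTop 8,
    eventually_rowLen_le ρ c, eventually_lg_lg_le, eventually_lg_pow_le G, eventually_d_le G,
    eventually_rowLen_pow_le G ρ c, tendsto_lg_natCast.eventually_ge_atTop 1]
    with n h1 h2 h3 h4 h5 h6 h7 h8 h9 h10
  have h11 : ∀ k, k ≤ 2 * G.d n + 5 → lg n ^ k ≤ n := fun k hk =>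
    (pow_le_pow_right₀ h10 hk).trans h7
  refine ⟨h2, h3, h4, h1, ?_, ?_, ?_⟩
  · have : (rowLen ρ c n : ℝ) ≤ n := by
      refine le_trans (h5.trans ?_) (h11 2 (by omega))
      rw [sq]
      gcongr
    exact_mod_cast this
  · have : ((rowLen ρ c n) ^ G.d n : ℝ) ≤ n := h9.trans (h11 _ (by omega))
    exact_mod_cast this
  · have : (G.d n : ℝ) ≤ n := h8.trans (by simpa using h11 1 (by omega))
    exact_mod_cast this

/-- The number of queries of a repetition is of smaller order than `g`. -/
theorem eventually_mul_rowLen_pow_le {g : ℕ → ℝ} (ρ c : ℕ)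
    (hg : IsLittleOmega g (fun n : ℕ => lg n ^ G.d n * lg (lg n) ^ G.d n)) :
    ∀ᶠ n : ℕ in atTop, 48 * (rowLen ρ c n : ℝ) ^ G.d n ≤ g n := by
  filter_upwards [eventually_rowLen_le ρ c, hg.eventually_ge_atTop 48,
    tendsto_lg_natCast.eventually_gt_atTop 0,
    (tendsto_lg.comp tendsto_lg_natCast).eventually_gt_atTop 0] with n h1 h2 h3 h4
  simp only [Function.comp] at h4
  rw [le_div_iff₀ (by positivity)] at h2
  refine le_trans ?_ h2
  rw [← mul_pow]
  gcongr

/-- The overhead of the algorithm. -/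
theorem eventually_overhead_le (k ρ c : ℕ) : ∀ᶠ n : ℕ in atTop,
    (k : ℝ) * (bitLen n ^ 4 * (rowLen ρ c n : ℝ) ^ G.d n) ≤ lg n ^ (2 * G.d n + 5) := by
  filter_upwards [eventually_rowLen_pow_le G ρ c, tendsto_lg_natCast.eventually_ge_atTop 1,
    tendsto_lg_natCast.eventually_ge_atTop (16 * k)] with n h1 h2 h3
  have h4 : (bitLen n : ℝ) ≤ 2 * lg n := by linarith [bitLen_le (n := n)]
  calc (k : ℝ) * (bitLen n ^ 4 * (rowLen ρ c n : ℝ) ^ G.d n)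
      ≤ k * ((2 * lg n) ^ 4 * lg n ^ (2 * G.d n)) := by gcongr
    _ = (16 * k) * (lg n ^ 4 * lg n ^ (2 * G.d n)) := by ring
    _ ≤ lg n * (lg n ^ 4 * lg n ^ (2 * G.d n)) := by gcongr
    _ = _ := by ring

end

/-! ### Short inputs -/

theorem penalty_le_one {t out : ℕ} {s : State} (h : s.time ≤ t) : penalty t out s ≤ 1 := by
  rw [penalty, if_pos h]
  split_ifs <;> simp

/-- On short inputs the program halts at once. -/
theorem mainProg_short {E : Env} {n₀ ρ c wc m : ℕ} {code : Prog} (h : E.table 0 < n₀)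
    (hw : n₀ < 2 ^ E.w) (out : ℕ) :
    TriL E (mainProg n₀ ρ c wc m code) State.start (fun s => penalty 20 out s) 1 := by
  refine TriL.seq_eq ((TriL.asg_eval 1 _).mono (fun _ => le_rfl) (guard_le rfl le_rfl)) ?_
  refine TriL.seq_eq ((TriL.asg_eval 26 _).mono (fun _ => le_rfl) (guard_le rfl le_rfl)) ?_
  refine TriL.cond_of (fun h0 => ?_) fun _ => ?_
  · refine absurd ?_ h0
    have e0 : E.table 0 % 2 ^ E.w = E.table 0 := Nat.mod_eq_of_lt (h.trans hw)
    rw [State.set_reg, Function.update_self]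
    show (E.table (0 % 2 ^ E.w) % 2 ^ E.w % 2 ^ E.w % 2 ^ E.w / (n₀ % 2 ^ E.w) % 2 ^ E.w) % 2 ^ E.w = 0
    rw [Nat.zero_mod, e0, e0, e0, Nat.mod_eq_of_lt hw, Nat.div_eq_of_lt h]
    simp
  · refine TriL.skip.mono (fun _ => le_rfl) ?_
    exact penalty_le_one (show 0 + 3 + 4 + 1 + 1 ≤ 20 by norm_num)

theorem TriL.tri {E : Env} {c : Prog} {t out : ℕ} {v : ℝ≥0∞}
    (h : TriL E c State.start (fun s => penalty t out s) v) :
    Tri E c State.start (penalty t out) v := h State.start rfl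

theorem penalty_anti {t t' : ℕ} (h : t ≤ t') (out : ℕ) (s : State) :
    penalty t' out s ≤ penalty t out s := by
  by_cases hs : s.time ≤ t
  · rw [penalty, penalty, if_pos hs, if_pos (hs.trans h)]
  · exact le_top.trans_eq (penalty_eq_top.2 hs).symm

end AvgCase

theorem mainTheorem1 (μ : ℝ) (hμ0 : 0 < μ) (hμ1 : μ < 1)
    (P : AvgCase.Problem) (G : AvgCase.GoodPolynomial P)
    (A : AvgCase.Algorithm) (T : ℕ → ℕ) (hT : A.RunsInTime G μ T)
    (g : ℕ → ℝ)
    (hg : AvgCase.IsLittleOmega g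
      (fun n : ℕ => AvgCase.lg n ^ G.d n * AvgCase.lg (AvgCase.lg n) ^ G.d n))
    (hA : ∀ᶠ n : ℕ in atTop, 1 - 1 / g n ≤ A.avgSuccessProb G μ n) :
    ∃ (B : AvgCase.Algorithm) (S : ℕ → ℕ),
      B.RunsInTime G μ S ∧
      AvgCase.SoftO (fun n => (S n : ℝ)) (fun n => (n : ℝ) + T n) ∧
      ((∃ D, ∀ n, 1 ≤ n → G.d n ≤ D) →
        AvgCase.PolylogO (fun n => (S n : ℝ)) (fun n => (n : ℝ) + T n)) ∧
      ∃ C : ℝ, ∀ (n : ℕ) (I : Fin n → Bool),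
        1 - C * 2 ^ (-(AvgCase.lg n ^ 2)) ≤ B.successProb G μ n I := by
  open AvgCase in
  obtain ⟨c, hc⟩ := G.p_lt
  have hμ' : 0 < 1 - μ := by linarith
  -- a digit is a number of ones among `2 ^ ρ` bits; its fluctuation must stay away from `0` and
  -- `2 ^ ρ`, so that the mean `μ * 2 ^ ρ` needs a constant distance to both
  obtain ⟨ρ, hρ⟩ := pow_unbounded_of_one_lt (max (4 / μ) (3 / (1 - μ))) (one_lt_two (α := ℝ))
  have hρ1 : 4 ≤ μ * 2 ^ ρ := by
    have := (le_max_left _ _).trans hρ.le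
    rwa [div_le_iff₀ hμ0, mul_comm] at this
  have hρ2 : 3 ≤ (1 - μ) * 2 ^ ρ := by
    have := (le_max_right _ _).trans hρ.le
    rwa [div_le_iff₀ hμ', mul_comm] at this
  obtain ⟨n₁, hn₁⟩ := eventually_atTop.1 ((eventually_large G hμ0 hμ1 ρ hc).and
    ((eventually_mul_rowLen_pow_le G ρ c hg).and hA))
  set n₀ := max n₁ 1 with hn₀
  have hn₀pos : 0 < n₀ := by omega
  -- words hold the sixth power of all numbers that occur, and also the constant `n₀`
  set B : Algorithm := ⟨mainProg n₀ ρ c A.wordConst (A.code.bound + 1) A.code,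
    6 * (A.wordConst + c + 10) + n₀⟩ with hBdef
  have hB : 6 * (A.wordConst + c + 10) ≤ B.wordConst := Nat.le_add_right _ _
  set k := timeConst ρ c (A.code.bound + 1) with hk
  set S : ℕ → ℕ := fun n => if n < n₀ then 20 else
    k * (bitLen n ^ 4 * (rowLen ρ c n ^ G.d n * (n + T n))) with hS
  have hshort : ∀ n (I : Fin n → Bool), n < n₀ →
      Tri (B.env G μ n I) B.code State.start (penalty (S n) (P n I)) 1 := by
    intro n I hn
    have hw : n₀ < 2 ^ (B.env G μ n I).w := by
      have h1 : n₀ ≤ B.wordConst * (Nat.log 2 n + 1) := by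
        calc n₀ ≤ B.wordConst := Nat.le_add_left _ _
          _ ≤ _ := Nat.le_mul_of_pos_right _ (Nat.succ_pos _)
      exact Nat.lt_two_pow_self.trans_le (Nat.pow_le_pow_right (by norm_num) h1)
    have hSn : S n = 20 := if_pos hn
    rw [hSn]
    exact (mainProg_short hn hw _).tri
  have hlong : ∀ n (I : Fin n → Bool), n₀ ≤ n →
      Tri (B.env G μ n I) B.code State.start (penalty (S n) (P n I))
        (2⁻¹ ^ (bitLen n * bitLen n)) := by
    intro n I hn
    obtain ⟨h1, h2, h3⟩ := hn₁ n ((le_max_left _ _).trans hn)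
    have hSn : S n = k * (bitLen n ^ 4 * (rowLen ρ c n ^ G.d n * (n + T n))) :=
      if_neg (by omega)
    refine Tri.mono (mainProg_spec (call G hμ0 hμ1 B hB hρ1 hρ2 h1 I hT)
      (setupOK G hμ0 hμ1 B hB hρ1 hρ2 h1 I) ?_ hn₀pos hn).tri
      (fun s => penalty_anti ((mainTime_le G hμ0 hμ1 B hB hρ1 hρ2 h1 I hT).trans_eq hSn.symm) _ s)
      le_rfl
    have hKD : 0 < (rowLen ρ c n : ℝ) ^ G.d n := by
      have : (0 : ℝ) < rowLen ρ c n := by exact_mod_cast Nat.succ_pos _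
      positivity
    have hgpos : 0 < g n := lt_of_lt_of_le (by positivity) h2
    calc ((rowLen ρ c n ^ G.d n : ℕ) : ℝ≥0∞) * _
        ≤ ((rowLen ρ c n ^ G.d n : ℕ) : ℝ≥0∞) * ENNReal.ofReal (3 * (1 / g n)) := by
          gcongr
          exact sum_err_le G hμ0 hμ1 B hB hρ1 hρ2 h1 I hT h3
      _ = ENNReal.ofReal ((rowLen ρ c n : ℝ) ^ G.d n * (3 * (1 / g n))) := by
          rw [ENNReal.ofReal_mul hKD.le]
          congr 1
          rw [← Nat.cast_pow, ENNReal.ofReal_natCast]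
      _ ≤ ENNReal.ofReal (16⁻¹) := by
          apply ENNReal.ofReal_le_ofReal
          rw [mul_one_div, mul_div_assoc', div_le_iff₀ hgpos]
          linarith
      _ = 16⁻¹ := by
          rw [ENNReal.ofReal_inv_of_pos (by norm_num)]
          norm_num
  have hv : ∀ j : ℕ, (2⁻¹ : ℝ≥0∞) ^ j ≠ ⊤ := fun j => by simp
  have hSle : ∀ᶠ n : ℕ in atTop, (S n : ℝ) ≤ lg n ^ (2 * G.d n + 5) * ((n : ℝ) + T n) := by
    filter_upwards [eventually_overhead_le G k ρ c, eventually_ge_atTop n₀] with n h1 h2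
    have hSn : S n = k * (bitLen n ^ 4 * (rowLen ρ c n ^ G.d n * (n + T n))) :=
      if_neg (by omega)
    rw [hSn]
    push_cast
    calc _ = (k : ℝ) * (bitLen n ^ 4 * (rowLen ρ c n : ℝ) ^ G.d n) * ((n : ℝ) + T n) := by ring
      _ ≤ _ := by gcongr
  refine ⟨B, S, ?_, ?_, ?_, ?_⟩
  · intro n I
    rcases lt_or_ge n n₀ with hn | hn
    · exact exists_halting_of_tri (hshort n I hn) ENNReal.one_ne_top
    · exact exists_halting_of_tri (hlong n I hn) (hv _)
  · refine ⟨overheadExp G, tendsto_overheadExp G, ?_⟩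
    filter_upwards [hSle, eventually_ge_atTop 1, tendsto_lg_natCast.eventually_gt_atTop 0]
      with n h1 h2 h3
    rw [overheadExp, rpow_eq_lg_pow (by omega) h3]
    exact h1
  · rintro ⟨D, hD⟩
    refine ⟨2 * D + 5, ?_⟩
    filter_upwards [hSle, eventually_ge_atTop 1, tendsto_lg_natCast.eventually_ge_atTop 1]
      with n h1 h2 h3
    refine h1.trans ?_
    gcongr
    exact hD n h2
  -- the constant makes the claim trivial at the finitely many short lengths
  · refine ⟨1 + ∑ i ∈ Finset.range n₀, (2 : ℝ) ^ (lg i ^ 2), fun n I => ?_⟩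
    have hsum : 0 ≤ ∑ i ∈ Finset.range n₀, (2 : ℝ) ^ (lg i ^ 2) :=
      Finset.sum_nonneg fun i _ => by positivity
    have hpos : (0 : ℝ) < 2 ^ (-(lg n ^ 2)) := by positivity
    rcases lt_or_ge n n₀ with hn | hn
    · refine le_trans ?_ (B.successProb_nonneg G μ n I)
      have h1 : (2 : ℝ) ^ (lg n ^ 2) ≤ ∑ i ∈ Finset.range n₀, (2 : ℝ) ^ (lg i ^ 2) :=
        Finset.single_le_sum (f := fun i : ℕ => (2 : ℝ) ^ (lg i ^ 2)) (fun i _ => by positivity)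
          (Finset.mem_range.2 hn)
      have h2 : (2 : ℝ) ^ (lg n ^ 2) * 2 ^ (-(lg n ^ 2)) = 1 := by
        rw [← Real.rpow_add (by norm_num), add_neg_cancel, Real.rpow_zero]
      refine sub_nonpos.2 (h2.symm.trans_le ?_)
      exact mul_le_mul_of_nonneg_right (h1.trans (le_add_of_nonneg_left zero_le_one)) hpos.le
    · refine le_trans ?_ (Algorithm.le_successProb (hv _) (hlong n I hn))
      have h1 : ((2⁻¹ : ℝ≥0∞) ^ (bitLen n * bitLen n)).toReal ≤ 2 ^ (-(lg n ^ 2)) := by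
        rw [ENNReal.toReal_pow, ENNReal.toReal_inv, ENNReal.toReal_ofNat, inv_pow,
          Real.rpow_neg (by norm_num), ← Real.rpow_natCast]
        have h2 := lg_le_bitLen (show 0 < n by omega)
        have h3 : 0 ≤ lg n := Real.logb_nonneg (by norm_num) (by exact_mod_cast (by omega : 1 ≤ n))
        gcongr
        · norm_num
        · push_cast
          rw [sq]
          exact mul_le_mul h2 h2 h3 (h3.trans h2)
      exact sub_le_sub_left
        (h1.trans (le_mul_of_one_le_left hpos.le (le_add_of_nonneg_right hsum))) 1
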